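/- \textbf{Conventions.} Fix one of the two categories, "algebraic" or "analytic". A function is algebraic near a point if it is analytic there and satisfies near it a nontrivial polynomial equation $P(x,\varphi(x))\equiv 0$ (Nash algebraic), with real coefficients in the real case ($\mathbb C^n=\mathbb R^{2n}$) and complex coefficients in the complex case. A generic submanifold $M\subset\mathbb C^n$ of codimension $d$ is a set which near each $p\in M$ is the zero set of $d$ real algebraic (resp. analytic) functions with independent differentials at $p$, such that $T_pM+JT_pM=T_p\mathbb C^n$; $m=n-d$ is its CR dimension. A subvariety $E\subset M$ is a subset which near each point of $M$ is the common zero set in $M$ of finitely many real algebraic (resp. analytic) functions. Local complex algebraic (resp. analytic) coordinates $t=(z,w)\in\mathbb C^m\times\mathbb C^d$ vanishing at $p\in M$ \emph{represent} $M$ by $\Theta$ if, near $p$, $M$ is given by $\bar w_j=\Theta_j(\bar z,t)$, $j=1,\dots,d$, with $\Theta_j(\zeta,t)$ complex algebraic (resp. analytic) near $0\in\mathbb C^{m+n}$ and $\Theta_j(0)=0$. The mapping of $k$-th order jets of the conjugate complexified Segre varieties is $$J^k\colon(\zeta,t)\longmapsto\Big(\zeta,\big(\tfrac1{\beta!}\partial_\zeta^\beta\Theta_j(\zeta,t)\big)_{1\le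 j\le d,\ |\beta|\le k}\Big),$$ where $(\zeta,t)$ are regarded as coordinates on the complexification $\{\xi=\Theta(\zeta,t)\}$ of $M$; the generic rank $\operatorname{genrk}J^k$ is its maximal rank at points arbitrarily close to $0$. For a representation $\Theta$, the Levi type $\ell$ is the smallest $k$ with $\operatorname{genrk}J^{k+1}=\operatorname{genrk}J^k$, the essential holomorphic dimension is $\operatorname{genrk}J^{\ell}-m$, and $\lambda_0=\operatorname{genrk}J^0-m$, $\lambda_k=\operatorname{genrk}J^k-\operatorname{genrk}J^{k-1}$ $(1\le k\le\ell)$. $M$ is $\ell$-finitely nondegenerate at $p$ if, in coordinates vanishing at $p$ and representing $M$ (equivalently, in all such coordinates), $\ell$ is the smallest integer $k$ such that the Segre mapping $t\mapsto\big(\tfrac1{\beta!}\partial_\zeta^\beta\Theta_j(0,t)\big)_{1\le j\le d,\ |\beta|\le k}$ has rank $n$ at $t=0$. All these notions are also used when $m=0$. \textbf{Theorem.} Let $M$ be a connected real algebraic (resp. analytic) generic submanifold of $\mathbb C^n$ of codimension $d\ge1$ and CR dimension $m=n-d\ge1$. Then there exist integers $n_M$, $\ell_M$, $\lambda_{0,M},\dots,\lambda_{\ell_M,M}\geq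 0$, well defined in the sense that they are the essential holomorphic dimension, the Levi type and the numbers $\lambda_k$ of every representation of $M$ at every point of $M$, and there exists a proper real algebraic (resp. analytic) subvariety $E$ of $M$ such that for every $p\in M\setminus E$ and every system of coordinates $t=(z,w)$ vanishing at $p$ in which $M$ is represented by equations $\bar w_j=\Theta_j(\bar z,t)$: \begin{itemize} \item[(1)] $\lambda_{0,M}=d$, $d\le n_M\le n$ and $\ell_M\le n_M-d$. \item[(2)] For every $k=0,1,\dots,\ell_M$, the mapping $J^k$ has rank $m+\lambda_{0,M}+\cdots+\lambda_{k,M}$ at $0$. \item[(3)] $n_M=d+\lambda_{1,M}+\cdots+\lambda_{\ell_M,M}$, and for every $k\ge\ell_M$ the mapping $J^k$ has rank $m+n_M$ at $0$. \item[(4)] There exists a complex algebraic (resp. analytic) change of coordinates $t'=h(t)$ vanishing at $p$ and defined in a neighborhood of $p$ such that the image of $M$ under $h$ is the product $M'_p\times\Delta^{n-n_M}$ of a real algebraic (resp. analytic) generic submanifold $M'_p\subset\mathbb C^{n_M}$ of codimension $d$ and a complex polydisc $\Delta^{n-n_M}$. Furthermore $M'_p$ is $\ell_M$-finitely nondegenerate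 at its central point $0$; in particular, its essential holomorphic dimension there is $n_M$. \end{itemize} -/

import Mathlib

open Filter Topology

noncomputable section

namespace SegreJets

/-- The two categories: (Nash) algebraic and analytic. -/
inductive Regularity
  | algebraic
  | analytic

/-- Near `p`, the function `f` satisfies a nontrivial polynomial equation `P (x, f x) = 0` with
coefficients in `K`, where `coord x` are the `K`-valued coordinates of the point `x`. -/
def IsAlgebraicAt {K σ E : Type*} [Field K] [TopologicalSpace E]
    (coord : E → σ → K) (f : E → K) (p : E) : Prop :=
  ∃ P : MvPolynomial (Option σ) K, P ≠ 0 ∧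
    ∀ᶠ x in 𝓝 p, MvPolynomial.eval (fun o : Option σ => o.elim (f x) (coord x)) P = 0

/-- The real and imaginary parts of the coordinates of a point of `ℂ^ι`. -/
def realCoords {ι : Type*} (x : ι → ℂ) : ι ⊕ ι → ℝ :=
  Sum.elim (fun i => (x i).re) (fun i => (x i).im)

/-- `f` is a real algebraic (resp. analytic) real-valued function near `p`, on `ℂ^ι = ℝ^{2ι}`. -/
def IsRealRegularAt {ι : Type*} [Fintype ι] (c : Regularity)
    (f : (ι → ℂ) → ℝ) (p : ι → ℂ) : Prop :=
  AnalyticAt ℝ f p ∧ (c = Regularity.algebraic → IsAlgebraicAt realCoords f p)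

/-- `f` is a complex algebraic (resp. holomorphic) function near `p`. -/
def IsComplexRegularAt {ι : Type*} [Fintype ι] (c : Regularity)
    (f : (ι → ℂ) → ℂ) (p : ι → ℂ) : Prop :=
  AnalyticAt ℂ f p ∧ (c = Regularity.algebraic → IsAlgebraicAt (fun x : ι → ℂ => x) f p)

/-- The complex structure `J` (multiplication by `i`) as a real linear map. -/
def complexStructure (ι : Type*) : (ι → ℂ) →ₗ[ℝ] (ι → ℂ) :=
  (Complex.I • (LinearMap.id : (ι → ℂ) →ₗ[ℂ] (ι → ℂ))).restrictScalars ℝ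

/-- `M ⊆ ℂ^ι` is a real algebraic (resp. analytic) generic submanifold of real codimension `d`:
near each of its points `p` it is the zero set of `d` real algebraic (resp. analytic) functions
with independent differentials at `p`, and its tangent space `T` satisfies `T + J T = ℂ^ι`. -/
def IsGenericSubmanifold {ι : Type*} [Fintype ι] (c : Regularity) (d : ℕ)
    (M : Set (ι → ℂ)) : Prop :=
  ∀ p ∈ M, ∃ r : Fin d → (ι → ℂ) → ℝ,
    (∀ j, IsRealRegularAt c (r j) p) ∧
    (∀ᶠ x in 𝓝 p, x ∈ M ↔ ∀ j, r j x = 0) ∧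
    LinearIndependent ℝ (fun j => fderiv ℝ (r j) p) ∧
    ∃ T : Submodule ℝ (ι → ℂ),
      (∀ v, v ∈ T ↔ ∀ j, fderiv ℝ (r j) p v = 0) ∧
      T ⊔ T.map (complexStructure ι) = ⊤

/-- `E` is a real algebraic (resp. analytic) subvariety of the submanifold `M`: near each point
of `M` it is the common zero set in `M` of finitely many real algebraic (resp. analytic)
functions. -/
def IsRealSubvariety {ι : Type*} [Fintype ι] (c : Regularity) (M E : Set (ι → ℂ)) : Prop :=
  E ⊆ M ∧ ∀ p ∈ M, ∃ (N : ℕ) (f : Fin N → (ι → ℂ) → ℝ),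
    (∀ i, IsRealRegularAt c (f i) p) ∧
    ∀ᶠ x in 𝓝 p, x ∈ M → (x ∈ E ↔ ∀ i, f i x = 0)

/-- `h` is complex algebraic (resp. holomorphic) near `p` with invertible differential at `p`. -/
def IsLocalBiholomorphismAt {ι κ : Type*} [Fintype ι] [Fintype κ] (c : Regularity)
    (h : (ι → ℂ) → (κ → ℂ)) (p : ι → ℂ) : Prop :=
  (∀ i, IsComplexRegularAt c (fun x => h x i) p) ∧ Function.Bijective (fderiv ℂ h p)

/-- Coordinates `t = (z, w) ∈ ℂ^m × ℂ^d`. -/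
abbrev CoordSpace (m d : ℕ) : Type := Fin m ⊕ Fin d → ℂ

/-- Coordinates `(ζ, t) = (ζ, z, w) ∈ ℂ^m × ℂ^m × ℂ^d`; they parametrize the extrinsic
complexification `ξ = Θ(ζ, t)`. -/
abbrev ComplexifiedSpace (m d : ℕ) : Type := Fin m ⊕ (Fin m ⊕ Fin d) → ℂ

/-- The local coordinates `h = (z, w)` vanish at `p`, and in these coordinates `M` is given near
`p` by the complex defining equations `conj w_j = Θ_j (conj z, z, w)`, `j = 1, …, d`. -/
structure IsRepresentedBy {ι : Type*} [Fintype ι] {m d : ℕ} (c : Regularity)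
    (M : Set (ι → ℂ)) (p : ι → ℂ) (h : (ι → ℂ) → CoordSpace m d)
    (Θ : Fin d → ComplexifiedSpace m d → ℂ) : Prop where
  coord : IsLocalBiholomorphismAt c h p
  center : h p = 0
  regular : ∀ j, IsComplexRegularAt c (Θ j) 0
  zero : ∀ j, Θ j 0 = 0
  equations : ∀ᶠ x in 𝓝 p, x ∈ M ↔ ∀ j : Fin d,
    (starRingEnd ℂ) (h x (Sum.inr j)) =
      Θ j (Sum.elim (fun i : Fin m => (starRingEnd ℂ) (h x (Sum.inl i))) (h x))

/-- The partial derivative in the `i`-th complex variable. -/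
def partialDeriv {σ : Type*} [Fintype σ] [DecidableEq σ] (i : σ) (f : (σ → ℂ) → ℂ) :
    (σ → ℂ) → ℂ :=
  fun x => fderiv ℂ f x (Pi.single i 1)

/-- The iterated partial derivative `∂_ζ^β`. -/
def zetaDeriv {m d : ℕ} (β : Fin m → ℕ) (f : ComplexifiedSpace m d → ℂ) :
    ComplexifiedSpace m d → ℂ :=
  (List.finRange m).foldr (fun i g => (partialDeriv (Sum.inl i))^[β i] g) f

/-- Multiindices `β ∈ ℕ^m` of length `|β| ≤ k`. -/
abbrev MultiIndex (m k : ℕ) : Type :=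
  {β : Fin m → Fin (k + 1) // ∑ i, (β i : ℕ) ≤ k}

/-- The function `(ζ, t) ↦ (1 / β!) ∂_ζ^β Θ_j (ζ, t)`. -/
def jetCoeff {m d : ℕ} (Θ : Fin d → ComplexifiedSpace m d → ℂ) {k : ℕ} (j : Fin d)
    (β : MultiIndex m k) : ComplexifiedSpace m d → ℂ :=
  fun x => ((∏ i, ((β.1 i : ℕ).factorial) : ℕ) : ℂ)⁻¹ *
    zetaDeriv (fun i => (β.1 i : ℕ)) (Θ j) x

/-- The mapping of `k`-th order jets of the conjugate complexified Segre varieties,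
`(ζ, t) ↦ (ζ, ((1 / β!) ∂_ζ^β Θ_j (ζ, t))_{1 ≤ j ≤ d, |β| ≤ k})`. -/
def segreJet {m d : ℕ} (Θ : Fin d → ComplexifiedSpace m d → ℂ) (k : ℕ) :
    ComplexifiedSpace m d → (Fin m ⊕ Fin d × MultiIndex m k → ℂ) :=
  fun x => Sum.elim (fun i => x (Sum.inl i)) (fun jb => jetCoeff Θ jb.1 jb.2 x)

/-- The `k`-th Segre mapping `t ↦ (Θ_{j,β}(t))_{1 ≤ j ≤ d, |β| ≤ k}`, where
`Θ_j (ζ, t) = ∑_β ζ^β Θ_{j,β}(t)`. -/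
def segreMap {m d : ℕ} (Θ : Fin d → ComplexifiedSpace m d → ℂ) (k : ℕ) :
    CoordSpace m d → (Fin d × MultiIndex m k → ℂ) :=
  fun t jb => jetCoeff Θ jb.1 jb.2 (Sum.elim (fun _ => 0) t)

/-- The rank of a map at a point: the rank of its differential. -/
def rankAt {σ κ : Type*} [Fintype σ] [Fintype κ] (f : (σ → ℂ) → (κ → ℂ)) (x : σ → ℂ) : ℕ :=
  Module.finrank ℂ (LinearMap.range (fderiv ℂ f x : (σ → ℂ) →ₗ[ℂ] (κ → ℂ)))

/-- The generic rank near `x`: the largest `e` such that the rank is at least `e` at points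
arbitrarily close to `x`, i.e. such that some `e × e` minor of the Jacobian matrix does not
vanish identically near `x`. -/
def genericRank {σ κ : Type*} [Fintype σ] [Fintype κ] (f : (σ → ℂ) → (κ → ℂ)) (x : σ → ℂ) : ℕ :=
  sSup {e : ℕ | ∃ᶠ y in 𝓝 x, e ≤ rankAt f y}

/-- `ℓ` is the Levi type: the smallest order at which the generic ranks of the jet mappings
stabilize. -/
def IsLeviType {m d : ℕ} (Θ : Fin d → ComplexifiedSpace m d → ℂ) (ℓ : ℕ) : Prop :=
  IsLeast {k : ℕ | genericRank (segreJet Θ (k + 1)) 0 = genericRank (segreJet Θ k) 0} ℓ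

/-- `N` is the essential holomorphic dimension: `m + N` is the generic rank of the jet mapping
of order the Levi type. -/
def IsEssentialDimension {m d : ℕ} (Θ : Fin d → ComplexifiedSpace m d → ℂ) (N : ℕ) : Prop :=
  ∃ ℓ, IsLeviType Θ ℓ ∧ genericRank (segreJet Θ ℓ) 0 = m + N

/-- `lam 0, …, lam ℓ` are the successive increments of the generic ranks of the jet mappings
of orders `0, …, ℓ` (starting from `m`). -/
def IsLeviMultitype {m d : ℕ} (Θ : Fin d → ComplexifiedSpace m d → ℂ) (ℓ : ℕ)
    (lam : ℕ → ℕ) : Prop :=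
  genericRank (segreJet Θ 0) 0 = m + lam 0 ∧
    ∀ k < ℓ, genericRank (segreJet Θ (k + 1)) 0 = genericRank (segreJet Θ k) 0 + lam (k + 1)

/-- `M` (of codimension `d`) is `ℓ`-finitely nondegenerate at `p`: in coordinates in which `M` is
represented by complex defining equations, `ℓ` is the smallest integer `k` such that the `k`-th
Segre mapping has rank `m + d`, the dimension of the ambient space, at the origin. -/
def IsFinitelyNondegenerateAt {ι : Type*} [Fintype ι] (c : Regularity) (d : ℕ)
    (M : Set (ι → ℂ)) (p : ι → ℂ) (ℓ : ℕ) : Prop :=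
  (∃ (m : ℕ) (h : (ι → ℂ) → CoordSpace m d) (Θ : Fin d → ComplexifiedSpace m d → ℂ),
    IsRepresentedBy c M p h Θ) ∧
  ∀ (m : ℕ) (h : (ι → ℂ) → CoordSpace m d) (Θ : Fin d → ComplexifiedSpace m d → ℂ),
    IsRepresentedBy c M p h Θ → IsLeast {k : ℕ | rankAt (segreMap Θ k) 0 = m + d} ℓ

/-- `M` (of codimension `d`) has essential holomorphic dimension `N` near `p`. -/
def HasEssentialDimensionAt {ι : Type*} [Fintype ι] (c : Regularity) (d : ℕ)
    (M : Set (ι → ℂ)) (p : ι → ℂ) (N : ℕ) : Prop :=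
  (∃ (m : ℕ) (h : (ι → ℂ) → CoordSpace m d) (Θ : Fin d → ComplexifiedSpace m d → ℂ),
    IsRepresentedBy c M p h Θ) ∧
  ∀ (m : ℕ) (h : (ι → ℂ) → CoordSpace m d) (Θ : Fin d → ComplexifiedSpace m d → ℂ),
    IsRepresentedBy c M p h Θ → IsEssentialDimension Θ N

/-- Near `p`, the set `M ⊆ ℂ^ι` is mapped by the biholomorphic coordinates `h` (vanishing at `p`)
onto the product of `M' ⊆ ℂ^a` by a polydisc of `ℂ^b`. Balls of `κ → ℂ` are polydiscs, the norm
being the maximum norm. -/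
def IsLocalProductAt {ι : Type*} [Fintype ι] {a b : ℕ} (c : Regularity) (M : Set (ι → ℂ))
    (p : ι → ℂ) (h : (ι → ℂ) → CoordSpace a b) (M' : Set (Fin a → ℂ)) : Prop :=
  h p = 0 ∧ ∃ (U : Set (ι → ℂ)) (ρ : ℝ), IsOpen U ∧ p ∈ U ∧ 0 < ρ ∧
    (∀ x ∈ U, IsLocalBiholomorphismAt c h x) ∧ Set.InjOn h U ∧
    h '' U = Metric.ball 0 ρ ∧
    h '' (M ∩ U) = {t | (fun i => t (Sum.inl i)) ∈ M' ∧
      (fun i => t (Sum.inr i)) ∈ Metric.ball (0 : Fin b → ℂ) ρ}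

end SegreJets

end

/-! Everything is read off from one family of subspaces. The variables ζ are themselves components
of the jet mapping J^k, so the kernel of its differential lies in the t-directions. It is `segreKer
Θ k y`, the space of vectors v such that the derivative of Θ along v vanishes to order greater than
k in ζ. Ranks of jet mappings are therefore codimensions in a decreasing chain of kernels
(`rankAt_segreJet_add_finrank`).

Invariance. Genericity makes the points of M a set of uniqueness in the complexification
(`IsLocallyRepresentedBy.eventually_eq_zero`), so a change of coordinates of M complexifies to a
transition between the two spaces (ζ, t). Its t-part maps each kernel injectively into the kernel of
the same order, because orders of vanishing survive a biholomorphic substitution in ζ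
(`IsLocallyRepresentedBy.map_mem_segreKer`). Hence the ranks of J^k at points of M, and then the
generic ranks, do not depend on the representation. By the identity theorem generic ranks are
locally constant, so connectedness of M yields one sequence g k
(`IsGenericSubmanifold.exists_genericRank_eq`).

Stabilization. Where the kernels of orders k and k + 1 agree and have constant dimension,
differentiating a section of the kernel along each ζ_i shows that the kernel of order k + 2 is the
same (`segreKer_succ_le`). Hence g increases strictly from g 0 = m + d up to order ℓ_M and is
constant afterwards. This gives all the numerical assertions, with n_M = g ℓ_M - m.

The set E consists of the points where some J^k with k ≤ ℓ_M has rank below g k. It is cut out by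
products of minors, and it is proper because a suitable product does not vanish identically on M.

Product structure. Near a point outside E the kernels of all orders at least ℓ_M coincide. A vector
in the kernel at ζ = 0 then annihilates Θ to infinite order in ζ, hence for all small ζ. These
vectors are tangent to the fibers of a submersion built from the Segre mapping, and Θ(ζ, ·) is
constant on the fibers (`exists_straightening`). The reality of the equations makes M itself a union
of fibers (`IsRepresentedBy.exists_mem_iff`), and M' is a slice transverse to them. A representation
of M' with b = n - n_M dummy variables added represents M, so the ranks for M' are g k - b, and
finite nondegeneracy follows.

Algebraic category. Nash functions are treated as analytic germs algebraic over the coordinate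
germs. This class is stable under derivatives (`isAlgebraic_derivation`), composition
(`IsNashAt.comp`), local inversion (`isAlgebraic_adjoin_exchange`), real and imaginary parts
(`isNashAt_re_im`) and complexification, which is all that the constructions use. -/

noncomputable section

namespace SegreJets

/-! ### Linear algebra: completing a map of given rank, and rank by minors. -/

section LinearAlgebra

variable {K : Type*} [Field K]

/-- `B` extends an isomorphism of the range of `L` with K^r, and `C` extends one of its kernel with
K^s. This turns a map of rank r into part of a coordinate system; it serves for kernel sections, for
adapted coordinates and for straightening. -/
theorem exists_complementary_maps {V X : Type*} [AddCommGroup V] [Module K V]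
    [AddCommGroup X] [Module K X] [FiniteDimensional K V] (L : V →ₗ[K] X) {r s : ℕ}
    (hr : Module.finrank K (LinearMap.range L) = r) (hs : Module.finrank K V = r + s) :
    ∃ (B : X →ₗ[K] (Fin r → K)) (C : V →ₗ[K] (Fin s → K)),
      LinearMap.ker (B ∘ₗ L) = LinearMap.ker L ∧
      Function.Bijective ((B ∘ₗ L).prod C) := by
  have hk : Module.finrank K (LinearMap.ker L) = s := by
    have := LinearMap.finrank_range_add_finrank_ker L
    omega
  let eB : LinearMap.range L ≃ₗ[K] (Fin r → K) := LinearEquiv.ofFinrankEq _ _ (by simpa using hr)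
  let eC : LinearMap.ker L ≃ₗ[K] (Fin s → K) := LinearEquiv.ofFinrankEq _ _ (by simpa using hk)
  obtain ⟨B, hB⟩ := LinearMap.exists_extend (eB : LinearMap.range L →ₗ[K] (Fin r → K))
  obtain ⟨C, hC⟩ := LinearMap.exists_extend (eC : LinearMap.ker L →ₗ[K] (Fin s → K))
  have hBL : ∀ v, B (L v) = eB ⟨L v, v, rfl⟩ := fun v =>
    LinearMap.congr_fun hB ⟨L v, v, rfl⟩
  have hker : LinearMap.ker (B ∘ₗ L) = LinearMap.ker L := by
    ext v
    simp only [LinearMap.mem_ker, LinearMap.comp_apply, hBL, LinearEquiv.map_eq_zero_iff]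
    exact Subtype.ext_iff
  refine ⟨B, C, hker, ?_⟩
  have hinj : Function.Injective ((B ∘ₗ L).prod C) := by
    rw [← LinearMap.ker_eq_bot, LinearMap.ker_eq_bot']
    intro v hv
    have h1 : (B ∘ₗ L) v = 0 := congrArg Prod.fst hv
    have h2 : C v = 0 := congrArg Prod.snd hv
    have h3 : v ∈ LinearMap.ker L := by rw [← hker]; exact h1
    have h4 : C v = eC ⟨v, h3⟩ := LinearMap.congr_fun hC ⟨v, h3⟩
    rw [h4, LinearEquiv.map_eq_zero_iff] at h2
    exact congrArg Subtype.val h2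
  refine ⟨hinj, ?_⟩
  exact (LinearMap.injective_iff_surjective_of_finrank_eq_finrank (by simp [hs])).1 hinj

theorem exists_linearIndependent_rows {κ σ : Type*} [Fintype κ] [Fintype σ]
    (A : Matrix κ σ K) {e : ℕ} (he : e ≤ A.rank) :
    ∃ r : Fin e → κ, LinearIndependent K (fun i => A (r i)) := by
  obtain ⟨b, hb, hspan, hli⟩ := exists_linearIndependent K (Set.range A.row)
  have hfin : b.Finite := (Set.finite_range _).subset hb
  have := hfin.fintype
  have hcard : Fintype.card b = A.rank := by
    rw [Matrix.rank_eq_finrank_span_row, ← hspan, ← finrank_span_eq_card hli, Subtype.range_coe]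
  obtain ⟨f⟩ : Nonempty (Fin e ↪ b) := by
    rw [Function.Embedding.nonempty_iff_card_le]; simpa [hcard] using he
  have : ∀ i, ∃ k, A.row k = (f i : σ → K) := fun i => hb (f i).2
  choose r hr using this
  refine ⟨r, ?_⟩
  have h : (fun i => A (r i)) = Subtype.val ∘ f := funext hr
  rw [h]
  exact hli.comp f f.injective

/-- Independent rows are selected first, then independent columns among the selected rows. Rank
conditions thus become nonvanishing of functions to which the identity theorem applies. -/
theorem le_rank_iff_exists_minor_ne_zero {κ σ : Type*} [Fintype κ] [Fintype σ]
    (A : Matrix κ σ K) (e : ℕ) :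
    e ≤ A.rank ↔ ∃ (r : Fin e → κ) (s : Fin e → σ), (A.submatrix r s).det ≠ 0 := by
  constructor
  · intro he
    obtain ⟨r, hr⟩ := exists_linearIndependent_rows A he
    have h1 : (A.submatrix r id).rank = e := by
      have := LinearIndependent.rank_matrix (M := A.submatrix r id) hr
      simpa using this
    obtain ⟨s, hs⟩ := exists_linearIndependent_rows (A.submatrix r id).transpose
      (e := e) (by rw [Matrix.rank_transpose, h1])
    refine ⟨r, s, ?_⟩
    have h2 : LinearIndependent K ((A.submatrix r s).transpose).row := hs
    have h3 := (Matrix.linearIndependent_rows_iff_isUnit.1 h2)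
    rw [Matrix.isUnit_iff_isUnit_det, Matrix.det_transpose] at h3
    exact h3.ne_zero
  · rintro ⟨r, s, h⟩
    have h1 : (A.submatrix r s).rank = e := by
      have := Matrix.rank_of_isUnit (A.submatrix r s)
        ((Matrix.isUnit_iff_isUnit_det _).2 (isUnit_iff_ne_zero.2 h))
      simpa using this
    rw [← h1]
    exact Matrix.rank_submatrix_le A r s

end LinearAlgebra

/-! ### Iterated partial derivatives and orders of vanishing. -/

section CoordinateDerivatives

variable {σ : Type*} [Fintype σ] [DecidableEq σ]

/-- The iterated partial derivative along a word of coordinate directions. -/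
def coordDeriv (w : List σ) (f : (σ → ℂ) → ℂ) : (σ → ℂ) → ℂ :=
  w.foldr partialDeriv f

@[simp] theorem coordDeriv_nil (f : (σ → ℂ) → ℂ) : coordDeriv [] f = f := rfl

@[simp] theorem coordDeriv_cons (i : σ) (w : List σ) (f : (σ → ℂ) → ℂ) :
    coordDeriv (i :: w) f = partialDeriv i (coordDeriv w f) := rfl

theorem coordDeriv_append (w w' : List σ) (f : (σ → ℂ) → ℂ) :
    coordDeriv (w ++ w') f = coordDeriv w (coordDeriv w' f) := by
  simp [coordDeriv]

theorem analyticAt_fderiv_apply {E : Type*} [NormedAddCommGroup E] [NormedSpace ℂ E]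
    {F : Type*} [NormedAddCommGroup F] [NormedSpace ℂ F] [CompleteSpace F] {f : E → F} {x : E}
    (hf : AnalyticAt ℂ f x) (v : E) : AnalyticAt ℂ (fun y => fderiv ℂ f y v) x :=
  (ContinuousLinearMap.analyticAt (ContinuousLinearMap.apply ℂ F v) _).comp hf.fderiv

theorem analyticAt_partialDeriv {f : (σ → ℂ) → ℂ} {x : σ → ℂ} (hf : AnalyticAt ℂ f x) (i : σ) :
    AnalyticAt ℂ (partialDeriv i f) x :=
  analyticAt_fderiv_apply hf _

theorem analyticAt_coordDeriv {f : (σ → ℂ) → ℂ} {x : σ → ℂ} (hf : AnalyticAt ℂ f x)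
    (w : List σ) : AnalyticAt ℂ (coordDeriv w f) x := by
  induction w with
  | nil => exact hf
  | cons i w ih => exact analyticAt_partialDeriv ih i

theorem partialDeriv_congr {f g : (σ → ℂ) → ℂ} {x : σ → ℂ} (h : f =ᶠ[𝓝 x] g) (i : σ) :
    partialDeriv i f =ᶠ[𝓝 x] partialDeriv i g := by
  filter_upwards [h.fderiv (𝕜 := ℂ)] with y hy
  simp [partialDeriv, hy]

theorem fderiv_fderiv_apply_comm {E : Type*} [NormedAddCommGroup E] [NormedSpace ℂ E]
    {f : E → ℂ} {x : E} (hf : AnalyticAt ℂ f x) (u v : E) :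
    fderiv ℂ (fun y => fderiv ℂ f y u) x v = fderiv ℂ (fun y => fderiv ℂ f y v) x u := by
  have hd : DifferentiableAt ℂ (fderiv ℂ f) x := hf.fderiv.differentiableAt
  have hs : IsSymmSndFDerivAt ℂ f x :=
    (hf.contDiffAt (n := ⊤)).isSymmSndFDerivAt (by simp)
  rw [fderiv_clm_apply hd (differentiableAt_const _), fderiv_clm_apply hd (differentiableAt_const _)]
  simp [hs.eq v u]

theorem partialDeriv_comm {f : (σ → ℂ) → ℂ} {x : σ → ℂ} (hf : AnalyticAt ℂ f x) (i j : σ) :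
    partialDeriv i (partialDeriv j f) =ᶠ[𝓝 x] partialDeriv j (partialDeriv i f) := by
  filter_upwards [hf.eventually_analyticAt] with y hy
  exact fderiv_fderiv_apply_comm hy _ _

/-- Mixed partials commute near points of analyticity, which allows words to replace multi-indices.
-/
theorem coordDeriv_perm {f : (σ → ℂ) → ℂ} {x : σ → ℂ} (hf : AnalyticAt ℂ f x) {w w' : List σ}
    (h : w.Perm w') : coordDeriv w f =ᶠ[𝓝 x] coordDeriv w' f := by
  induction h with
  | nil => exact EventuallyEq.rfl
  | cons i _ ih => exact partialDeriv_congr ih i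
  | swap i j w => exact partialDeriv_comm (analyticAt_coordDeriv hf w) _ _
  | trans _ _ h1 h2 => exact h1.trans h2

/-- A directional derivative commutes with iterated partial derivatives. -/
theorem coordDeriv_fderiv_apply {f : (σ → ℂ) → ℂ} {x : σ → ℂ} (hf : AnalyticAt ℂ f x)
    (w : List σ) (v : σ → ℂ) :
    coordDeriv w (fun y => fderiv ℂ f y v) =ᶠ[𝓝 x] fun y => fderiv ℂ (coordDeriv w f) y v := by
  induction w with
  | nil => exact EventuallyEq.rfl
  | cons i w ih =>
    refine (partialDeriv_congr ih i).trans ?_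
    filter_upwards [(analyticAt_coordDeriv hf w).eventually_analyticAt] with y hy
    exact fderiv_fderiv_apply_comm hy v _

theorem norm_le_sum_norm_apply_single {F : Type*} [NormedAddCommGroup F] [NormedSpace ℂ F]
    (L : (σ → ℂ) →L[ℂ] F) :
    ‖L‖ ≤ ∑ i, ‖L (Pi.single i 1)‖ := by
  refine L.opNorm_le_bound (Finset.sum_nonneg fun i _ => norm_nonneg _) fun v => ?_
  have hv : v = ∑ i, v i • (Pi.single i 1 : σ → ℂ) := by
    ext j; simp [Finset.sum_apply, Pi.single_apply]
  calc ‖L v‖ = ‖∑ i, v i • L (Pi.single i 1)‖ := by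
        conv_lhs => rw [hv, map_sum]
        simp
    _ ≤ ∑ i, ‖v i • L (Pi.single i 1)‖ := norm_sum_le _ _
    _ ≤ ∑ i, ‖L (Pi.single i 1)‖ * ‖v‖ := by
        refine Finset.sum_le_sum fun i _ => ?_
        rw [norm_smul, mul_comm]
        exact mul_le_mul_of_nonneg_left (norm_le_pi_norm v i) (norm_nonneg _)
    _ = (∑ i, ‖L (Pi.single i 1)‖) * ‖v‖ := by rw [Finset.sum_mul]

/-- Mean value inequality on the closed ball of radius `‖y - x‖` about `x`, where the differential
is bounded by a multiple of `‖y - x‖ ^ k`. -/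
theorem isBigO_pow_succ_of_partialDeriv {f : (σ → ℂ) → ℂ} {x : σ → ℂ} (hf : AnalyticAt ℂ f x)
    (hfx : f x = 0) {k : ℕ} (h : ∀ i, partialDeriv i f =O[𝓝 x] fun y => ‖y - x‖ ^ k) :
    f =O[𝓝 x] fun y => ‖y - x‖ ^ (k + 1) := by
  have h1 : (fun y => fderiv ℂ f y) =O[𝓝 x] fun y => ‖y - x‖ ^ k := by
    have h2 : (fun y => ∑ i, ‖partialDeriv i f y‖) =O[𝓝 x] fun y => ‖y - x‖ ^ k :=
      Asymptotics.IsBigO.fun_sum fun i _ => (h i).norm_left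
    refine Asymptotics.IsBigO.trans (Asymptotics.isBigO_of_le _ fun y => ?_) h2
    refine (norm_le_sum_norm_apply_single _).trans (le_abs_self _)
  obtain ⟨C, hC0, hC⟩ := h1.exists_pos
  replace hC := hC.bound
  have hd := hf.eventually_analyticAt
  obtain ⟨ε, hε, hball⟩ := Metric.eventually_nhds_iff_ball.1 (hC.and hd)
  refine Asymptotics.IsBigO.of_bound C ?_
  filter_upwards [Metric.ball_mem_nhds x hε] with y hy
  have hsub : Metric.closedBall x ‖y - x‖ ⊆ Metric.ball x ε := by
    refine Metric.closedBall_subset_ball ?_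
    rwa [← dist_eq_norm]
  have hmv := (convex_closedBall x ‖y - x‖).norm_image_sub_le_of_norm_fderiv_le (𝕜 := ℂ)
    (f := f) (C := C * ‖y - x‖ ^ k) (x := x) (y := y)
    (fun z hz => (hball z (hsub hz)).2.differentiableAt) (fun z hz => ?_)
    (Metric.mem_closedBall_self (norm_nonneg _)) (by simp [dist_eq_norm])
  · rw [hfx, sub_zero] at hmv
    simpa [pow_succ, mul_assoc] using hmv
  · have h3 := (hball z (hsub hz)).1
    have h4 : ‖z - x‖ ≤ ‖y - x‖ := by simpa [dist_eq_norm] using hz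
    calc ‖fderiv ℂ f z‖ ≤ C * ‖‖z - x‖ ^ k‖ := h3
      _ = C * ‖z - x‖ ^ k := by rw [norm_pow, norm_norm]
      _ ≤ C * ‖y - x‖ ^ k := by gcongr

/-- Cauchy's estimate in the i-th variable on the circle of radius `‖y - x‖` about `y`, which costs
one power of `‖y - x‖`. -/
theorem partialDeriv_isBigO {f : (σ → ℂ) → ℂ} {x : σ → ℂ} (hf : AnalyticAt ℂ f x) {k : ℕ}
    (h : f =O[𝓝 x] fun y => ‖y - x‖ ^ (k + 2)) (i : σ) :
    partialDeriv i f =O[𝓝 x] fun y => ‖y - x‖ ^ (k + 1) := by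
  obtain ⟨C, hC0, hC⟩ := h.exists_pos
  replace hC := hC.bound
  obtain ⟨ε, hε, hball⟩ := Metric.eventually_nhds_iff_ball.1 (hC.and hf.eventually_analyticAt)
  -- The circle stays within `2 * ‖y - x‖` of `x`, hence the factor `2 ^ (k + 2)`.
  refine Asymptotics.IsBigO.of_bound (C * 2 ^ (k + 2)) ?_
  filter_upwards [Metric.ball_mem_nhds x (half_pos hε)] with y hy
  -- At the center the circle degenerates; there the differential is zero because `f` is o(‖y - x‖).
  by_cases hyx : y = x
  · have h0 : fderiv ℂ f x = 0 := (h.hasFDerivAt (𝕜 := ℂ) (by omega)).fderiv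
    simp [partialDeriv, hyx, h0]
  have hr : 0 < ‖y - x‖ := norm_pos_iff.2 (sub_ne_zero.2 hyx)
  have hy' : ‖y - x‖ < ε / 2 := by simpa [dist_eq_norm] using hy
  have hline : ∀ s : ℂ, ‖s‖ ≤ ‖y - x‖ → ‖y + s • (Pi.single i 1 : σ → ℂ) - x‖ ≤ 2 * ‖y - x‖ := by
    intro s hs
    have : y + s • (Pi.single i 1 : σ → ℂ) - x = (y - x) + s • (Pi.single i 1 : σ → ℂ) := by abel
    rw [this]
    refine (norm_add_le _ _).trans ?_
    rw [norm_smul, Pi.norm_single, norm_one, mul_one]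
    linarith
  have hmem : ∀ s : ℂ, ‖s‖ ≤ ‖y - x‖ → y + s • (Pi.single i 1 : σ → ℂ) ∈ Metric.ball x ε := by
    intro s hs
    rw [Metric.mem_ball, dist_eq_norm]
    linarith [hline s hs]
  have hg : ∀ s : ℂ, ‖s‖ ≤ ‖y - x‖ →
      DifferentiableAt ℂ (fun s : ℂ => f (y + s • (Pi.single i 1 : σ → ℂ))) s := by
    intro s hs
    have h1 := (hball _ (hmem s hs)).2.differentiableAt
    exact DifferentiableAt.comp s (g := f) h1 (by fun_prop)
  have hcont : DiffContOnCl ℂ (fun s : ℂ => f (y + s • (Pi.single i 1 : σ → ℂ)))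
      (Metric.ball 0 ‖y - x‖) := by
    refine DifferentiableOn.diffContOnCl fun s hs => ?_
    rw [closure_ball _ hr.ne'] at hs
    exact (hg s (by simpa using hs)).differentiableWithinAt
  have key := Complex.norm_deriv_le_of_forall_mem_sphere_norm_le hr hcont
    (C := C * (2 * ‖y - x‖) ^ (k + 2)) (fun s hs => ?_)
  · have hder : deriv (fun s : ℂ => f (y + s • (Pi.single i 1 : σ → ℂ))) 0 = partialDeriv i f y := by
      have h1 : HasFDerivAt f (fderiv ℂ f y) (y + (0:ℂ) • (Pi.single i 1 : σ → ℂ)) := by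
        have := (hball _ (hmem 0 (by simp))).2.differentiableAt.hasFDerivAt
        simpa using this
      have h2 : HasDerivAt (fun s : ℂ => y + s • (Pi.single i 1 : σ → ℂ)) (Pi.single i 1) 0 := by
        simpa using ((hasDerivAt_id (0:ℂ)).smul_const (Pi.single i 1 : σ → ℂ)).const_add y
      exact (h1.comp_hasDerivAt (0:ℂ) h2).deriv
    rw [hder] at key
    refine key.trans (le_of_eq ?_)
    rw [norm_pow, norm_norm, mul_pow, pow_succ ‖y - x‖ (k + 1)]
    field_simp
  · have hs' : ‖s‖ ≤ ‖y - x‖ := by simpa using (le_of_eq (by simpa using hs))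
    calc ‖f (y + s • (Pi.single i 1 : σ → ℂ))‖
        ≤ C * ‖‖y + s • (Pi.single i 1 : σ → ℂ) - x‖ ^ (k + 2)‖ := (hball _ (hmem s hs')).1
      _ = C * ‖y + s • (Pi.single i 1 : σ → ℂ) - x‖ ^ (k + 2) := by rw [norm_pow, norm_norm]
      _ ≤ _ := by gcongr; exact hline s hs'

/-- The growth condition makes no reference to coordinates, so it can be transported by local
biholomorphisms; the vanishing of a list of derivatives cannot be transported directly. -/
theorem coordDeriv_eq_zero_iff_isBigO {f : (σ → ℂ) → ℂ} {x : σ → ℂ} (hf : AnalyticAt ℂ f x)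
    (k : ℕ) :
    (∀ w : List σ, w.length ≤ k → coordDeriv w f x = 0) ↔
      f =O[𝓝 x] fun y => ‖y - x‖ ^ (k + 1) := by
  induction k generalizing f with
  | zero =>
    constructor
    · intro h
      have h0 : f x = 0 := h [] le_rfl
      have := hf.differentiableAt.hasFDerivAt.isBigO_sub
      simpa [h0, Asymptotics.isBigO_norm_right] using this
    · intro h w hw
      obtain rfl : w = [] := List.length_eq_zero_iff.1 (by omega)
      have := h.eq_zero_of_norm_pow (n := 1) one_ne_zero
      simpa using this
  | succ k ih =>
    -- Words are split at their last letter, the derivative applied first, so that induction applies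
    -- to `partialDeriv i f`.
    have key : (∀ w : List σ, w.length ≤ k + 1 → coordDeriv w f x = 0) ↔
        f x = 0 ∧ ∀ i, ∀ w : List σ, w.length ≤ k → coordDeriv w (partialDeriv i f) x = 0 := by
      constructor
      · intro h
        refine ⟨h [] (by simp), fun i w hw => ?_⟩
        have := h (w ++ [i]) (by simpa using hw)
        rwa [coordDeriv_append] at this
      · rintro ⟨h0, h1⟩ w hw
        rcases List.eq_nil_or_concat w with rfl | ⟨w', i, rfl⟩
        · exact h0
        · rw [List.concat_eq_append, coordDeriv_append]
          exact h1 i w' (by simpa using hw)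
    rw [key]
    constructor
    · rintro ⟨h0, h1⟩
      exact isBigO_pow_succ_of_partialDeriv hf h0 fun i =>
        (ih (analyticAt_partialDeriv hf i)).1 (h1 i)
    · intro h
      refine ⟨h.eq_zero_of_norm_pow (by omega), fun i => ?_⟩
      exact (ih (analyticAt_partialDeriv hf i)).2 (partialDeriv_isBigO hf h i)

end CoordinateDerivatives

/-! ### Identity theorems and sets of uniqueness. -/

section Uniqueness

variable {𝕜 : Type*} [RCLike 𝕜] {E F : Type*} [NormedAddCommGroup E] [NormedSpace 𝕜 E]
  [NormedAddCommGroup F] [NormedSpace 𝕜 F]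

/-- The homogeneous terms of the power series vanish one after another: once the lower ones are
zero, the term of degree n is O(‖y‖^(n+1)), hence zero. -/
theorem eventually_eq_zero_of_forall_isBigO [CompleteSpace F] {f : E → F} {x : E}
    (hf : AnalyticAt 𝕜 f x) (h : ∀ k : ℕ, f =O[𝓝 x] fun y => ‖y - x‖ ^ (k + 1)) :
    ∀ᶠ y in 𝓝 x, f y = 0 := by
  obtain ⟨p, hp⟩ := hf
  have hshift : ∀ k : ℕ, (fun y => f (x + y)) =O[𝓝 0] fun y => ‖y‖ ^ (k + 1) := by
    intro k
    have ht : Tendsto (fun y : E => x + y) (𝓝 0) (𝓝 x) := by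
      have : Continuous fun y : E => x + y := by fun_prop
      simpa using this.tendsto 0
    simpa [Function.comp_def] using (h k).comp_tendsto ht
  have key : ∀ n : ℕ, ∀ y : E, p n (fun _ => y) = 0 := by
    intro n
    induction n using Nat.strong_induction_on with
    | _ n ih =>
      have h1 := hp.isBigO_sub_partialSum_pow (n + 1)
      have h2 := (hshift n).sub h1
      have h3 : (fun y => p n (fun _ => y)) =O[𝓝 0] fun y => ‖y‖ ^ (n + 1) := by
        refine h2.congr_left fun y => ?_
        rw [sub_sub_cancel, FormalMultilinearSeries.partialSum, Finset.sum_range_succ,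
          Finset.sum_eq_zero, zero_add]
        intro j hj
        exact ih j (Finset.mem_range.1 hj) y
      exact h3.continuousMultilinearMap_apply_eq_zero
  obtain ⟨r, hr⟩ := hp
  have hball : Metric.eball x r ∈ 𝓝 x := Metric.eball_mem_nhds x hr.r_pos
  filter_upwards [hball] with y hy
  have h1 := hr.hasSum_sub hy
  simp only [key] at h1
  exact h1.unique hasSum_zero

/-- The identity theorem on balls. -/
theorem eq_zero_of_mem_ball_of_eventually [CompleteSpace F] {f : E → F} {x₀ x : E} {ε : ℝ}
    (hf : ∀ y ∈ Metric.ball x₀ ε, AnalyticAt 𝕜 f y) (hx : x ∈ Metric.ball x₀ ε)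
    (h : ∀ᶠ y in 𝓝 x, f y = 0) {y : E} (hy : y ∈ Metric.ball x₀ ε) : f y = 0 := by
  let _ : NormedSpace ℝ E := NormedSpace.restrictScalars ℝ 𝕜 E
  exact AnalyticOnNhd.eqOn_zero_of_preconnected_of_eventuallyEq_zero (𝕜 := 𝕜) hf
    (convex_ball x₀ ε).isPreconnected hx h hy

theorem exists_ball_analyticAt [CompleteSpace F] {f : E → F} {x : E} (hf : AnalyticAt 𝕜 f x) :
    ∃ ε > 0, ∀ y ∈ Metric.ball x ε, AnalyticAt 𝕜 f y :=
  Metric.eventually_nhds_iff_ball.1 hf.eventually_analyticAt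

theorem eventually_eq_zero_of_frequently_eventually [CompleteSpace F] {f : E → F} {x : E}
    (hf : AnalyticAt 𝕜 f x) (h : ∃ᶠ y in 𝓝 x, ∀ᶠ z in 𝓝 y, f z = 0) : ∀ᶠ y in 𝓝 x, f y = 0 := by
  obtain ⟨ε, hε, hball⟩ := exists_ball_analyticAt hf
  obtain ⟨y, hy, hyb⟩ := (h.and_eventually (Metric.ball_mem_nhds x hε)).exists
  filter_upwards [Metric.ball_mem_nhds x hε] with z hz
  exact eq_zero_of_mem_ball_of_eventually hball hyb hy hz

/-- If `f` is nonzero at points arbitrarily close to `x`, then `g` vanishes on a neighborhood of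
such points, and the identity theorem brings this back to `x`. The germ ring is a domain for this
reason. -/
theorem eventually_eq_zero_or_of_smul {A : Type*} [NormedField A] [NormedAlgebra 𝕜 A]
    [CompleteSpace A] {f g : E → A} {x : E}
    (hf : AnalyticAt 𝕜 f x) (hg : AnalyticAt 𝕜 g x) (h : ∀ᶠ y in 𝓝 x, f y * g y = 0) :
    (∀ᶠ y in 𝓝 x, f y = 0) ∨ ∀ᶠ y in 𝓝 x, g y = 0 := by
  rw [or_iff_not_imp_left]
  intro h3
  refine (eventually_eq_zero_of_frequently_eventually hg ?_)
  replace h3 : ∃ᶠ y in 𝓝 x, f y ≠ 0 := not_eventually.1 h3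
  refine (h3.and_eventually (h.eventually_nhds.and
    hf.eventually_continuousAt)).mono ?_
  rintro y ⟨hy, hyy, hc⟩
  filter_upwards [hyy, hc.eventually_ne hy] with z hz hz'
  exact (mul_eq_zero.1 hz).resolve_left hz'

/-- If every analytic function vanishing on `S` has vanishing differential on `S`, then `S` is a
set of uniqueness for analytic functions. -/
theorem eventually_eq_zero_of_eq_zero_on {σ : Type*} [Fintype σ] [DecidableEq σ]
    {S : Set (σ → ℂ)} {x₀ : σ → ℂ} (hx₀ : x₀ ∈ S)
    (hS : ∀ᶠ y in 𝓝 x₀, y ∈ S → ∀ G : (σ → ℂ) → ℂ, AnalyticAt ℂ G y →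
      (∀ᶠ z in 𝓝 y, z ∈ S → G z = 0) → fderiv ℂ G y = 0)
    {f : (σ → ℂ) → ℂ} (hf : AnalyticAt ℂ f x₀) (h : ∀ᶠ z in 𝓝 x₀, z ∈ S → f z = 0) :
    ∀ᶠ z in 𝓝 x₀, f z = 0 := by
  -- The hypothesis on `S` applies to each derivative in turn: if it vanishes on `S`, so do its
  -- partial derivatives. All derivatives therefore vanish at `x₀`.
  have key : ∀ w : List σ, ∀ᶠ z in 𝓝 x₀, z ∈ S → coordDeriv w f z = 0 := by
    intro w
    induction w with
    | nil => exact h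
    | cons i w ih =>
      filter_upwards [ih.eventually_nhds, hS, (analyticAt_coordDeriv hf w).eventually_analyticAt]
        with z h1 h2 h3 hz
      simp [coordDeriv_cons, partialDeriv, h2 hz _ h3 h1]
  exact eventually_eq_zero_of_forall_isBigO hf fun k =>
    (coordDeriv_eq_zero_iff_isBigO hf k).1 fun w _ => (key w).self_of_nhds hx₀

end Uniqueness

/-! ### Sections of kernels of constant dimension. -/

section ConstantRank

variable {Y X Z : Type*} [NormedAddCommGroup Y] [NormedSpace ℂ Y] [NormedAddCommGroup X]
  [NormedSpace ℂ X] [FiniteDimensional ℂ X] [NormedAddCommGroup Z] [NormedSpace ℂ Z]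
  [FiniteDimensional ℂ Z]

/-- Kernels of constant dimension have differentiable sections through each of their vectors. -/
theorem exists_differentiableAt_section_ker {A : Y → X →L[ℂ] Z} {y₀ : Y}
    (hA : DifferentiableAt ℂ A y₀)
    (hrank : ∀ᶠ y in 𝓝 y₀, Module.finrank ℂ (LinearMap.ker (A y : X →ₗ[ℂ] Z)) =
      Module.finrank ℂ (LinearMap.ker (A y₀ : X →ₗ[ℂ] Z)))
    {v₀ : X} (hv₀ : A y₀ v₀ = 0) :
    ∃ v : Y → X, v y₀ = v₀ ∧ DifferentiableAt ℂ v y₀ ∧ ∀ᶠ y in 𝓝 y₀, A y (v y) = 0 := by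
  obtain ⟨r, hr⟩ : ∃ r, Module.finrank ℂ (LinearMap.range (A y₀ : X →ₗ[ℂ] Z)) = r := ⟨_, rfl⟩
  obtain ⟨s, hs⟩ : ∃ s, Module.finrank ℂ (LinearMap.ker (A y₀ : X →ₗ[ℂ] Z)) = s := ⟨_, rfl⟩
  have hrs : Module.finrank ℂ X = r + s := by
    rw [← hr, ← hs]; exact (LinearMap.finrank_range_add_finrank_ker _).symm
  obtain ⟨B, C, hker, hbij⟩ := exists_complementary_maps (A y₀ : X →ₗ[ℂ] Z) hr hrs
  rw [hs] at hrank
  let B' : Z →L[ℂ] (Fin r → ℂ) := LinearMap.toContinuousLinearMap B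
  let C' : X →L[ℂ] (Fin s → ℂ) := LinearMap.toContinuousLinearMap C
  let N : Y → X →L[ℂ] (Fin r → ℂ) × (Fin s → ℂ) := fun y => (B' ∘L A y).prod C'
  have : CompleteSpace X := FiniteDimensional.complete ℂ X
  let e : X ≃L[ℂ] (Fin r → ℂ) × (Fin s → ℂ) :=
    (LinearEquiv.ofBijective ((B ∘ₗ (A y₀ : X →ₗ[ℂ] Z)).prod C) hbij).toContinuousLinearEquiv
  have he : (e : X →L[ℂ] _) = N y₀ := by ext <;> rfl
  have hN : DifferentiableAt ℂ N y₀ := by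
    have h1 : DifferentiableAt ℂ (fun y => B' ∘L A y) y₀ :=
      ((ContinuousLinearMap.compL ℂ X Z (Fin r → ℂ)) B').differentiableAt.comp y₀ hA
    exact ((ContinuousLinearMap.prodₗᵢ (𝕜 := ℂ) (E := X) (F := Fin r → ℂ)
      (G := Fin s → ℂ) ℂ).toContinuousLinearEquiv.differentiableAt).comp y₀
        (h1.prodMk (differentiableAt_const C'))
  -- `N y = (B ∘ A y, C)` is invertible at `y₀`, hence nearby. The section keeps the value `N y₀ v₀`
  -- of these coordinates, whose first component is zero.
  refine ⟨fun y => (N y).inverse (N y₀ v₀), ?_, ?_, ?_⟩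
  · change (N y₀).inverse (N y₀ v₀) = v₀
    rw [← he, ContinuousLinearMap.inverse_equiv]
    exact e.symm_apply_apply v₀
  · have h1 : DifferentiableAt ℂ (ContinuousLinearMap.inverse (R := ℂ) (M := X)
        (M₂ := (Fin r → ℂ) × (Fin s → ℂ))) (N y₀) := by
      rw [← he]
      exact (contDiffAt_map_inverse (n := 1) e).differentiableAt one_ne_zero
    exact (h1.comp y₀ hN).clm_apply (differentiableAt_const _)
  · have hequiv : ∀ᶠ y in 𝓝 y₀, N y ∈ Set.range ((↑) : (X ≃L[ℂ] (Fin r → ℂ) × (Fin s → ℂ)) → _) :=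
      hN.continuousAt.eventually (he ▸ ContinuousLinearEquiv.nhds e)
    filter_upwards [hequiv, hrank] with y ⟨g, hg⟩ hy
    have h1 : N y ((N y).inverse (N y₀ v₀)) = N y₀ v₀ := by
      rw [← hg, ContinuousLinearMap.inverse_equiv]
      exact g.apply_symm_apply _
    set v := (N y).inverse (N y₀ v₀)
    have h2 : B (A y v) = 0 := by
      have : B (A y v) = B (A y₀ v₀) := congrArg Prod.fst h1
      rw [this, hv₀, map_zero]
    -- By construction the section lies only in the kernel of `B ∘ A y`; constancy of the dimension
    -- identifies it with the kernel of `A y`.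
    have hle : LinearMap.ker (A y : X →ₗ[ℂ] Z) ≤ LinearMap.ker (B ∘ₗ (A y : X →ₗ[ℂ] Z)) :=
      LinearMap.ker_le_ker_comp _ _
    have hsurj : Function.Surjective (B ∘ₗ (A y : X →ₗ[ℂ] Z)) := by
      intro z
      obtain ⟨x, hx⟩ := g.surjective (z, 0)
      refine ⟨x, ?_⟩
      have : N y x = (z, 0) := by rw [← hg]; exact hx
      exact congrArg Prod.fst this
    have hdim : Module.finrank ℂ (LinearMap.ker (B ∘ₗ (A y : X →ₗ[ℂ] Z))) = s := by
      have h3 := LinearMap.finrank_range_add_finrank_ker (B ∘ₗ (A y : X →ₗ[ℂ] Z))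
      rw [LinearMap.range_eq_top.2 hsurj, finrank_top, Module.finrank_fin_fun] at h3
      omega
    have heq := Submodule.eq_of_le_of_finrank_eq hle (hy.trans hdim.symm)
    have : v ∈ LinearMap.ker (B ∘ₗ (A y : X →ₗ[ℂ] Z)) := h2
    rw [← heq] at this
    exact this

end ConstantRank

/-! ### Kernels of the jet mappings. -/

section SegreKernel

variable {m d : ℕ}

theorem iterate_partialDeriv {σ : Type*} [Fintype σ] [DecidableEq σ] (i : σ) (n : ℕ)
    (f : (σ → ℂ) → ℂ) :
    (partialDeriv i)^[n] f = coordDeriv (List.replicate n i) f := by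
  induction n with
  | zero => rfl
  | succ n ih => rw [Function.iterate_succ_apply', ih, List.replicate_succ, coordDeriv_cons]

/-- The increasing word with prescribed multiplicities. -/
def multiIndexWord (β : Fin m → ℕ) : List (Fin m) :=
  (List.finRange m).flatMap fun i => List.replicate (β i) i

theorem zetaDeriv_eq_coordDeriv (β : Fin m → ℕ) (f : ComplexifiedSpace m d → ℂ) :
    zetaDeriv β f = coordDeriv ((multiIndexWord β).map Sum.inl) f := by
  unfold zetaDeriv multiIndexWord
  induction List.finRange m with
  | nil => rfl
  | cons i l ih =>
    rw [List.foldr_cons, ih, iterate_partialDeriv, List.flatMap_cons, List.map_append,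
      coordDeriv_append, List.map_replicate]

theorem length_multiIndexWord (β : Fin m → ℕ) : (multiIndexWord β).length = ∑ i, β i := by
  simp [multiIndexWord, List.length_flatMap, Fin.sum_univ_def]

theorem perm_multiIndexWord_count (w : List (Fin m)) :
    w.Perm (multiIndexWord fun i => w.count i) := by
  rw [List.perm_iff_count]
  intro a
  simp [multiIndexWord, List.count_flatMap, List.count_replicate, Function.comp_def,
    ← Fin.sum_univ_def]

/-- The inclusion of the `t`-directions. -/
def tangentInr : CoordSpace m d →L[ℂ] ComplexifiedSpace m d :=
  LinearMap.toContinuousLinearMap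
    { toFun := fun v => Sum.elim (fun _ => 0) v
      map_add' := fun u v => by ext (_ | _) <;> simp
      map_smul' := fun a v => by ext (_ | _) <;> simp }

@[simp] theorem tangentInr_inl (v : CoordSpace m d) (i : Fin m) :
    (tangentInr v : ComplexifiedSpace m d) (Sum.inl i) = 0 := rfl

@[simp] theorem tangentInr_inr (v : CoordSpace m d) (i : Fin m ⊕ Fin d) :
    (tangentInr v : ComplexifiedSpace m d) (Sum.inr i) = v i := rfl

theorem tangentInr_injective : Function.Injective (tangentInr (m := m) (d := d)) := by
  intro u v h
  ext i
  exact congrFun h (Sum.inr i)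

/-- The vectors `v` for which the `t`-derivative of `Θ` along `v` has vanishing `ζ`-jet of
order `k`. -/
def segreKer (Θ : Fin d → ComplexifiedSpace m d → ℂ) (k : ℕ) (y : ComplexifiedSpace m d) :
    Submodule ℂ (CoordSpace m d) where
  carrier := {v | ∀ (j : Fin d) (w : List (Fin m)), w.length ≤ k →
    fderiv ℂ (coordDeriv (w.map Sum.inl) (Θ j)) y (tangentInr v) = 0}
  zero_mem' := by
    intro j w _
    rw [map_zero, map_zero]
  add_mem' := by
    intro u v hu hv j w hw
    rw [map_add, map_add, hu j w hw, hv j w hw, add_zero]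
  smul_mem' := by
    intro a v hv j w hw
    rw [map_smul, map_smul, hv j w hw, smul_zero]

theorem mem_segreKer {Θ : Fin d → ComplexifiedSpace m d → ℂ} {k : ℕ} {y : ComplexifiedSpace m d}
    {v : CoordSpace m d} : v ∈ segreKer Θ k y ↔ ∀ (j : Fin d) (w : List (Fin m)), w.length ≤ k →
      fderiv ℂ (coordDeriv (w.map Sum.inl) (Θ j)) y (tangentInr v) = 0 := Iff.rfl

theorem segreKer_anti (Θ : Fin d → ComplexifiedSpace m d → ℂ) (y : ComplexifiedSpace m d) :
    Antitone fun k => segreKer Θ k y :=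
  fun _ _ h _ hv j w hw => hv j w (hw.trans h)

variable {Θ : Fin d → ComplexifiedSpace m d → ℂ} {y : ComplexifiedSpace m d}

theorem analyticAt_jetCoeff (hΘ : ∀ j, AnalyticAt ℂ (Θ j) y) {k : ℕ} (j : Fin d)
    (β : MultiIndex m k) : AnalyticAt ℂ (jetCoeff Θ j β) y := by
  unfold jetCoeff
  rw [zetaDeriv_eq_coordDeriv]
  exact analyticAt_const.mul (analyticAt_coordDeriv (hΘ j) _)

theorem analyticAt_segreJet (hΘ : ∀ j, AnalyticAt ℂ (Θ j) y) (k : ℕ) :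
    AnalyticAt ℂ (segreJet Θ k) y := by
  rw [analyticAt_pi_iff]
  rintro (i | ⟨j, β⟩)
  · exact (ContinuousLinearMap.proj (R := ℂ) (φ := fun _ => ℂ)
      (Sum.inl i : Fin m ⊕ (Fin m ⊕ Fin d))).analyticAt y
  · exact analyticAt_jetCoeff hΘ j β

/-- The factors 1/β! are nonzero, and every word is a permutation of the increasing word with the
same letter counts. -/
theorem fderiv_jetCoeff_eq_zero_iff (hΘ : ∀ j, AnalyticAt ℂ (Θ j) y) (k : ℕ)
    (v : ComplexifiedSpace m d) :
    (∀ (j : Fin d) (β : MultiIndex m k), fderiv ℂ (jetCoeff Θ j β) y v = 0) ↔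
      ∀ (j : Fin d) (w : List (Fin m)), w.length ≤ k →
        fderiv ℂ (coordDeriv (w.map Sum.inl) (Θ j)) y v = 0 := by
  have hjet : ∀ (j : Fin d) (β : MultiIndex m k), fderiv ℂ (jetCoeff Θ j β) y v = 0 ↔
      fderiv ℂ (coordDeriv ((multiIndexWord fun i => (β.1 i : ℕ)).map Sum.inl) (Θ j)) y v = 0 := by
    intro j β
    unfold jetCoeff
    rw [zetaDeriv_eq_coordDeriv, fderiv_const_mul
      (analyticAt_coordDeriv (hΘ j) _).differentiableAt]
    have : ((∏ i, ((β.1 i : ℕ).factorial) : ℕ) : ℂ)⁻¹ ≠ 0 := by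
      refine inv_ne_zero (Nat.cast_ne_zero.2 ?_)
      exact Finset.prod_ne_zero_iff.2 fun i _ => Nat.factorial_ne_zero _
    simp only [smul_apply, smul_eq_mul]
    rw [mul_eq_zero, or_iff_right this]
  constructor
  · intro h j w hw
    have hlen : ∑ i, w.count i = w.length := by
      rw [(perm_multiIndexWord_count w).length_eq, length_multiIndexWord]
    have hle : ∀ i, w.count i < k + 1 := fun i =>
      Nat.lt_succ_of_le (List.count_le_length.trans hw)
    have h1 := (hjet j ⟨fun i => ⟨w.count i, hle i⟩, by simpa [hlen] using hw⟩).1 (h _ _)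
    rw [← h1]
    exact congrArg (fun L : ComplexifiedSpace m d →L[ℂ] ℂ => L v)
      (coordDeriv_perm (hΘ j) ((perm_multiIndexWord_count w).map Sum.inl)).fderiv_eq
  · intro h j β
    rw [hjet]
    exact h j _ (by rw [length_multiIndexWord]; exact β.2)

theorem fderiv_segreJet_apply (hΘ : ∀ j, AnalyticAt ℂ (Θ j) y) (k : ℕ)
    (v : ComplexifiedSpace m d) :
    fderiv ℂ (segreJet Θ k) y v =
      Sum.elim (fun i => v (Sum.inl i)) (fun jb => fderiv ℂ (jetCoeff Θ jb.1 jb.2) y v) := by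
  have hd : ∀ a, DifferentiableAt ℂ (fun x => segreJet Θ k x a) y := fun a =>
    ((analyticAt_pi_iff.1 (analyticAt_segreJet hΘ k)) a).differentiableAt
  have h1 : fderiv ℂ (segreJet Θ k) y = ContinuousLinearMap.pi
      fun a => fderiv ℂ (fun x => segreJet Θ k x a) y := fderiv_pi hd
  rw [h1]
  ext (i | ⟨j, β⟩)
  · simp only [ContinuousLinearMap.coe_pi', Sum.elim_inl]
    exact congrArg (fun L : ComplexifiedSpace m d →L[ℂ] ℂ => L v)
      ((ContinuousLinearMap.proj (R := ℂ) (φ := fun _ => ℂ)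
        (Sum.inl i : Fin m ⊕ (Fin m ⊕ Fin d))).fderiv (x := y))
  · rfl

/-- Since ζ is a component of the jet mapping, a kernel vector has no ζ-part. -/
theorem fderiv_segreJet_eq_zero_iff (hΘ : ∀ j, AnalyticAt ℂ (Θ j) y) (k : ℕ)
    (v : ComplexifiedSpace m d) :
    fderiv ℂ (segreJet Θ k) y v = 0 ↔
      ∃ u ∈ segreKer Θ k y, v = tangentInr u := by
  rw [fderiv_segreJet_apply hΘ]
  constructor
  · intro h
    have hv : v = tangentInr (v ∘ Sum.inr) := by
      ext (i | i)
      · exact congrFun h (Sum.inl i)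
      · rfl
    refine ⟨v ∘ Sum.inr, ?_, hv⟩
    rw [mem_segreKer, ← hv]
    exact (fderiv_jetCoeff_eq_zero_iff hΘ k v).1 fun j β => congrFun h (Sum.inr (j, β))
  · rintro ⟨u, hu, rfl⟩
    have := (fderiv_jetCoeff_eq_zero_iff hΘ k (tangentInr u)).2 hu
    ext (i | ⟨j, β⟩)
    · simp
    · simpa using this j β

theorem finrank_ker_fderiv_segreJet (hΘ : ∀ j, AnalyticAt ℂ (Θ j) y) (k : ℕ) :
    Module.finrank ℂ (LinearMap.ker (fderiv ℂ (segreJet Θ k) y).toLinearMap) =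
      Module.finrank ℂ (segreKer Θ k y) := by
  have : LinearMap.ker (fderiv ℂ (segreJet Θ k) y).toLinearMap =
      (segreKer Θ k y).map (tangentInr (m := m) (d := d)).toLinearMap := by
    ext v
    rw [LinearMap.mem_ker, Submodule.mem_map]
    refine (fderiv_segreJet_eq_zero_iff hΘ k v).trans ?_
    exact exists_congr fun u => and_congr_right fun _ => eq_comm
  rw [this]
  exact (Submodule.equivMapOfInjective _ tangentInr_injective _).finrank_eq.symm

/-- Rank-nullity in the form through which every rank statement below is reduced to dimensions of
`segreKer`. -/
theorem rankAt_segreJet_add_finrank (hΘ : ∀ j, AnalyticAt ℂ (Θ j) y) (k : ℕ) :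
    rankAt (segreJet Θ k) y + Module.finrank ℂ (segreKer Θ k y) = m + (m + d) := by
  have := LinearMap.finrank_range_add_finrank_ker (fderiv ℂ (segreJet Θ k) y).toLinearMap
  rw [finrank_ker_fderiv_segreJet hΘ] at this
  simpa [rankAt] using this

end SegreKernel

/-! ### Power series as families of scalar coefficients. -/

section CoefficientFamilies

variable {𝕜 : Type*} [RCLike 𝕜] {σ : Type*} [Fintype σ] [DecidableEq σ]

/-- The coefficients are the values of the multilinear terms on basis vectors. Their geometric bound
persists when they are conjugated or when real ones are read as complex ones. -/
theorem exists_coefficients_of_analyticAt {f : (σ → 𝕜) → 𝕜} {p : σ → 𝕜} (hf : AnalyticAt 𝕜 f p) :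
    ∃ (a : ∀ k : ℕ, (Fin k → σ) → 𝕜) (C R : ℝ), (∀ k i, ‖a k i‖ ≤ C * R ^ k) ∧ 0 < R ∧
      ∀ᶠ x in 𝓝 0, HasSum (fun k => ∑ i : Fin k → σ, a k i * ∏ j, x (i j)) (f (p + x)) := by
  obtain ⟨P, r, hP⟩ := hf
  obtain ⟨ρ, hρ0, hρ⟩ := ENNReal.lt_iff_exists_nnreal_btwn.1 hP.radius_pos
  have hρ0' : 0 < ρ := by exact_mod_cast hρ0
  obtain ⟨C, hC0, hC⟩ := P.norm_mul_pow_le_of_lt_radius hρ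
  refine ⟨fun k i => P k fun j => Pi.single (i j) 1, C, (ρ : ℝ)⁻¹, fun k i => ?_, by positivity, ?_⟩
  · have h1 : ‖P k fun j => Pi.single (i j) (1 : 𝕜)‖ ≤ ‖P k‖ * ∏ _j : Fin k, 1 := by
      refine (P k).le_opNorm_mul_prod_of_le fun j => ?_
      rw [Pi.norm_single, norm_one]
    have h2 := hC k
    rw [Finset.prod_const_one, mul_one] at h1
    refine h1.trans ?_
    rw [inv_pow, ← div_eq_mul_inv, le_div_iff₀ (by positivity)]
    exact h2
  · filter_upwards [Metric.eball_mem_nhds (0 : σ → 𝕜) hP.r_pos] with x hx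
    convert! hP.hasSum hx using 1
    ext k
    have hx' : x = ∑ s, x s • (Pi.single s 1 : σ → 𝕜) := by
      ext j; simp [Finset.sum_apply, Pi.single_apply]
    conv_rhs => rw [hx']
    symm
    rw [show (P k fun _ => ∑ s, x s • (Pi.single s 1 : σ → 𝕜)) =
      (P k).toMultilinearMap fun _ => ∑ s, x s • (Pi.single s 1 : σ → 𝕜) from rfl,
      MultilinearMap.map_sum]
    refine Finset.sum_congr rfl fun i _ => ?_
    rw [MultilinearMap.map_smul_univ, smul_eq_mul, mul_comm]
    rfl

/-- The number of index tuples of length k is itself geometric in k, so summing over them only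
changes the rate. -/
theorem exists_analyticAt_of_coefficients (a : ∀ k : ℕ, (Fin k → σ) → 𝕜) {C R : ℝ}
    (hR : 0 < R) (ha : ∀ k i, ‖a k i‖ ≤ C * R ^ k) :
    ∃ F : (σ → 𝕜) → 𝕜, AnalyticAt 𝕜 F 0 ∧
      ∀ᶠ x in 𝓝 0, HasSum (fun k => ∑ i : Fin k → σ, a k i * ∏ j, x (i j)) (F x) := by
  let q : FormalMultilinearSeries 𝕜 (σ → 𝕜) 𝕜 := fun k =>
    ∑ i : Fin k → σ, a k i • (ContinuousMultilinearMap.mkPiAlgebra 𝕜 (Fin k) 𝕜).compContinuousLinearMap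
      fun j => ContinuousLinearMap.proj (R := 𝕜) (φ := fun _ : σ => 𝕜) (i j)
  have hq : ∀ k (x : σ → 𝕜), q k (fun _ => x) = ∑ i : Fin k → σ, a k i * ∏ j, x (i j) := by
    intro k x
    simp [q]
  have hnorm : ∀ k, ‖q k‖ ≤ C * (Fintype.card σ * R) ^ k := by
    intro k
    have h1 : ∀ i : Fin k → σ, ‖a k i • (ContinuousMultilinearMap.mkPiAlgebra 𝕜 (Fin k)
        𝕜).compContinuousLinearMap fun j =>
          ContinuousLinearMap.proj (R := 𝕜) (φ := fun _ : σ => 𝕜) (i j)‖ ≤ C * R ^ k := by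
      intro i
      rw [norm_smul]
      have h2 : ‖(ContinuousMultilinearMap.mkPiAlgebra 𝕜 (Fin k)
        𝕜).compContinuousLinearMap fun j =>
          ContinuousLinearMap.proj (R := 𝕜) (φ := fun _ : σ => 𝕜) (i j)‖ ≤ 1 := by
        refine ContinuousMultilinearMap.opNorm_le_bound zero_le_one fun v => ?_
        simp only [ContinuousMultilinearMap.compContinuousLinearMap_apply,
          ContinuousMultilinearMap.mkPiAlgebra_apply, ContinuousLinearMap.proj_apply, norm_prod,
          one_mul]
        exact Finset.prod_le_prod (fun _ _ => norm_nonneg _) fun j _ => norm_le_pi_norm (v j) (i j)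
      calc _ ≤ ‖a k i‖ * 1 := by gcongr
        _ ≤ _ := by rw [mul_one]; exact ha k i
    refine (norm_sum_le _ _).trans ((Finset.sum_le_sum fun i _ => h1 i).trans (le_of_eq ?_))
    simp [mul_pow]
    ring
  have hrad : 0 < q.radius := by
    have h0 : (0 : ℝ) < Fintype.card σ * R + 1 := by positivity
    -- The summand 1 keeps the radius positive when `σ` is empty.
    let ρ : NNReal := ⟨(Fintype.card σ * R + 1)⁻¹, by positivity⟩
    have hρ : (0 : ENNReal) < ρ := by
      have : (0 : ℝ) < (ρ : ℝ) := by change 0 < (Fintype.card σ * R + 1)⁻¹; positivity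
      exact_mod_cast this
    refine hρ.trans_le (q.le_radius_of_bound |C| fun k => ?_)
    change ‖q k‖ * ((Fintype.card σ * R + 1)⁻¹) ^ k ≤ |C|
    have hC : C ≤ |C| := le_abs_self C
    rw [inv_pow, ← div_eq_mul_inv, div_le_iff₀ (by positivity)]
    calc ‖q k‖ ≤ C * (Fintype.card σ * R) ^ k := hnorm k
      _ ≤ |C| * (Fintype.card σ * R) ^ k := by gcongr
      _ ≤ |C| * (Fintype.card σ * R + 1) ^ k := by gcongr; linarith
  have hs := q.hasFPowerSeriesOnBall hrad
  refine ⟨q.sum, hs.analyticAt, ?_⟩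
  filter_upwards [Metric.eball_mem_nhds (0 : σ → 𝕜) hs.r_pos] with x hx
  have := hs.hasSum hx
  simpa [hq] using this

end CoefficientFamilies

/-! ### Functions with conjugate coefficients. -/

section Conjugation

variable {σ : Type*}

/-- Componentwise complex conjugation. -/
def conjVec (x : σ → ℂ) : σ → ℂ := fun i => starRingEnd ℂ (x i)

@[simp] theorem conjVec_apply (x : σ → ℂ) (i : σ) : conjVec x i = starRingEnd ℂ (x i) := rfl

@[simp] theorem conjVec_conjVec (x : σ → ℂ) : conjVec (conjVec x) = x := by ext; simp

@[simp] theorem conjVec_zero : conjVec (0 : σ → ℂ) = 0 := by ext; simp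

theorem conjVec_add (x y : σ → ℂ) : conjVec (x + y) = conjVec x + conjVec y := by ext; simp

theorem conjVec_sub (x y : σ → ℂ) : conjVec (x - y) = conjVec x - conjVec y := by ext; simp

theorem conjVec_smul (a : ℂ) (x : σ → ℂ) :
    conjVec (a • x) = starRingEnd ℂ a • conjVec x := by ext; simp

theorem conjVec_injective : Function.Injective (conjVec : (σ → ℂ) → (σ → ℂ)) :=
  Function.LeftInverse.injective conjVec_conjVec

theorem continuous_conjVec : Continuous (conjVec : (σ → ℂ) → (σ → ℂ)) :=
  continuous_pi fun i => Complex.continuous_conj.comp (continuous_apply i)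

/-- The function with conjugate coefficients. -/
def conjFun (f : (σ → ℂ) → ℂ) : (σ → ℂ) → ℂ := fun x => starRingEnd ℂ (f (conjVec x))

theorem conjFun_conjVec (f : (σ → ℂ) → ℂ) (x : σ → ℂ) :
    conjFun f (conjVec x) = starRingEnd ℂ (f x) := by simp [conjFun]

variable [Fintype σ] [DecidableEq σ]

theorem analyticAt_conjFun {f : (σ → ℂ) → ℂ} {p : σ → ℂ} (hf : AnalyticAt ℂ f p) :
    AnalyticAt ℂ (conjFun f) (conjVec p) := by
  obtain ⟨a, C, R, ha, hR, hsum⟩ := exists_coefficients_of_analyticAt hf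
  obtain ⟨F, hF, hFsum⟩ := exists_analyticAt_of_coefficients
    (fun k i => starRingEnd ℂ (a k i)) (C := C) hR (by simpa using ha)
  have h1 : AnalyticAt ℂ (fun x => F (x - conjVec p)) (conjVec p) := by
    refine AnalyticAt.comp (g := F) ?_ (by fun_prop)
    simpa using hF
  refine h1.congr ?_
  have ht : Tendsto (fun x : σ → ℂ => x - conjVec p) (𝓝 (conjVec p)) (𝓝 0) := by
    have : Continuous fun x : σ → ℂ => x - conjVec p := by fun_prop
    simpa using this.tendsto (conjVec p)
  have ht' : Tendsto (fun x : σ → ℂ => conjVec (x - conjVec p)) (𝓝 (conjVec p)) (𝓝 0) := by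
    have := (continuous_conjVec.tendsto (0 : σ → ℂ)).comp ht
    simpa [Function.comp_def] using this
  filter_upwards [ht.eventually hFsum, ht'.eventually hsum] with x h2 h3
  have h4 := h3.map (starRingEnd ℂ) Complex.continuous_conj
  refine h2.unique ?_
  have h5 : (p + conjVec (x - conjVec p)) = conjVec x := by simp [conjVec_sub]
  rw [h5] at h4
  convert! h4 using 1
  ext k
  simp [map_sum, map_prod]

/-- It suffices to differentiate along a real line, where conjugation is linear. -/
theorem fderiv_conjFun {f : (σ → ℂ) → ℂ} {y : σ → ℂ} (hf : AnalyticAt ℂ f (conjVec y))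
    (v : σ → ℂ) :
    fderiv ℂ (conjFun f) y v = starRingEnd ℂ (fderiv ℂ f (conjVec y) (conjVec v)) := by
  have h1 : AnalyticAt ℂ (conjFun f) y := by simpa using analyticAt_conjFun hf
  have hline : ∀ {g : (σ → ℂ) → ℂ} {x u : σ → ℂ}, DifferentiableAt ℂ g x →
      HasDerivAt (fun s : ℝ => g (x + (s : ℂ) • u)) (fderiv ℂ g x u) 0 := by
    intro g x u hg
    have h2 : HasFDerivAt g (fderiv ℂ g x) (x + (((0 : ℝ) : ℂ)) • u) := by
      simpa using hg.hasFDerivAt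
    have h3 : HasDerivAt (fun s : ℝ => x + (s : ℂ) • u) u 0 := by
      have h4 : HasDerivAt (fun s : ℝ => (s : ℂ)) 1 (0 : ℝ) := Complex.ofRealCLM.hasDerivAt
      simpa using (h4.smul_const u).const_add x
    exact (h2.restrictScalars ℝ).comp_hasDerivAt (0 : ℝ) h3
  have h5 := hline (u := v) h1.differentiableAt
  have h6 := hline (u := conjVec v) hf.differentiableAt
  have h7 : HasDerivAt (fun s : ℝ => conjFun f (y + (s : ℂ) • v))
      (starRingEnd ℂ (fderiv ℂ f (conjVec y) (conjVec v))) 0 := by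
    have := (Complex.conjCLE : ℂ →L[ℝ] ℂ).hasFDerivAt.comp_hasDerivAt (0 : ℝ) h6
    refine this.congr_of_eventuallyEq (Eventually.of_forall fun s => ?_)
    simp [conjFun, conjVec_add, conjVec_smul, -Complex.coe_smul]
  exact h5.unique h7

end Conjugation

/-! ### Complexification of real analytic functions. -/

section Complexification

variable {σ : Type*} [Fintype σ] [DecidableEq σ]

theorem exists_complexification {f : (σ → ℝ) → ℝ} {p : σ → ℝ} (hf : AnalyticAt ℝ f p) :
    ∃ F : (σ → ℂ) → ℂ, AnalyticAt ℂ F (fun i => (p i : ℂ)) ∧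
      ∀ᶠ x in 𝓝 p, F (fun i => (x i : ℂ)) = f x := by
  obtain ⟨a, C, R, ha, hR, hsum⟩ := exists_coefficients_of_analyticAt hf
  obtain ⟨F, hF, hFsum⟩ := exists_analyticAt_of_coefficients
    (fun k i => (a k i : ℂ)) (C := C) hR (by simpa using ha)
  refine ⟨fun x => F (x - fun i => (p i : ℂ)), ?_, ?_⟩
  · refine AnalyticAt.comp (g := F) ?_ (analyticAt_id.sub analyticAt_const)
    simpa using hF
  · have ht : Tendsto (fun x : σ → ℝ => x - p) (𝓝 p) (𝓝 0) := by
      have : Continuous fun x : σ → ℝ => x - p := by fun_prop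
      simpa using this.tendsto p
    have ht' : Tendsto (fun x : σ → ℝ => (fun i => (x i : ℂ)) - fun i => (p i : ℂ)) (𝓝 p)
        (𝓝 0) := by
      have : Continuous fun x : σ → ℝ => (fun i => (x i : ℂ)) - fun i => (p i : ℂ) := by fun_prop
      simpa using this.tendsto p
    filter_upwards [ht.eventually hsum, ht'.eventually hFsum] with x h1 h2
    have h3 := h1.map Complex.ofRealHom Complex.continuous_ofReal
    refine h2.unique ?_
    rw [add_sub_cancel] at h3
    convert! h3 using 1
    ext k
    simp [map_sum]

/-- The real points are a set of uniqueness. -/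
theorem eventually_eq_zero_of_real {F : (σ → ℂ) → ℂ} {p : σ → ℝ}
    (hF : AnalyticAt ℂ F (fun i => (p i : ℂ)))
    (h : ∀ᶠ x in 𝓝 p, F (fun i => (x i : ℂ)) = 0) :
    ∀ᶠ z in 𝓝 (fun i => (p i : ℂ)), F z = 0 := by
  have hre : ∀ y : σ → ℂ, Tendsto (fun z : σ → ℂ => fun i => (z i).re) (𝓝 y)
      (𝓝 fun i => (y i).re) := fun y => by
    have : Continuous fun z : σ → ℂ => fun i => (z i).re := by fun_prop
    exact this.tendsto y
  -- A holomorphic function vanishing at the real points has zero derivative along the real basis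
  -- vectors, and these span over ℂ.
  refine eventually_eq_zero_of_eq_zero_on (S := {z | ∀ i, z i = (z i).re}) (by simp) ?_ hF ?_
  · refine Eventually.of_forall fun y hy G hG hGz => ?_
    refine ContinuousLinearMap.coe_injective ((Pi.basisFun ℂ σ).ext fun i => ?_)
    have h2 : HasFDerivAt G (fderiv ℂ G y) (y + (((0 : ℝ) : ℂ)) • (Pi.single i 1 : σ → ℂ)) := by
      simpa using hG.differentiableAt.hasFDerivAt
    have hc : HasDerivAt (fun s : ℝ => y + (s : ℂ) • (Pi.single i 1 : σ → ℂ))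
        (Pi.single i 1) 0 := by
      have h4 : HasDerivAt (fun s : ℝ => (s : ℂ)) 1 (0 : ℝ) := Complex.ofRealCLM.hasDerivAt
      simpa using (h4.smul_const (Pi.single i 1 : σ → ℂ)).const_add y
    have h3 := (h2.restrictScalars ℝ).comp_hasDerivAt (0 : ℝ) hc
    have ht : Tendsto (fun s : ℝ => y + (s : ℂ) • (Pi.single i 1 : σ → ℂ)) (𝓝 0) (𝓝 y) := by
      simpa using hc.continuousAt.tendsto
    have h4 : (fun s : ℝ => G (y + (s : ℂ) • (Pi.single i 1 : σ → ℂ))) =ᶠ[𝓝 0] fun _ => 0 := by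
      filter_upwards [ht.eventually hGz] with s hs
      refine hs fun j => ?_
      have := hy j
      rcases eq_or_ne j i with rfl | hji
      · apply Complex.ext <;> simp
        rw [this]; simp
      · simpa [hji] using this
    have h5 := h3.congr_of_eventuallyEq h4.symm
    simpa using h5.unique (hasDerivAt_const (0 : ℝ) (0 : ℂ))
  · have := (hre fun i => (p i : ℂ)).eventually (p := fun x => F (fun i => (x i : ℂ)) = 0)
      (by simpa using h)
    filter_upwards [this] with z hz hzS
    convert hz using 2
    ext i
    exact hzS i

end Complexification

/-! ### Transfer, exchange and derivations for algebraic elements. -/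

section AlgebraicElements

variable {K R R' : Type*} [Field K] [CommRing R] [IsDomain R] [CommRing R'] [IsDomain R']
  [Algebra K R']

/-- Transitivity of algebraicity, through the algebraic closure of the target algebra in `R'`. The
map is only a ring homomorphism because conjugation of germs, to which this is applied, is not
ℂ-linear. -/
theorem isAlgebraic_adjoin_of_ringHom {K₀ : Type*} [CommRing K₀] [Algebra K₀ R]
    (T : Subalgebra K₀ R) (φ : R →+* R') (hφ : Function.Injective φ) {S' : Set R'}
    (hT : ∀ s ∈ T, IsAlgebraic (Algebra.adjoin K S') (φ s)) {f : R}
    (hf : IsAlgebraic T f) : IsAlgebraic (Algebra.adjoin K S') (φ f) := by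
  let C := Subalgebra.algebraicClosure (Algebra.adjoin K S') R'
  let ψ : T →+* C := (φ.comp (algebraMap T R)).codRestrict C fun x => hT _ x.2
  have h1 : IsAlgebraic C (φ f) := by
    refine hf.ringHom_of_comp_eq ψ φ (fun a b hab => ?_) rfl
    have h2 : φ (a : R) = φ (b : R) := congrArg Subtype.val hab
    exact Subtype.ext (hφ h2)
  exact h1.restrictScalars _

theorem isAlgebraic_adjoin_map [Algebra K R] (φ : R →ₐ[K] R') (hφ : Function.Injective φ)
    {S : Set R} {S' : Set R'} (hS : ∀ s ∈ S, IsAlgebraic (Algebra.adjoin K S') (φ s)) {f : R}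
    (hf : IsAlgebraic (Algebra.adjoin K S) f) : IsAlgebraic (Algebra.adjoin K S') (φ f) := by
  refine isAlgebraic_adjoin_of_ringHom _ (φ : R →+* R') hφ (fun s hs => ?_) hf
  have hle : (Algebra.adjoin K S) ≤
      ((Subalgebra.algebraicClosure (Algebra.adjoin K S') R').restrictScalars K).comap φ := by
    rw [Algebra.adjoin_le_iff]
    exact fun s hs => hS s hs
  exact hle hs

/-- The exchange property for algebraic dependence. -/
theorem isAlgebraic_adjoin_exchange {σ τ : Type*} [Fintype σ] [Fintype τ]
    (hcard : Fintype.card σ ≤ Fintype.card τ) {x : σ → R'} {y : τ → R'}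
    (hy : AlgebraicIndependent K y)
    (h : ∀ j, IsAlgebraic (Algebra.adjoin K (Set.range x)) (y j)) (i : σ) :
    IsAlgebraic (Algebra.adjoin K (Set.range y)) (x i) := by
  -- In the matroid of algebraic independence, `range y` is independent inside the closure of `range
  -- x`, whose rank is at most the cardinality of `τ`. So it is a basis there, and its closure
  -- contains every `x i`.
  let M := AlgebraicIndependent.matroid K R'
  have hE : ∀ s : Set R', s ⊆ M.E := fun s => Set.subset_univ s
  have hind : M.Indep (Set.range y) :=
    AlgebraicIndependent.matroid_indep_iff.2 hy.coe_range
  have hsub : Set.range y ⊆ M.closure (Set.range x) := by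
    rintro _ ⟨j, rfl⟩
    rw [AlgebraicIndependent.matroid_closure_eq]
    exact h j
  obtain ⟨J, hJ, hyJ⟩ := hind.subset_isBasis_of_subset hsub (hE _)
  obtain ⟨I, hI⟩ := M.exists_isBasis (Set.range x) (hE _)
  have hI' : M.IsBasis I (M.closure (Set.range x)) := hI.isBasis_closure_right
  have hcard' : J.encard ≤ (Set.range y).encard := by
    rw [hJ.encard_eq_encard hI']
    calc I.encard ≤ (Set.range x).encard := Set.encard_le_encard hI.subset
      _ ≤ (Fintype.card σ : ℕ∞) := by
          rw [← Set.image_univ]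
          refine (Set.encard_image_le _ _).trans (le_of_eq ?_)
          simp
      _ ≤ (Fintype.card τ : ℕ∞) := by exact_mod_cast hcard
      _ = (Set.range y).encard := by
          rw [← Set.image_univ, hy.injective.encard_image]
          simp
  have hEq : Set.range y = J :=
    (Set.finite_range y).eq_of_subset_of_encard_le hyJ hcard'
  have hmem : x i ∈ M.closure (Set.range y) := by
    rw [hEq, hJ.closure_eq_closure, Matroid.closure_closure]
    exact M.subset_closure _ (hE _) ⟨i, rfl⟩
  rw [AlgebraicIndependent.matroid_closure_eq] at hmem
  exact hmem

theorem aeval_derivative_eq_sum {S : Subalgebra K R'} (Q : Polynomial S) (f : R') :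
    Polynomial.aeval f (Polynomial.derivative Q) =
      ∑ i ∈ Finset.range (Q.natDegree + 1), (Q.coeff i : R') * (i * f ^ (i - 1)) := by
  conv_lhs => rw [Q.as_sum_range_C_mul_X_pow]
  simp only [map_sum, Polynomial.derivative_C_mul_X_pow, map_mul,
    Polynomial.aeval_C, map_pow, Polynomial.aeval_X, map_natCast]
  refine Finset.sum_congr rfl fun i _ => ?_
  change (Q.coeff i : R') * i * f ^ (i - 1) = _
  ring

/-- A derivation preserving a subalgebra preserves the elements algebraic over it. -/
theorem isAlgebraic_derivation [CharZero R'] (D : Derivation K R' R') (S : Subalgebra K R')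
    (hS : ∀ s ∈ S, D s ∈ S) {f : R'} (hf : IsAlgebraic S f) : IsAlgebraic S (D f) := by
  let C := Subalgebra.algebraicClosure S R'
  -- Descent on the degree of the relation: if its derivative also annihilates `f`, pass to that
  -- derivative; otherwise differentiate Q(f) = 0.
  have key : ∀ (n : ℕ) (Q : Polynomial S), Q.natDegree ≤ n → Q ≠ 0 → Polynomial.aeval f Q = 0 →
      IsAlgebraic S (D f) := by
    intro n
    induction n with
    | zero =>
      intro Q hn hQ h0
      rw [Polynomial.eq_C_of_natDegree_le_zero hn, Polynomial.aeval_C] at h0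
      have h1 : Q.coeff 0 = 0 := Subtype.ext h0
      rw [Polynomial.eq_C_of_natDegree_le_zero hn, h1, map_zero] at hQ
      exact absurd rfl hQ
    | succ n ih =>
      intro Q hn hQ h0
      by_cases hQ' : Polynomial.derivative Q = 0
      · have := Polynomial.derivative_eq_zero.1 hQ'
        exact ih Q (by omega) hQ h0
      by_cases hz : Polynomial.aeval f (Polynomial.derivative Q) = 0
      · exact ih _ ((Polynomial.natDegree_derivative_le Q).trans (by omega)) hQ' hz
      have hsum : D (Polynomial.aeval f Q) =
          ∑ i ∈ Finset.range (Q.natDegree + 1), D (Q.coeff i : R') * f ^ i +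
            Polynomial.aeval f (Polynomial.derivative Q) * D f := by
        have h2 : Polynomial.aeval f (Polynomial.derivative Q) =
            ∑ i ∈ Finset.range (Q.natDegree + 1), (Q.coeff i : R') * (i * f ^ (i - 1)) := by
          exact aeval_derivative_eq_sum Q f
        rw [h2, Polynomial.aeval_eq_sum_range, map_sum, Finset.sum_mul, ← Finset.sum_add_distrib]
        refine Finset.sum_congr rfl fun i _ => ?_
        rw [Algebra.smul_def, Derivation.leibniz, Derivation.leibniz_pow]
        simp only [smul_eq_mul, nsmul_eq_mul]
        change (Q.coeff i : R') * (i * (f ^ (i - 1) * D f)) + f ^ i * D (Q.coeff i : R') = _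
        ring
      rw [h0, map_zero] at hsum
      have hfC : f ∈ C := hf
      have hSC : ∀ s ∈ S, s ∈ C := fun s hs => isAlgebraic_algebraMap (⟨s, hs⟩ : S)
      have ha : ∑ i ∈ Finset.range (Q.natDegree + 1), D (Q.coeff i : R') * f ^ i ∈ C :=
        C.sum_mem fun i _ => C.mul_mem (hSC _ (hS _ (Q.coeff i).2)) (C.pow_mem hfC i)
      have hb : Polynomial.aeval f (Polynomial.derivative Q) ∈ C := by
        rw [Polynomial.aeval_eq_sum_range]
        exact C.sum_mem fun i _ => C.smul_mem (C.pow_mem hfC i) _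
      -- The differentiated relation is linear in `D f`, with leading coefficient Q'(f) ≠ 0 and
      -- coefficients algebraic over `S`.
      have h3 : IsAlgebraic C (D f) := by
        refine ⟨Polynomial.C ⟨_, hb⟩ * Polynomial.X + Polynomial.C ⟨_, ha⟩, fun h4 => hz ?_, ?_⟩
        · have h5 := congrArg (fun q : Polynomial C => q.coeff 1) h4
          simp only [Polynomial.coeff_add, Polynomial.coeff_C_mul, Polynomial.coeff_X_one, mul_one,
            Polynomial.coeff_C_succ, add_zero, Polynomial.coeff_zero] at h5
          exact congrArg Subtype.val h5
        · rw [map_add, map_mul, Polynomial.aeval_C, Polynomial.aeval_X, Polynomial.aeval_C]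
          change Polynomial.aeval f (Polynomial.derivative Q) * D f + _ = 0
          rw [add_comm]
          exact hsum.symm
      exact h3.restrictScalars _
  obtain ⟨Q, hQ, h0⟩ := hf
  exact key _ Q le_rfl hQ h0

end AlgebraicElements

/-! ### The domain of analytic germs. -/

section AnalyticGerms

variable (𝕜 : Type*) [RCLike 𝕜] {E : Type*} [NormedAddCommGroup E] [NormedSpace 𝕜 E]
  {E' : Type*} [NormedAddCommGroup E'] [NormedSpace 𝕜 E']
  (A : Type*) [NormedField A] [NormedAlgebra 𝕜 A] [CompleteSpace A]

/-- The subalgebra of functions analytic at `p`. -/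
def analyticSubalgebra (p : E) : Subalgebra A (E → A) where
  carrier := {f | AnalyticAt 𝕜 f p}
  mul_mem' hf hg := AnalyticAt.mul hf hg
  add_mem' hf hg := AnalyticAt.add hf hg
  algebraMap_mem' _ := analyticAt_const

/-- The ring of functions analytic at `p`. -/
def AnalyticFunction (p : E) : Type _ := analyticSubalgebra 𝕜 A p

instance (p : E) : CommRing (AnalyticFunction 𝕜 A p) :=
  inferInstanceAs (CommRing (analyticSubalgebra 𝕜 A p))

instance (K : Type*) [Field K] [Algebra K A] (p : E) : Algebra K (AnalyticFunction 𝕜 A p) :=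
  inferInstanceAs (Algebra K (analyticSubalgebra 𝕜 A p))

/-- Inclusion into the ring of all functions. -/
def AnalyticFunction.val (K : Type*) [Field K] [Algebra K A] (p : E) :
    AnalyticFunction 𝕜 A p →ₐ[K] (E → A) :=
  (analyticSubalgebra 𝕜 A p).val.restrictScalars K

/-- The analytic functions vanishing near `p`. -/
def locallyZeroIdeal (p : E) : Ideal (AnalyticFunction 𝕜 A p) where
  carrier := {f | ∀ᶠ x in 𝓝 p, f.1 x = 0}
  zero_mem' := Eventually.of_forall fun _ => rfl
  add_mem' {f g} hf hg := by
    filter_upwards [hf, hg] with x h1 h2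
    change f.1 x + g.1 x = 0
    rw [h1, h2, add_zero]
  smul_mem' f g hg := by
    filter_upwards [hg] with x h1
    change f.1 x * g.1 x = 0
    rw [h1, mul_zero]

instance locallyZeroIdeal_isPrime (p : E) : (locallyZeroIdeal 𝕜 A p).IsPrime where
  ne_top' h := by
    have : (1 : AnalyticFunction 𝕜 A p) ∈ locallyZeroIdeal 𝕜 A p := h ▸ Submodule.mem_top
    have h1 : ∀ᶠ _x in 𝓝 p, (1 : A) = 0 := this
    exact one_ne_zero h1.self_of_nhds
  mem_or_mem' {f g} h := eventually_eq_zero_or_of_smul f.2 g.2 h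

/-- The ring of germs at `p` of analytic functions. -/
def AnalyticGerm (p : E) : Type _ := AnalyticFunction 𝕜 A p ⧸ locallyZeroIdeal 𝕜 A p

instance (p : E) : CommRing (AnalyticGerm 𝕜 A p) :=
  inferInstanceAs (CommRing (AnalyticFunction 𝕜 A p ⧸ locallyZeroIdeal 𝕜 A p))

instance (p : E) : IsDomain (AnalyticGerm 𝕜 A p) :=
  inferInstanceAs (IsDomain (AnalyticFunction 𝕜 A p ⧸ locallyZeroIdeal 𝕜 A p))

instance (K : Type*) [Field K] [Algebra K A] (p : E) : Algebra K (AnalyticGerm 𝕜 A p) :=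
  inferInstanceAs (Algebra K (AnalyticFunction 𝕜 A p ⧸ locallyZeroIdeal 𝕜 A p))

/-- The projection to germs. -/
def AnalyticGerm.mk (K : Type*) [Field K] [Algebra K A] (p : E) :
    AnalyticFunction 𝕜 A p →ₐ[K] AnalyticGerm 𝕜 A p :=
  Ideal.Quotient.mkₐ K (locallyZeroIdeal 𝕜 A p)

variable {A} in
/-- The germ of an analytic function. -/
def analyticGerm {p : E} (f : E → A) (hf : AnalyticAt 𝕜 f p) : AnalyticGerm 𝕜 A p :=
  AnalyticGerm.mk 𝕜 A A p ⟨f, hf⟩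

variable {𝕜 A}

theorem AnalyticGerm.mk_eq_zero_iff {K : Type*} [Field K] [Algebra K A] {p : E}
    (f : AnalyticFunction 𝕜 A p) :
    AnalyticGerm.mk 𝕜 A K p f = 0 ↔ ∀ᶠ x in 𝓝 p, f.1 x = 0 :=
  Ideal.Quotient.eq_zero_iff_mem

theorem analyticGerm_eq_zero_iff {p : E} {f : E → A} (hf : AnalyticAt 𝕜 f p) :
    analyticGerm 𝕜 f hf = 0 ↔ ∀ᶠ x in 𝓝 p, f x = 0 :=
  AnalyticGerm.mk_eq_zero_iff _

theorem exists_analyticGerm_eq {p : E} (a : AnalyticGerm 𝕜 A p) :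
    ∃ (f : E → A) (hf : AnalyticAt 𝕜 f p), analyticGerm 𝕜 f hf = a := by
  obtain ⟨f, rfl⟩ := Ideal.Quotient.mk_surjective a
  exact ⟨f.1, f.2, rfl⟩

theorem analyticGerm_add {p : E} {f g : E → A} (hf : AnalyticAt 𝕜 f p)
    (hg : AnalyticAt 𝕜 g p) :
    analyticGerm 𝕜 (f + g) (hf.add hg) = analyticGerm 𝕜 f hf + analyticGerm 𝕜 g hg := rfl

theorem analyticGerm_mul {p : E} {f g : E → A} (hf : AnalyticAt 𝕜 f p)
    (hg : AnalyticAt 𝕜 g p) :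
    analyticGerm 𝕜 (f * g) (hf.mul hg) = analyticGerm 𝕜 f hf * analyticGerm 𝕜 g hg := rfl

section Map

variable {A' : Type*} [NormedField A'] [NormedAlgebra 𝕜 A'] [CompleteSpace A']
    {K : Type*} [Field K] [Algebra K A] [Algebra K A'] {p : E} {q : E'}
    (Φ : (E → A) →ₐ[K] (E' → A')) (h1 : ∀ f, AnalyticAt 𝕜 f p → AnalyticAt 𝕜 (Φ f) q)
    (h2 : ∀ f, (∀ᶠ x in 𝓝 p, f x = 0) → ∀ᶠ x in 𝓝 q, Φ f x = 0)

/-- The algebra homomorphism of rings of analytic functions induced by an operation. -/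
def analyticFunctionMap : AnalyticFunction 𝕜 A p →ₐ[K] AnalyticFunction 𝕜 A' q :=
  (Φ.comp (AnalyticFunction.val 𝕜 A K p)).codRestrict
    ((analyticSubalgebra 𝕜 A' q).restrictScalars K) fun f => h1 f.1 f.2

/-- The algebra homomorphism of rings of germs induced by an operation on functions. -/
def analyticGermMap : AnalyticGerm 𝕜 A p →ₐ[K] AnalyticGerm 𝕜 A' q :=
  Ideal.quotientMapₐ (locallyZeroIdeal 𝕜 A' q) (analyticFunctionMap Φ h1) fun f hf => h2 f.1 hf

theorem analyticGermMap_apply (f : E → A) (hf : AnalyticAt 𝕜 f p) :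
    analyticGermMap Φ h1 h2 (analyticGerm 𝕜 f hf) = analyticGerm 𝕜 (Φ f) (h1 f hf) := rfl

theorem analyticGermMap_injective
    (h3 : ∀ f, AnalyticAt 𝕜 f p → (∀ᶠ x in 𝓝 q, Φ f x = 0) → ∀ᶠ x in 𝓝 p, f x = 0) :
    Function.Injective (analyticGermMap Φ h1 h2) := by
  rw [injective_iff_map_eq_zero]
  intro a ha
  obtain ⟨f, hf, rfl⟩ := exists_analyticGerm_eq a
  rw [analyticGermMap_apply, analyticGerm_eq_zero_iff] at ha
  rw [analyticGerm_eq_zero_iff]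
  exact h3 f hf ha

end Map

/-- Polynomial identities near a point become algebraic relations in a domain, where the
field-theoretic closure properties are available. -/
theorem aeval_analyticGerm {K : Type*} [Field K] [Algebra K A] {σ : Type*} {p : E}
    (x : σ → E → A) (hx : ∀ i, AnalyticAt 𝕜 (x i) p) (P : MvPolynomial σ K) :
    MvPolynomial.aeval (fun i => analyticGerm 𝕜 (x i) (hx i)) P = 0 ↔
      ∀ᶠ y in 𝓝 p, MvPolynomial.aeval (fun i => x i y) P = 0 := by
  let x' : σ → AnalyticFunction 𝕜 A p := fun i => ⟨x i, hx i⟩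
  have h1 : MvPolynomial.aeval (fun i => analyticGerm 𝕜 (x i) (hx i)) P =
      AnalyticGerm.mk 𝕜 A K p (MvPolynomial.aeval x' P) :=
    (MvPolynomial.comp_aeval_apply (f := x') (AnalyticGerm.mk 𝕜 A K p) P).symm
  have h2 : ∀ y, (MvPolynomial.aeval x' P).1 y = MvPolynomial.aeval (fun i => x i y) P := fun y =>
    MvPolynomial.comp_aeval_apply (f := x')
      ((Pi.evalAlgHom K (fun _ : E => A) y).comp (AnalyticFunction.val 𝕜 A K p)) P
  rw [h1, AnalyticGerm.mk_eq_zero_iff]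
  exact eventually_congr (Eventually.of_forall fun y => by rw [← h2])

theorem algebraicIndependent_analyticGerm {K : Type*} [Field K] [Algebra K A] {σ : Type*} {p : E}
    (x : σ → E → A) (hx : ∀ i, AnalyticAt 𝕜 (x i) p) :
    AlgebraicIndependent K (fun i => analyticGerm 𝕜 (x i) (hx i)) ↔
      ∀ P : MvPolynomial σ K, (∀ᶠ y in 𝓝 p, MvPolynomial.aeval (fun i => x i y) P = 0) → P = 0 := by
  rw [algebraicIndependent_iff]
  exact forall_congr' fun P => by rw [aeval_analyticGerm]

end AnalyticGerms

/-! ### Nash functions: closure under algebra operations, derivatives and inverses. -/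

section Nash

variable {𝕜 : Type*} [RCLike 𝕜] {E : Type*} [NormedAddCommGroup E] [NormedSpace 𝕜 E]
  {E' : Type*} [NormedAddCommGroup E'] [NormedSpace 𝕜 E']
  {σ : Type*} [Fintype σ] {τ : Type*} [Fintype τ]

/-- Analytic functions algebraic over the polynomials in the coordinates `e`. -/
def IsNashAt (e : E ≃L[𝕜] (σ → 𝕜)) (f : E → 𝕜) (p : E) : Prop :=
  AnalyticAt 𝕜 f p ∧ IsAlgebraicAt e f p

theorem analyticAt_coord (e : E ≃L[𝕜] (σ → 𝕜)) (p : E) (i : σ) :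
    AnalyticAt 𝕜 (fun x => e x i) p :=
  ((ContinuousLinearMap.proj (R := 𝕜) (φ := fun _ : σ => 𝕜) i).comp
    (e : E →L[𝕜] (σ → 𝕜))).analyticAt p

/-- The germ of a coordinate function. -/
def coordGerm (e : E ≃L[𝕜] (σ → 𝕜)) (p : E) (i : σ) : AnalyticGerm 𝕜 𝕜 p :=
  analyticGerm 𝕜 (fun x => e x i) (analyticAt_coord e p i)

theorem mvPolynomial_eq_zero_of_eventually (e : E ≃L[𝕜] (σ → 𝕜)) {p : E} (P : MvPolynomial σ 𝕜)
    (h : ∀ᶠ x in 𝓝 p, MvPolynomial.eval (e x) P = 0) : P = 0 := by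
  have han : ∀ x, AnalyticAt 𝕜 (fun x => MvPolynomial.eval (e x) P) x := fun x => by
    simpa [MvPolynomial.aeval_eq_eval] using
      AnalyticAt.aeval_mvPolynomial (f := fun x => e x) (fun i => analyticAt_coord e x i) P
  refine MvPolynomial.funext fun y => ?_
  -- Polynomials are analytic everywhere, so the ball may be taken large enough to contain the
  -- prescribed point.
  have h1 := eq_zero_of_mem_ball_of_eventually (𝕜 := 𝕜) (x₀ := p) (ε := dist (e.symm y) p + 1)
    (fun x _ => han x) (Metric.mem_ball_self (by positivity)) h (y := e.symm y) (by simp)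
  simpa using h1

theorem algebraicIndependent_coordGerm (e : E ≃L[𝕜] (σ → 𝕜)) (p : E) :
    AlgebraicIndependent 𝕜 (coordGerm e p) :=
  (algebraicIndependent_analyticGerm _ _).2 fun P hP =>
    mvPolynomial_eq_zero_of_eventually e P (by simpa [MvPolynomial.aeval_eq_eval] using hP)

/-- A nontrivial equation P(x, f(x)) = 0 says that the coordinates together with `f` are dependent.
As the coordinates alone are independent, this is algebraicity of `f` over them. -/
theorem isAlgebraicAt_iff (e : E ≃L[𝕜] (σ → 𝕜)) {p : E} {f : E → 𝕜} (hf : AnalyticAt 𝕜 f p) :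
    IsAlgebraicAt e f p ↔
      IsAlgebraic (Algebra.adjoin 𝕜 (Set.range (coordGerm e p))) (analyticGerm 𝕜 f hf) := by
  rw [← not_iff_not, ← Transcendental,
    ← (algebraicIndependent_coordGerm e p).option_iff_transcendental]
  let x : Option σ → E → 𝕜 := fun o => o.elim f fun i y => e y i
  have hx : ∀ o, AnalyticAt 𝕜 (x o) p := by
    rintro (_ | i)
    · exact hf
    · exact analyticAt_coord e p i
  have h1 : (fun o : Option σ => o.elim (analyticGerm 𝕜 f hf) (coordGerm e p)) =
      fun o => analyticGerm 𝕜 (x o) (hx o) := by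
    ext (_ | i) <;> rfl
  have h2 : ∀ y, (fun o : Option σ => o.elim (f y) (e y)) = fun o => x o y := by
    intro y
    ext (_ | i) <;> rfl
  rw [h1, algebraicIndependent_analyticGerm]
  simp only [IsAlgebraicAt, h2, MvPolynomial.aeval_eq_eval]
  exact ⟨fun h P hP => by_contra fun hne => h ⟨P, hne, hP⟩,
    fun h ⟨P, hne, hP⟩ => hne (h P hP)⟩

theorem IsAlgebraicAt.congr {K σ E : Type*} [Field K] [TopologicalSpace E] {coord : E → σ → K}
    {f g : E → K} {p : E} (hf : IsAlgebraicAt coord f p) (h : f =ᶠ[𝓝 p] g) :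
    IsAlgebraicAt coord g p := by
  obtain ⟨P, hP, hev⟩ := hf
  refine ⟨P, hP, ?_⟩
  filter_upwards [hev, h] with x h1 h2
  rwa [← h2]

theorem IsNashAt.congr {e : E ≃L[𝕜] (σ → 𝕜)} {f g : E → 𝕜} {p : E} (hf : IsNashAt e f p)
    (h : f =ᶠ[𝓝 p] g) : IsNashAt e g p :=
  ⟨hf.1.congr h, hf.2.congr h⟩

theorem IsNashAt.eventually {e : E ≃L[𝕜] (σ → 𝕜)} {f : E → 𝕜} {p : E} (hf : IsNashAt e f p) :
    ∀ᶠ q in 𝓝 p, IsNashAt e f q := by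
  obtain ⟨P, hP, hev⟩ := hf.2
  filter_upwards [hf.1.eventually_analyticAt, hev.eventually_nhds] with q h1 h2
  exact ⟨h1, P, hP, h2⟩

/-- The algebra of Nash functions. -/
def nashSubalgebra (e : E ≃L[𝕜] (σ → 𝕜)) (p : E) : Subalgebra 𝕜 (E → 𝕜) where
  carrier := {f | IsNashAt e f p}
  mul_mem' hf hg := ⟨hf.1.mul hg.1, (isAlgebraicAt_iff e (hf.1.mul hg.1)).2
    (((isAlgebraicAt_iff e hf.1).1 hf.2).mul ((isAlgebraicAt_iff e hg.1).1 hg.2))⟩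
  add_mem' hf hg := ⟨hf.1.add hg.1, (isAlgebraicAt_iff e (hf.1.add hg.1)).2
    (((isAlgebraicAt_iff e hf.1).1 hf.2).add ((isAlgebraicAt_iff e hg.1).1 hg.2))⟩
  algebraMap_mem' a := ⟨analyticAt_const, (isAlgebraicAt_iff e analyticAt_const).2
    (isAlgebraic_algebraMap (algebraMap 𝕜 (Algebra.adjoin 𝕜 (Set.range (coordGerm e p))) a))⟩

theorem isNashAt_const (e : E ≃L[𝕜] (σ → 𝕜)) (a : 𝕜) (p : E) : IsNashAt e (fun _ => a) p :=
  (nashSubalgebra e p).algebraMap_mem a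

theorem isNashAt_coord (e : E ≃L[𝕜] (σ → 𝕜)) (p : E) (i : σ) : IsNashAt e (fun x => e x i) p :=
  ⟨analyticAt_coord e p i, (isAlgebraicAt_iff e (analyticAt_coord e p i)).2
    (isAlgebraic_algebraMap (⟨coordGerm e p i, Algebra.subset_adjoin ⟨i, rfl⟩⟩ :
      Algebra.adjoin 𝕜 (Set.range (coordGerm e p))))⟩

theorem isNashAt_clm [DecidableEq σ] (e : E ≃L[𝕜] (σ → 𝕜)) (L : E →L[𝕜] 𝕜) (p : E) :
    IsNashAt e L p := by
  have h : (L : E → 𝕜) = ∑ i, L (e.symm (Pi.single i 1)) • fun x => e x i := by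
    ext x
    have hx : x = e.symm (∑ i, e x i • Pi.single i 1) := by
      rw [← pi_eq_sum_univ' (e x)]; simp
    conv_lhs => rw [hx, map_sum, map_sum]
    simp [Finset.sum_apply, mul_comm]
  rw [h]
  exact (nashSubalgebra e p).sum_mem fun i _ =>
    (nashSubalgebra e p).smul_mem (isNashAt_coord e p i) _

section Derivative

theorem analyticGerm_congr {p : E} {f g : E → 𝕜} (hf : AnalyticAt 𝕜 f p) (hg : AnalyticAt 𝕜 g p)
    (h : f =ᶠ[𝓝 p] g) : analyticGerm 𝕜 f hf = analyticGerm 𝕜 g hg := by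
  have h1 : analyticGerm 𝕜 f hf + analyticGerm 𝕜 (-g) hg.neg = 0 := by
    rw [← analyticGerm_add, analyticGerm_eq_zero_iff]
    filter_upwards [h] with x hx
    simp [hx]
  have h2 : analyticGerm 𝕜 g hg + analyticGerm 𝕜 (-g) hg.neg = 0 := by
    rw [← analyticGerm_add, analyticGerm_eq_zero_iff]
    simp
  exact add_right_cancel (h1.trans h2.symm)

theorem analyticGerm_eq_iff {p : E} {f g : E → 𝕜} (hf : AnalyticAt 𝕜 f p)
    (hg : AnalyticAt 𝕜 g p) : analyticGerm 𝕜 f hf = analyticGerm 𝕜 g hg ↔ f =ᶠ[𝓝 p] g := by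
  refine ⟨fun h => ?_, analyticGerm_congr hf hg⟩
  have h2 : analyticGerm 𝕜 g hg + analyticGerm 𝕜 (-g) hg.neg = 0 := by
    rw [← analyticGerm_add, analyticGerm_eq_zero_iff]
    simp
  rw [← h, ← analyticGerm_add, analyticGerm_eq_zero_iff] at h2
  filter_upwards [h2] with x hx
  simpa [add_neg_eq_zero] using hx

theorem smul_analyticGerm {p : E} {f : E → 𝕜} (a : 𝕜) (hf : AnalyticAt 𝕜 f p) :
    a • analyticGerm 𝕜 f hf =
      analyticGerm 𝕜 ((fun _ => a) * f) (analyticAt_const.mul hf) :=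
  (map_smul (AnalyticGerm.mk 𝕜 𝕜 𝕜 p) a ⟨f, hf⟩).symm

theorem analyticAt_fderiv_apply' {f : E → 𝕜} {p : E} (hf : AnalyticAt 𝕜 f p) (v : E) :
    AnalyticAt 𝕜 (fun x => fderiv 𝕜 f x v) p :=
  (ContinuousLinearMap.analyticAt (ContinuousLinearMap.apply 𝕜 𝕜 v) _).comp hf.fderiv

/-- The directional derivative of germs. -/
def germDeriv (p v : E) (a : AnalyticGerm 𝕜 𝕜 p) : AnalyticGerm 𝕜 𝕜 p :=
  analyticGerm 𝕜 _ (analyticAt_fderiv_apply' (exists_analyticGerm_eq a).choose_spec.choose v)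

theorem germDeriv_analyticGerm (p v : E) {f : E → 𝕜} (hf : AnalyticAt 𝕜 f p) :
    germDeriv p v (analyticGerm 𝕜 f hf) =
      analyticGerm 𝕜 (fun x => fderiv 𝕜 f x v) (analyticAt_fderiv_apply' hf v) := by
  have h := (exists_analyticGerm_eq (analyticGerm 𝕜 f hf)).choose_spec.choose_spec
  rw [analyticGerm_eq_iff] at h
  refine analyticGerm_congr _ _ ?_
  filter_upwards [h.fderiv (𝕜 := 𝕜)] with x hx
  rw [hx]

/-- The directional derivative as a derivation of the ring of germs. -/
def germDerivation (p v : E) : Derivation 𝕜 (AnalyticGerm 𝕜 𝕜 p) (AnalyticGerm 𝕜 𝕜 p) :=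
  Derivation.mk'
    { toFun := germDeriv p v
      map_add' := fun a b => by
        obtain ⟨f, hf, rfl⟩ := exists_analyticGerm_eq a
        obtain ⟨g, hg, rfl⟩ := exists_analyticGerm_eq b
        rw [← analyticGerm_add]
        simp only [germDeriv_analyticGerm]
        rw [← analyticGerm_add]
        refine analyticGerm_congr _ _ ?_
        filter_upwards [hf.eventually_analyticAt, hg.eventually_analyticAt] with x h1 h2
        rw [fderiv_add h1.differentiableAt h2.differentiableAt]
        rfl
      map_smul' := fun c a => by
        obtain ⟨f, hf, rfl⟩ := exists_analyticGerm_eq a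
        rw [smul_analyticGerm]
        simp only [germDeriv_analyticGerm, RingHom.id_apply]
        rw [smul_analyticGerm]
        refine analyticGerm_congr _ _ ?_
        filter_upwards [hf.eventually_analyticAt] with x h1
        rw [fderiv_mul (differentiableAt_const _) h1.differentiableAt]
        simp }
    fun a b => by
      obtain ⟨f, hf, rfl⟩ := exists_analyticGerm_eq a
      obtain ⟨g, hg, rfl⟩ := exists_analyticGerm_eq b
      change germDeriv p v _ = _ • germDeriv p v _ + _ • germDeriv p v _
      rw [← analyticGerm_mul]
      simp only [germDeriv_analyticGerm, smul_eq_mul]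
      rw [← analyticGerm_mul, ← analyticGerm_mul, ← analyticGerm_add]
      refine analyticGerm_congr _ _ ?_
      filter_upwards [hf.eventually_analyticAt, hg.eventually_analyticAt] with x h1 h2
      rw [fderiv_mul h1.differentiableAt h2.differentiableAt]
      rfl

instance (p : E) : CharZero (AnalyticGerm 𝕜 𝕜 p) :=
  charZero_of_injective_algebraMap (algebraMap 𝕜 (AnalyticGerm 𝕜 𝕜 p)).injective

/-- A constant-direction derivative sends coordinate germs to constants, so it preserves the
polynomial algebra and `isAlgebraic_derivation` applies. -/
theorem IsNashAt.fderiv_apply {e : E ≃L[𝕜] (σ → 𝕜)} {f : E → 𝕜} {p : E} (hf : IsNashAt e f p)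
    (v : E) : IsNashAt e (fun x => fderiv 𝕜 f x v) p := by
  refine ⟨analyticAt_fderiv_apply' hf.1 v,
    (isAlgebraicAt_iff e (analyticAt_fderiv_apply' hf.1 v)).2 ?_⟩
  rw [← germDeriv_analyticGerm p v hf.1]
  refine isAlgebraic_derivation (germDerivation p v) _ ?_ ((isAlgebraicAt_iff e hf.1).1 hf.2)
  intro s hs
  induction hs using Algebra.adjoin_induction with
  | mem x hx =>
    obtain ⟨i, rfl⟩ := hx
    have h1 : germDerivation p v (coordGerm e p i) =
        algebraMap 𝕜 (AnalyticGerm 𝕜 𝕜 p) (e v i) := by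
      refine (germDeriv_analyticGerm p v (analyticAt_coord e p i)).trans ?_
      rw [Algebra.algebraMap_eq_smul_one]
      change _ = _ • analyticGerm 𝕜 (fun _ => (1 : 𝕜)) analyticAt_const
      rw [smul_analyticGerm]
      refine analyticGerm_congr _ _ (Eventually.of_forall fun x => ?_)
      have h2 : HasFDerivAt (fun x : E => e x i)
          ((ContinuousLinearMap.proj (R := 𝕜) (φ := fun _ : σ => 𝕜) i).comp
            (e : E →L[𝕜] (σ → 𝕜))) x :=
        ((ContinuousLinearMap.proj (R := 𝕜) (φ := fun _ : σ => 𝕜) i).comp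
            (e : E →L[𝕜] (σ → 𝕜))).hasFDerivAt
      change fderiv 𝕜 (fun x : E => e x i) x v = e v i • (1 : 𝕜)
      rw [h2.fderiv]
      simp
    rw [h1]
    exact Subalgebra.algebraMap_mem _ _
  | algebraMap r => rw [Derivation.map_algebraMap]; exact Subalgebra.zero_mem _
  | add x y _ _ hx hy => rw [map_add]; exact Subalgebra.add_mem _ hx hy
  | mul x y hx' hy' hx hy =>
    rw [Derivation.leibniz]
    exact Subalgebra.add_mem _ (Subalgebra.mul_mem _ hx' hy) (Subalgebra.mul_mem _ hy' hx)

end Derivative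

section Pullback

/-- Pullback of functions. -/
def functionPullback (g : E → E') : (E' → 𝕜) →ₐ[𝕜] (E → 𝕜) where
  toFun f := f ∘ g
  map_one' := rfl
  map_mul' _ _ := rfl
  map_zero' := rfl
  map_add' _ _ := rfl
  commutes' _ := rfl

/-- Pullback of germs. -/
def germPullback (g : E → E') (p : E) (hg : AnalyticAt 𝕜 g p) :
    AnalyticGerm 𝕜 𝕜 (g p) →ₐ[𝕜] AnalyticGerm 𝕜 𝕜 p :=
  analyticGermMap (K := 𝕜) (functionPullback g) (fun f hf => (AnalyticAt.comp hf hg : AnalyticAt 𝕜 (f ∘ g) p))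
    (fun _ hf => hg.continuousAt.eventually hf)

theorem germPullback_analyticGerm {g : E → E'} {p : E} (hg : AnalyticAt 𝕜 g p) {f : E' → 𝕜}
    (hf : AnalyticAt 𝕜 f (g p)) :
    germPullback g p hg (analyticGerm 𝕜 f hf) = analyticGerm 𝕜 (f ∘ g) (hf.comp hg) := rfl

theorem germPullback_injective {g : E → E'} {p : E} (hg : AnalyticAt 𝕜 g p)
    (h : ∀ f : E' → 𝕜, AnalyticAt 𝕜 f (g p) → (∀ᶠ x in 𝓝 p, f (g x) = 0) →
      ∀ᶠ y in 𝓝 (g p), f y = 0) : Function.Injective (germPullback g p hg) :=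
  analyticGermMap_injective _ _ _ h

/-- Injectivity of the pullback keeps the relation satisfied by `f` from degenerating along the
image of `g`; `IsNashAt.comp` removes this hypothesis. -/
theorem IsNashAt.comp_of_injective {e : E ≃L[𝕜] (σ → 𝕜)} {e' : E' ≃L[𝕜] (τ → 𝕜)} {g : E → E'}
    {p : E} (hg : AnalyticAt 𝕜 g p) (hgN : ∀ j, IsNashAt e (fun x => e' (g x) j) p)
    (hinj : ∀ f : E' → 𝕜, AnalyticAt 𝕜 f (g p) → (∀ᶠ x in 𝓝 p, f (g x) = 0) →
      ∀ᶠ y in 𝓝 (g p), f y = 0)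
    {f : E' → 𝕜} (hf : IsNashAt e' f (g p)) : IsNashAt e (f ∘ g) p := by
  refine ⟨hf.1.comp hg, (isAlgebraicAt_iff e (hf.1.comp hg)).2 ?_⟩
  rw [← germPullback_analyticGerm hg hf.1]
  refine isAlgebraic_adjoin_map (germPullback g p hg) (germPullback_injective hg hinj) ?_
    ((isAlgebraicAt_iff e' hf.1).1 hf.2)
  rintro _ ⟨j, rfl⟩
  exact (isAlgebraicAt_iff e (hgN j).1).1 (hgN j).2

/-- The inverse of a Nash diffeomorphism is Nash. -/
theorem IsNashAt.inverse {e : E ≃L[𝕜] (σ → 𝕜)} {e' : E' ≃L[𝕜] (τ → 𝕜)}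
    (hcard : Fintype.card σ ≤ Fintype.card τ) {g : E → E'} {f : E' → E} {q : E'}
    (hf : AnalyticAt 𝕜 f q) (hg : ∀ j, IsNashAt e (fun x => e' (g x) j) (f q))
    (hgq : g (f q) = q) (hgc : ContinuousAt g (f q))
    (hgf : ∀ᶠ y in 𝓝 q, g (f y) = y) (hfg : ∀ᶠ x in 𝓝 (f q), f (g x) = x) (i : σ) :
    IsNashAt e' (fun y => e (f y) i) q := by
  have hinj : Function.Injective (germPullback f q hf) := by
    refine germPullback_injective hf fun k _ hk => ?_
    have : Tendsto g (𝓝 (f q)) (𝓝 q) := by simpa [ContinuousAt, hgq] using hgc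
    filter_upwards [this.eventually hk, hfg] with x h1 h2
    rwa [h2] at h1
  have han : AnalyticAt 𝕜 (fun y => e (f y) i) q := (analyticAt_coord e (f q) i).comp hf
  refine ⟨han, (isAlgebraicAt_iff e' han).2 ?_⟩
  -- Since y_j = g_j(f(y)), the coordinates of the target are algebraic over the components of `f`.
  -- Exchange reverses this dependence.
  refine isAlgebraic_adjoin_exchange (x := fun i => germPullback f q hf (coordGerm e (f q) i))
    hcard (algebraicIndependent_coordGerm e' q) (fun j => ?_) i
  have h1 : coordGerm e' q j = germPullback f q hf (analyticGerm 𝕜 _ (hg j).1) := by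
    rw [germPullback_analyticGerm]
    refine analyticGerm_congr _ _ ?_
    filter_upwards [hgf] with y hy
    simp [hy]
  rw [h1]
  refine isAlgebraic_adjoin_map _ hinj ?_ ((isAlgebraicAt_iff e (hg j).1).1 (hg j).2)
  rintro _ ⟨i, rfl⟩
  exact isAlgebraic_algebraMap (⟨_, Algebra.subset_adjoin ⟨i, rfl⟩⟩ : Algebra.adjoin 𝕜
    (Set.range fun i => germPullback f q hf (coordGerm e (f q) i)))

end Pullback

end Nash

/-! ### Composition of Nash functions. -/

section NashComposition

variable {𝕜 : Type*} [RCLike 𝕜] {E : Type*} [NormedAddCommGroup E] [NormedSpace 𝕜 E]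
  {E' : Type*} [NormedAddCommGroup E'] [NormedSpace 𝕜 E']
  {σ : Type*} [Fintype σ] {τ : Type*} [Fintype τ]

/-- Coordinates on a product. -/
def prodCoords (e : E ≃L[𝕜] (σ → 𝕜)) (τ : Type*) [Fintype τ] :
    (E × (τ → 𝕜)) ≃L[𝕜] (σ ⊕ τ → 𝕜) :=
  (e.prodCongr (ContinuousLinearEquiv.refl 𝕜 (τ → 𝕜))).trans
    (LinearEquiv.sumArrowLequivProdArrow σ τ 𝕜 𝕜).symm.toContinuousLinearEquiv

theorem prodCoords_apply (e : E ≃L[𝕜] (σ → 𝕜)) (x : E) (u : τ → 𝕜) :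
    prodCoords e τ (x, u) = Sum.elim (e x) u := by
  ext (i | i) <;> rfl

/-- Algebraicity is inherited by restrictions to coordinate subspaces, even when the polynomial
equation degenerates there. -/
theorem IsNashAt.restrict {e : E ≃L[𝕜] (σ → 𝕜)} {F : E × (τ → 𝕜) → 𝕜} {p : E}
    (hF : IsNashAt (prodCoords e τ) F (p, 0)) : IsNashAt e (fun x => F (x, 0)) p := by
  have han : AnalyticAt 𝕜 (fun x : E => F (x, 0)) p :=
    AnalyticAt.comp (g := F) hF.1 (analyticAt_id.prod analyticAt_const)
  refine ⟨han, ?_⟩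
  obtain ⟨Q, hQ, hev⟩ := hF.2
  obtain ⟨y₀, hy₀⟩ : ∃ y, MvPolynomial.eval y Q ≠ 0 := by
    by_contra! h
    exact hQ (MvPolynomial.funext fun y => by rw [h y, map_zero])
  -- The equation is restricted to u = s • u₀ and viewed as a polynomial in s over the polynomials
  -- in x and the value of F. It is nonzero because at s = 1 it takes the value of `Q` at `y₀`.
  let u₀ : τ → 𝕜 := fun a => y₀ (some (Sum.inr a))
  let sub : Option (σ ⊕ τ) → Polynomial (MvPolynomial (Option σ) 𝕜) := fun o =>
    o.elim (Polynomial.C (MvPolynomial.X none)) (Sum.elim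
      (fun i => Polynomial.C (MvPolynomial.X (some i)))
      (fun a => Polynomial.C (MvPolynomial.C (u₀ a)) * Polynomial.X))
  let Q' : Polynomial (MvPolynomial (Option σ) 𝕜) := MvPolynomial.aeval sub Q
  have hQ' : ∀ (x : σ → 𝕜) (T s : 𝕜),
      (Q'.map (MvPolynomial.eval fun o : Option σ => o.elim T x)).eval s =
        MvPolynomial.eval (fun o : Option (σ ⊕ τ) => o.elim T (Sum.elim x (s • u₀))) Q := by
    intro x T s
    let ψ : Polynomial (MvPolynomial (Option σ) 𝕜) →ₐ[𝕜] 𝕜 :=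
      { toRingHom := (Polynomial.evalRingHom s).comp (Polynomial.mapRingHom
          (MvPolynomial.eval fun o : Option σ => o.elim T x))
        commutes' := fun r => by
          simp [Polynomial.algebraMap_apply, MvPolynomial.algebraMap_eq] }
    have h1 : ψ Q' = MvPolynomial.aeval (fun o => ψ (sub o)) Q :=
      MvPolynomial.comp_aeval_apply (f := sub) ψ Q
    have h2 : (fun o => ψ (sub o)) =
        fun o : Option (σ ⊕ τ) => o.elim T (Sum.elim x (s • u₀)) := by
      ext (_ | i | a)
      · simp [ψ, sub]
      · simp [ψ, sub]
      · change Polynomial.eval s (Polynomial.map _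
          (Polynomial.C (MvPolynomial.C (u₀ a)) * Polynomial.X)) = s * u₀ a
        rw [Polynomial.map_mul, Polynomial.map_C, Polynomial.map_X, Polynomial.eval_mul,
          Polynomial.eval_C, Polynomial.eval_X, MvPolynomial.eval_C, mul_comm]
    rw [h2, MvPolynomial.aeval_eq_eval] at h1
    exact h1
  have hQ'0 : Q' ≠ 0 := by
    intro h
    have h1 := hQ' (fun i => y₀ (some (Sum.inl i))) (y₀ none) 1
    rw [h] at h1
    have h2 : (fun o : Option (σ ⊕ τ) => o.elim (y₀ none)
        (Sum.elim (fun i => y₀ (some (Sum.inl i))) ((1 : 𝕜) • u₀))) = y₀ := by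
      ext (_ | i | a) <;> simp [u₀]
    rw [h2] at h1
    exact hy₀ (by simpa using h1.symm)
  -- The full power of s is divided out, so the constant term of `R` is nonzero. The relation for
  -- `R` holds for small s ≠ 0, and at s = 0 by continuity.
  obtain ⟨R, hR, hdvd⟩ := Polynomial.exists_eq_pow_rootMultiplicity_mul_and_not_dvd Q' hQ'0 0
  set k := Polynomial.rootMultiplicity 0 Q'
  rw [map_zero, sub_zero] at hR hdvd
  refine ⟨R.coeff 0, fun h => hdvd (Polynomial.X_dvd_iff.2 h), ?_⟩
  have hcont : ∀ᶠ x : E in 𝓝 p, ContinuousAt F (x, 0) := by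
    have hc : Tendsto (fun x : E => (x, (0 : τ → 𝕜))) (𝓝 p) (𝓝 (p, 0)) :=
      (Continuous.prodMk_left (0 : τ → 𝕜)).tendsto p
    exact hc.eventually hF.1.eventually_continuousAt
  have hev' : ∀ᶠ x : E in 𝓝 p, ∀ᶠ u in 𝓝 (0 : τ → 𝕜), MvPolynomial.eval
      (fun o : Option (σ ⊕ τ) => o.elim (F (x, u)) (Sum.elim (e x) u)) Q = 0 := by
    have h1 := hev
    simp only [← prodCoords_apply]
    rw [nhds_prod_eq] at h1
    exact h1.curry
  filter_upwards [hev', hcont] with x h1 h2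
  have hs : Tendsto (fun s : 𝕜 => s • u₀) (𝓝 0) (𝓝 0) := by
    have : Continuous fun s : 𝕜 => s • u₀ := by fun_prop
    simpa using this.tendsto 0
  let φ : 𝕜 → 𝕜 := fun s =>
    (R.map (MvPolynomial.eval fun o : Option σ => o.elim (F (x, s • u₀)) (e x))).eval s
  have hφ0 : ∀ᶠ s in 𝓝[≠] (0 : 𝕜), φ s = 0 := by
    filter_upwards [(hs.eventually h1).filter_mono nhdsWithin_le_nhds, self_mem_nhdsWithin]
      with s h3 h4
    rw [← hQ', hR, Polynomial.map_mul, Polynomial.map_pow, Polynomial.map_X, Polynomial.eval_mul,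
      Polynomial.eval_pow, Polynomial.eval_X] at h3
    exact (mul_eq_zero.1 h3).resolve_left (pow_ne_zero _ h4)
  have hφc : ContinuousAt φ 0 := by
    have h3 : φ = fun s => ∑ i ∈ Finset.range (R.natDegree + 1),
        MvPolynomial.eval (fun o : Option σ => o.elim (F (x, s • u₀)) (e x)) (R.coeff i) * s ^ i := by
      ext s
      simp only [φ]
      rw [Polynomial.eval_map, Polynomial.eval₂_eq_sum_range]
    rw [h3]
    have h4 : ContinuousAt (fun s : 𝕜 => F (x, s • u₀)) 0 := by
      refine ContinuousAt.comp_of_eq (g := F) (y := (x, 0)) h2 ?_ (by simp)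
      fun_prop
    have h5 : ContinuousAt (fun s : 𝕜 => fun o : Option σ => o.elim (F (x, s • u₀)) (e x)) 0 := by
      rw [continuousAt_pi]
      rintro (_ | i)
      · exact h4
      · exact continuousAt_const
    refine tendsto_finsetSum _ fun i _ => ?_
    exact ((MvPolynomial.continuous_eval (R.coeff i)).continuousAt.comp h5).mul
      (continuousAt_id.pow i)
  have h6 : φ 0 = 0 := by
    have h7 : Tendsto φ (𝓝[≠] 0) (𝓝 (φ 0)) := hφc.tendsto.mono_left nhdsWithin_le_nhds
    exact tendsto_nhds_unique (h7.congr' hφ0) tendsto_const_nhds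
  have h8 : φ 0 = MvPolynomial.eval (fun o : Option σ => o.elim (F (x, 0)) (e x)) (R.coeff 0) := by
    simp only [φ, zero_smul]
    rw [← Polynomial.coeff_zero_eq_eval_zero, Polynomial.coeff_map]
  rw [← h8, h6]

/-- Pullback by `g` may fail to be injective on germs. Adding parameters gives the submersion G(x,
u) = g(x) + u in the coordinates `e'`, whose pullback is injective; `IsNashAt.restrict` then returns
to u = 0. -/
theorem IsNashAt.comp {e : E ≃L[𝕜] (σ → 𝕜)} {e' : E' ≃L[𝕜] (τ → 𝕜)} {g : E → E'}
    {p : E} (hg : ∀ j, IsNashAt e (fun x => e' (g x) j) p)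
    {f : E' → 𝕜} (hf : IsNashAt e' f (g p)) : IsNashAt e (f ∘ g) p := by
  have hga : AnalyticAt 𝕜 g p := by
    have h1 : AnalyticAt 𝕜 (fun x => e' (g x)) p := by
      rw [analyticAt_pi_iff]
      exact fun j => (hg j).1
    have h2 := ((e'.symm : (τ → 𝕜) →L[𝕜] E').analyticAt _).comp h1
    simpa [Function.comp_def] using h2
  let G : E × (τ → 𝕜) → E' := fun y => g y.1 + e'.symm y.2
  have hG0 : G (p, 0) = g p := by simp [G]
  have hGa : AnalyticAt 𝕜 G (p, 0) := by
    have h1 : AnalyticAt 𝕜 (fun y : E × (τ → 𝕜) => g y.1) (p, 0) :=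
      AnalyticAt.comp (g := g) hga analyticAt_fst
    exact h1.add (((e'.symm : (τ → 𝕜) →L[𝕜] E').analyticAt _).comp analyticAt_snd)
  have hfst : ∀ {k : E → 𝕜}, IsNashAt e k p →
      IsNashAt (prodCoords e τ) (fun y : E × (τ → 𝕜) => k y.1) (p, 0) := by
    intro k hk
    refine IsNashAt.comp_of_injective (g := Prod.fst) (e' := e) analyticAt_fst (fun i => ?_) ?_ hk
    · exact isNashAt_coord (prodCoords e τ) _ (Sum.inl i)
    · intro k _ h
      have hc : Tendsto (fun x : E => (x, (0 : τ → 𝕜))) (𝓝 p) (𝓝 (p, 0)) :=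
        (Continuous.prodMk_left (0 : τ → 𝕜)).tendsto p
      exact hc.eventually h
  have hGN : ∀ j, IsNashAt (prodCoords e τ) (fun y => e' (G y) j) (p, 0) := by
    intro j
    have h1 := (nashSubalgebra (prodCoords e τ) (p, 0)).add_mem (hfst (hg j))
      (isNashAt_coord (prodCoords e τ) (p, 0) (Sum.inr j))
    refine IsNashAt.congr h1 (Eventually.of_forall fun y => ?_)
    simp [G, prodCoords_apply (E := E) (τ := τ) e y.1 y.2]
  have hfG : IsNashAt (prodCoords e τ) (f ∘ G) (p, 0) := by
    refine IsNashAt.comp_of_injective (e' := e') hGa hGN (fun k _ h => ?_) (by rwa [hG0])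
    rw [hG0]
    have hc : Tendsto (fun y : E' => (p, e' (y - g p))) (𝓝 (g p)) (𝓝 (p, 0)) := by
      have : Continuous fun y : E' => (p, e' (y - g p)) := by fun_prop
      simpa using this.tendsto (g p)
    filter_upwards [hc.eventually h] with y hy
    simpa [G] using hy
  have := hfG.restrict
  simpa [G, Function.comp_def] using this

end NashComposition

/-! ### Real and complex algebraicity compared. -/

section RealAndComplex

variable {ι : Type*}

/-- Real and imaginary parts as real linear coordinates. -/
def realCoordsEquiv (ι : Type*) [Fintype ι] : (ι → ℂ) ≃L[ℝ] (ι ⊕ ι → ℝ) :=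
  LinearEquiv.toContinuousLinearEquiv
    { toFun := realCoords
      invFun := fun y i => ⟨y (Sum.inl i), y (Sum.inr i)⟩
      map_add' := fun x y => by ext (i | i) <;> simp [realCoords]
      map_smul' := fun a x => by ext (i | i) <;> simp [realCoords]
      left_inv := fun x => by ext i; simp [realCoords]
      right_inv := fun y => by ext (i | i) <;> simp [realCoords] }

instance (p : ι → ℂ) [Fintype ι] : IsScalarTower ℝ ℂ (AnalyticGerm ℝ ℂ p) :=
  IsScalarTower.of_algebraMap_eq fun _ => rfl

variable [Fintype ι]

/-- `f` is algebraic over the complex polynomials in z. Complex constants are algebraic over ℝ, and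
φ(z_i) is a combination of real coordinates, so algebraicity passes down. The map `φ` will be the
identity or conjugation. -/
theorem isAlgebraic_conj_or_self_realCoords {p : ι → ℂ} {f : (ι → ℂ) → ℂ} (hf : AnalyticAt ℂ f p)
    (halg : IsAlgebraicAt (fun x : ι → ℂ => x) f p)
    (x : ι ⊕ ι → AnalyticGerm ℝ ℂ p)
    (φ : AnalyticGerm ℝ ℂ p →+* AnalyticGerm ℝ ℂ p) (hφ : Function.Injective φ)
    (hφc : ∀ a : ℂ, ∃ b : ℂ, φ (algebraMap ℂ _ a) = algebraMap ℂ _ b)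
    (hφz : ∀ i, ∃ b : ℂ, φ (analyticGerm ℝ (fun y : ι → ℂ => y i)
      ((ContinuousLinearMap.proj (R := ℝ) (φ := fun _ : ι => ℂ) i).analyticAt p)) =
        x (Sum.inl i) + algebraMap ℂ _ b * x (Sum.inr i)) :
    IsAlgebraic (Algebra.adjoin ℝ (Set.range x)) (φ (analyticGerm ℝ f hf.restrictScalars)) := by
  let z : ι → AnalyticGerm ℝ ℂ p := fun i => analyticGerm ℝ (fun y : ι → ℂ => y i)
      ((ContinuousLinearMap.proj (R := ℝ) (φ := fun _ : ι => ℂ) i).analyticAt p)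
  have hz : AlgebraicIndependent ℂ z := by
    refine (algebraicIndependent_analyticGerm _ _).2 fun P hP => ?_
    refine mvPolynomial_eq_zero_of_eventually (ContinuousLinearEquiv.refl ℂ (ι → ℂ)) (p := p) P ?_
    simpa [MvPolynomial.aeval_eq_eval] using hP
  have h1 : IsAlgebraic (Algebra.adjoin ℂ (Set.range z)) (analyticGerm ℝ f hf.restrictScalars) := by
    by_contra hcon
    have h2 := (hz.option_iff_transcendental _).2 hcon
    let w : Option ι → (ι → ℂ) → ℂ := fun o => o.elim f fun i y => y i
    have hw : ∀ o, AnalyticAt ℝ (w o) p := by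
      rintro (_ | i)
      · exact hf.restrictScalars
      · exact (ContinuousLinearMap.proj (R := ℝ) (φ := fun _ : ι => ℂ) i).analyticAt p
    have h3 : (fun o : Option ι => o.elim (analyticGerm ℝ f hf.restrictScalars) z) =
        fun o => analyticGerm ℝ (w o) (hw o) := by
      ext (_ | i) <;> rfl
    rw [h3, algebraicIndependent_analyticGerm] at h2
    obtain ⟨P, hP, hev⟩ := halg
    refine hP (h2 P ?_)
    filter_upwards [hev] with y hy
    rw [MvPolynomial.aeval_eq_eval]
    have h4 : (fun o : Option ι => w o y) = fun o => o.elim (f y) y := by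
      ext (_ | i) <;> rfl
    rw [h4]
    exact hy
  refine isAlgebraic_adjoin_of_ringHom _ φ hφ (fun s hs => ?_) h1
  let C := Subalgebra.algebraicClosure (Algebra.adjoin ℝ (Set.range x)) (AnalyticGerm ℝ ℂ p)
  have hC : ∀ a : ℂ, algebraMap ℂ (AnalyticGerm ℝ ℂ p) a ∈ C := fun a => by
    have h4 : IsAlgebraic ℝ a := Algebra.IsAlgebraic.isAlgebraic a
    have h5 : IsAlgebraic ℝ (algebraMap ℂ (AnalyticGerm ℝ ℂ p) a) := h4.algebraMap
    exact h5.extendScalars (S := Algebra.adjoin ℝ (Set.range x)) (algebraMap ℝ _).injective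
  have hx : ∀ i, x i ∈ C := fun i =>
    isAlgebraic_algebraMap (⟨x i, Algebra.subset_adjoin ⟨i, rfl⟩⟩ :
      Algebra.adjoin ℝ (Set.range x))
  change φ s ∈ C
  induction hs using Algebra.adjoin_induction with
  | mem s hs =>
    obtain ⟨i, rfl⟩ := hs
    obtain ⟨b, hb⟩ := hφz i
    rw [hb]
    exact C.add_mem (hx _) (C.mul_mem (hC b) (hx _))
  | algebraMap r =>
    obtain ⟨b, hb⟩ := hφc r
    rw [hb]
    exact hC b
  | add a b _ _ ha hb => rw [map_add]; exact C.add_mem ha hb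
  | mul a b _ _ ha hb => rw [map_mul]; exact C.mul_mem ha hb

/-- Complex conjugation of germs of real analytic functions. -/
def germConj (p : ι → ℂ) : AnalyticGerm ℝ ℂ p →ₐ[ℝ] AnalyticGerm ℝ ℂ p :=
  analyticGermMap (K := ℝ) ((Complex.conjAe : ℂ →ₐ[ℝ] ℂ).compLeft (ι → ℂ))
    (fun _ hf => ((Complex.conjCLE : ℂ →L[ℝ] ℂ).analyticAt _).comp hf)
    (fun f hf => by
      filter_upwards [hf] with x hx
      change (starRingEnd ℂ) (f x) = 0
      rw [hx, map_zero])

theorem germConj_analyticGerm {p : ι → ℂ} {f : (ι → ℂ) → ℂ} (hf : AnalyticAt ℝ f p) :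
    germConj p (analyticGerm ℝ f hf) = analyticGerm ℝ (fun x => (starRingEnd ℂ) (f x))
      (((Complex.conjCLE : ℂ →L[ℝ] ℂ).analyticAt _).comp hf) := rfl

theorem germConj_injective (p : ι → ℂ) : Function.Injective (germConj p) := by
  refine analyticGermMap_injective _ _ _ fun f _ h => ?_
  filter_upwards [h] with x hx
  exact (map_eq_zero (starRingEnd ℂ)).1 hx

theorem analyticGerm_eq_of_eventually {𝕜 : Type*} [RCLike 𝕜] {E : Type*} [NormedAddCommGroup E]
    [NormedSpace 𝕜 E] {A : Type*} [NormedField A] [NormedAlgebra 𝕜 A] [CompleteSpace A]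
    {p : E} {f g : E → A} (hf : AnalyticAt 𝕜 f p) (hg : AnalyticAt 𝕜 g p) (h : f =ᶠ[𝓝 p] g) :
    analyticGerm 𝕜 f hf = analyticGerm 𝕜 g hg := by
  have h1 : analyticGerm 𝕜 (f + (fun _ => -1) * g) (hf.add (analyticAt_const.mul hg)) = 0 := by
    rw [analyticGerm_eq_zero_iff]
    filter_upwards [h] with x hx
    simp [hx]
  rw [analyticGerm_add hf (analyticAt_const.mul hg), analyticGerm_mul analyticAt_const hg] at h1
  have h2 : analyticGerm 𝕜 (fun _ : E => (-1 : A)) (analyticAt_const (x := p)) = -1 := by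
    have := (AnalyticGerm.mk 𝕜 A A p).commutes (-1)
    rw [map_neg, map_one, map_neg, map_one] at this
    exact (AnalyticGerm.mk 𝕜 A A p).commutes (-1 : A) |>.trans (by simp)
  rw [h2] at h1
  linear_combination h1

/-- Both parts are ℂ-linear combinations of `f` and its conjugate, which are algebraic over the real
coordinate germs by the previous lemma applied twice. -/
theorem isNashAt_re_im {p : ι → ℂ} {f : (ι → ℂ) → ℂ} (hf : AnalyticAt ℂ f p)
    (halg : IsAlgebraicAt (fun x : ι → ℂ => x) f p) :
    IsNashAt (realCoordsEquiv ι) (fun x => (f x).re) p ∧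
      IsNashAt (realCoordsEquiv ι) (fun x => (f x).im) p := by
  have hfR : AnalyticAt ℝ f p := hf.restrictScalars
  have hofR : ∀ {g : (ι → ℂ) → ℝ}, AnalyticAt ℝ g p →
      AnalyticAt ℝ (fun x => (g x : ℂ)) p := fun hg =>
    (Complex.ofRealCLM.analyticAt _).comp hg
  have hxa : ∀ i, AnalyticAt ℝ (fun y : ι → ℂ => (realCoords y i : ℂ)) p := fun i =>
    hofR (analyticAt_coord (realCoordsEquiv ι) p i)
  let x : ι ⊕ ι → AnalyticGerm ℝ ℂ p := fun i => analyticGerm ℝ _ (hxa i)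
  have hxi : AlgebraicIndependent ℝ x := by
    refine (algebraicIndependent_analyticGerm _ _).2 fun P hP => ?_
    refine mvPolynomial_eq_zero_of_eventually (realCoordsEquiv ι) (p := p) P ?_
    filter_upwards [hP] with y hy
    have h1 : MvPolynomial.aeval (fun i => ((realCoords y i : ℝ) : ℂ)) P =
        ((MvPolynomial.aeval (realCoords y) P : ℝ) : ℂ) :=
      (MvPolynomial.comp_aeval_apply (f := realCoords y) Complex.ofRealAm P).symm
    rw [h1] at hy
    exact Complex.ofReal_eq_zero.1 hy
  let C := Subalgebra.algebraicClosure (Algebra.adjoin ℝ (Set.range x)) (AnalyticGerm ℝ ℂ p)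
  have hmk : ∀ a : ℂ, algebraMap ℂ (AnalyticGerm ℝ ℂ p) a =
      analyticGerm ℝ (fun _ => a) analyticAt_const := fun a =>
    ((AnalyticGerm.mk ℝ ℂ ℂ p).commutes a).symm
  have hF : analyticGerm ℝ f hfR ∈ C := by
    refine isAlgebraic_conj_or_self_realCoords hf halg x (RingHom.id _) Function.injective_id
      (fun a => ⟨a, rfl⟩) fun i => ⟨Complex.I, ?_⟩
    rw [hmk]
    simp only [x]
    rw [← analyticGerm_mul, ← analyticGerm_add]
    refine analyticGerm_eq_of_eventually _ _ (Eventually.of_forall fun y => ?_)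
    simp [realCoords, mul_comm Complex.I]
  have hF' : germConj p (analyticGerm ℝ f hfR) ∈ C := by
    refine isAlgebraic_conj_or_self_realCoords hf halg x (germConj p : _ →+* _)
      (germConj_injective p) (fun a => ⟨(starRingEnd ℂ) a, ?_⟩) fun i => ⟨-Complex.I, ?_⟩
    · rw [hmk, hmk]; rfl
    · rw [hmk]
      refine (germConj_analyticGerm _).trans ?_
      simp only [x]
      rw [← analyticGerm_mul, ← analyticGerm_add]
      refine analyticGerm_eq_of_eventually _ _ (Eventually.of_forall fun y => ?_)
      apply Complex.ext <;> simp [realCoords]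
  have hC : ∀ a : ℂ, algebraMap ℂ (AnalyticGerm ℝ ℂ p) a ∈ C := fun a => by
    have h4 : IsAlgebraic ℝ a := Algebra.IsAlgebraic.isAlgebraic a
    have h5 : IsAlgebraic ℝ (algebraMap ℂ (AnalyticGerm ℝ ℂ p) a) := h4.algebraMap
    exact h5.extendScalars (S := Algebra.adjoin ℝ (Set.range x)) (algebraMap ℝ _).injective
  have key : ∀ (g : (ι → ℂ) → ℝ) (hg : AnalyticAt ℝ g p) (a b : ℂ),
      (∀ y, (g y : ℂ) = a * f y + b * (starRingEnd ℂ) (f y)) →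
      IsNashAt (realCoordsEquiv ι) g p := by
    intro g hg a b hab
    refine ⟨hg, ?_⟩
    have h1 : analyticGerm ℝ (fun y => (g y : ℂ)) (hofR hg) ∈ C := by
      have h2 : analyticGerm ℝ (fun y => (g y : ℂ)) (hofR hg) =
          algebraMap ℂ _ a * analyticGerm ℝ f hfR +
            algebraMap ℂ _ b * germConj p (analyticGerm ℝ f hfR) := by
        have hfc : AnalyticAt ℝ (fun y => (starRingEnd ℂ) (f y)) p :=
          ((Complex.conjCLE : ℂ →L[ℝ] ℂ).analyticAt _).comp hfR
        rw [hmk, hmk]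
        exact analyticGerm_eq_of_eventually (hofR hg)
          ((analyticAt_const.mul hfR).add (analyticAt_const.mul hfc))
          (Eventually.of_forall fun y => hab y)
      rw [h2]
      exact C.add_mem (C.mul_mem (hC a) hF) (C.mul_mem (hC b) hF')
    let w : Option (ι ⊕ ι) → (ι → ℂ) → ℂ := fun o => o.elim (fun y => (g y : ℂ))
      fun i y => (realCoords y i : ℂ)
    have hw : ∀ o, AnalyticAt ℝ (w o) p := by
      rintro (_ | i)
      · exact hofR hg
      · exact hxa i
    have h3 : (fun o : Option (ι ⊕ ι) => o.elim (analyticGerm ℝ _ (hofR hg)) x) =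
        fun o => analyticGerm ℝ (w o) (hw o) := by
      ext (_ | i) <;> rfl
    by_contra hcon
    refine absurd h1 (?_ : Transcendental _ _)
    rw [← hxi.option_iff_transcendental, h3, algebraicIndependent_analyticGerm]
    intro P hP
    by_contra hne
    refine hcon ⟨P, hne, ?_⟩
    filter_upwards [hP] with y hy
    have h4 : (fun o => w o y) =
        fun o => ((o.elim (g y) (realCoords y) : ℝ) : ℂ) := by
      ext (_ | i) <;> rfl
    rw [h4] at hy
    have h5 : MvPolynomial.aeval (fun o : Option (ι ⊕ ι) =>
        ((o.elim (g y) (realCoords y) : ℝ) : ℂ)) P =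
        ((MvPolynomial.aeval (fun o : Option (ι ⊕ ι) => o.elim (g y) (realCoords y)) P : ℝ) : ℂ) :=
      (MvPolynomial.comp_aeval_apply (f := fun o : Option (ι ⊕ ι) => o.elim (g y) (realCoords y))
        Complex.ofRealAm P).symm
    rw [h5] at hy
    exact Complex.ofReal_eq_zero.1 hy
  refine ⟨key _ ((Complex.reCLM.analyticAt _).comp hfR) (1 / 2) (1 / 2) fun y => ?_,
    key _ ((Complex.imCLM.analyticAt _).comp hfR) (-Complex.I / 2) (Complex.I / 2) fun y => ?_⟩
  · apply Complex.ext <;> simp <;> ring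
  · apply Complex.ext <;> simp <;> ring

/-- The complexification of a real algebraic function is algebraic. -/
theorem IsNashAt.of_complexification {σ : Type*} [Fintype σ] [DecidableEq σ] {f : (σ → ℝ) → ℝ} {p : σ → ℝ}
    (hf : IsAlgebraicAt (fun x : σ → ℝ => x) f p) {F : (σ → ℂ) → ℂ}
    (hF : AnalyticAt ℂ F (fun i => (p i : ℂ)))
    (hfF : ∀ᶠ x in 𝓝 p, F (fun i => (x i : ℂ)) = f x) :
    IsNashAt (ContinuousLinearEquiv.refl ℂ (σ → ℂ)) F (fun i => (p i : ℂ)) := by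
  obtain ⟨P, hP, hev⟩ := hf
  refine ⟨hF, MvPolynomial.map Complex.ofRealHom P,
    fun h => hP (MvPolynomial.map_injective _ Complex.ofRealHom.injective
      (by rw [h, map_zero])), ?_⟩
  -- The real equation, read with complex coefficients, holds at the real points and so propagates
  -- to a complex neighborhood.
  refine eventually_eq_zero_of_real ?_ ?_
  · let w : Option σ → (σ → ℂ) → ℂ := fun o => o.elim F fun i y => y i
    have hw : ∀ o, AnalyticAt ℂ (w o) (fun i => (p i : ℂ)) := by
      rintro (_ | i)
      · exact hF
      · exact (ContinuousLinearMap.proj (R := ℂ) (φ := fun _ : σ => ℂ) i).analyticAt _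
    have h4 := AnalyticAt.aeval_mvPolynomial hw (MvPolynomial.map Complex.ofRealHom P)
    have h5 : ∀ y : σ → ℂ, (fun o : Option σ => o.elim (F y)
        ((ContinuousLinearEquiv.refl ℂ (σ → ℂ)) y)) = fun o => w o y := fun y => by
      ext (_ | i) <;> rfl
    simp only [MvPolynomial.aeval_eq_eval] at h4
    simp only [h5]
    exact h4
  · filter_upwards [hev, hfF] with x h1 h2
    rw [MvPolynomial.eval_map]
    have h3 : (fun o : Option σ => o.elim (F fun i => (x i : ℂ))
        ((ContinuousLinearEquiv.refl ℂ (σ → ℂ)) fun i => (x i : ℂ))) =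
        fun o => Complex.ofRealHom (o.elim (f x) x) := by
      ext (_ | i)
      · simp [h2]
      · simp
    rw [h3]
    have h4 := MvPolynomial.eval₂_comp_left Complex.ofRealHom (RingHom.id ℝ)
      (fun o : Option σ => o.elim (f x) x) P
    have h5 : MvPolynomial.eval₂ (RingHom.id ℝ) (fun o : Option σ => o.elim (f x) x) P = 0 := h1
    rw [h5, map_zero] at h4
    exact h4.symm

end RealAndComplex

/-! ### Uniform treatment of the algebraic and analytic categories. -/

section Regularity

variable {ι κ : Type*} [Fintype ι] [Fintype κ] {c : Regularity}

theorem isComplexRegularAt_iff {f : (ι → ℂ) → ℂ} {p : ι → ℂ} :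
    IsComplexRegularAt c f p ↔ AnalyticAt ℂ f p ∧
      (c = Regularity.algebraic → IsNashAt (ContinuousLinearEquiv.refl ℂ (ι → ℂ)) f p) :=
  ⟨fun h => ⟨h.1, fun hc => ⟨h.1, h.2 hc⟩⟩, fun h => ⟨h.1, fun hc => (h.2 hc).2⟩⟩

theorem isRealRegularAt_iff {f : (ι → ℂ) → ℝ} {p : ι → ℂ} :
    IsRealRegularAt c f p ↔ AnalyticAt ℝ f p ∧
      (c = Regularity.algebraic → IsNashAt (realCoordsEquiv ι) f p) :=
  ⟨fun h => ⟨h.1, fun hc => ⟨h.1, h.2 hc⟩⟩, fun h => ⟨h.1, fun hc => (h.2 hc).2⟩⟩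

/-- The algebra of regular complex functions. -/
def complexRegularSubalgebra (c : Regularity) (p : ι → ℂ) : Subalgebra ℂ ((ι → ℂ) → ℂ) where
  carrier := {f | IsComplexRegularAt c f p}
  mul_mem' hf hg := isComplexRegularAt_iff.2 ⟨hf.1.mul hg.1, fun hc =>
    (nashSubalgebra _ p).mul_mem ((isComplexRegularAt_iff.1 hf).2 hc)
      ((isComplexRegularAt_iff.1 hg).2 hc)⟩
  add_mem' hf hg := isComplexRegularAt_iff.2 ⟨hf.1.add hg.1, fun hc =>
    (nashSubalgebra _ p).add_mem ((isComplexRegularAt_iff.1 hf).2 hc)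
      ((isComplexRegularAt_iff.1 hg).2 hc)⟩
  algebraMap_mem' a := isComplexRegularAt_iff.2 ⟨analyticAt_const, fun _ =>
    isNashAt_const _ a p⟩

/-- The algebra of regular real functions. -/
def realRegularSubalgebra (c : Regularity) (p : ι → ℂ) : Subalgebra ℝ ((ι → ℂ) → ℝ) where
  carrier := {f | IsRealRegularAt c f p}
  mul_mem' hf hg := isRealRegularAt_iff.2 ⟨hf.1.mul hg.1, fun hc =>
    (nashSubalgebra _ p).mul_mem ((isRealRegularAt_iff.1 hf).2 hc)
      ((isRealRegularAt_iff.1 hg).2 hc)⟩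
  add_mem' hf hg := isRealRegularAt_iff.2 ⟨hf.1.add hg.1, fun hc =>
    (nashSubalgebra _ p).add_mem ((isRealRegularAt_iff.1 hf).2 hc)
      ((isRealRegularAt_iff.1 hg).2 hc)⟩
  algebraMap_mem' a := isRealRegularAt_iff.2 ⟨analyticAt_const, fun _ =>
    isNashAt_const _ a p⟩

theorem IsComplexRegularAt.congr {f g : (ι → ℂ) → ℂ} {p : ι → ℂ} (hf : IsComplexRegularAt c f p)
    (h : f =ᶠ[𝓝 p] g) : IsComplexRegularAt c g p :=
  ⟨hf.1.congr h, fun hc => (hf.2 hc).congr h⟩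

theorem IsComplexRegularAt.eventually {f : (ι → ℂ) → ℂ} {p : ι → ℂ}
    (hf : IsComplexRegularAt c f p) : ∀ᶠ q in 𝓝 p, IsComplexRegularAt c f q := by
  by_cases hc : c = Regularity.algebraic
  · filter_upwards [((isComplexRegularAt_iff.1 hf).2 hc).eventually] with q hq
    exact ⟨hq.1, fun _ => hq.2⟩
  · filter_upwards [hf.1.eventually_analyticAt] with q hq
    exact ⟨hq, fun h => absurd h hc⟩

theorem isComplexRegularAt_const (a : ℂ) (p : ι → ℂ) : IsComplexRegularAt c (fun _ => a) p :=
  (complexRegularSubalgebra c p).algebraMap_mem a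

theorem isComplexRegularAt_clm (L : (ι → ℂ) →L[ℂ] ℂ) (p : ι → ℂ) :
    IsComplexRegularAt c L p := by
  classical
  exact isComplexRegularAt_iff.2 ⟨L.analyticAt p, fun _ => isNashAt_clm _ L p⟩

theorem isComplexRegularAt_coord (i : ι) (p : ι → ℂ) : IsComplexRegularAt c (fun x => x i) p :=
  isComplexRegularAt_clm (ContinuousLinearMap.proj (R := ℂ) (φ := fun _ : ι => ℂ) i) p

theorem IsComplexRegularAt.comp {f : (κ → ℂ) → ℂ} {g : (ι → ℂ) → (κ → ℂ)} {p : ι → ℂ}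
    (hf : IsComplexRegularAt c f (g p)) (hg : ∀ j, IsComplexRegularAt c (fun x => g x j) p) :
    IsComplexRegularAt c (fun x => f (g x)) p := by
  refine isComplexRegularAt_iff.2 ⟨?_, fun hc => ?_⟩
  · exact AnalyticAt.comp (g := f) hf.1 ((analyticAt_pi_iff).2 fun j => (hg j).1)
  · exact IsNashAt.comp (e' := ContinuousLinearEquiv.refl ℂ (κ → ℂ))
      (fun j => (isComplexRegularAt_iff.1 (hg j)).2 hc) ((isComplexRegularAt_iff.1 hf).2 hc)

theorem IsComplexRegularAt.fderiv_apply {f : (ι → ℂ) → ℂ} {p : ι → ℂ}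
    (hf : IsComplexRegularAt c f p) (v : ι → ℂ) :
    IsComplexRegularAt c (fun x => fderiv ℂ f x v) p := by
  refine isComplexRegularAt_iff.2 ⟨analyticAt_fderiv_apply hf.1 v, fun hc => ?_⟩
  exact ((isComplexRegularAt_iff.1 hf).2 hc).fderiv_apply v

theorem IsComplexRegularAt.coordDeriv [DecidableEq ι] {f : (ι → ℂ) → ℂ} {p : ι → ℂ}
    (hf : IsComplexRegularAt c f p) (w : List ι) :
    IsComplexRegularAt c (coordDeriv w f) p := by
  induction w with
  | nil => exact hf
  | cons i w ih => exact ih.fderiv_apply (Pi.single i 1)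

theorem IsComplexRegularAt.jetCoeff {m d : ℕ} {Θ : Fin d → ComplexifiedSpace m d → ℂ}
    {p : ComplexifiedSpace m d} (hΘ : ∀ j, IsComplexRegularAt c (Θ j) p) {k : ℕ} (j : Fin d)
    (β : MultiIndex m k) : IsComplexRegularAt c (jetCoeff Θ j β) p := by
  refine (complexRegularSubalgebra c p).mul_mem (isComplexRegularAt_const _ p) ?_
  rw [zetaDeriv_eq_coordDeriv]
  exact (hΘ j).coordDeriv _

theorem IsComplexRegularAt.det {σ : Type*} [Fintype σ] [DecidableEq σ]
    {A : (ι → ℂ) → Matrix σ σ ℂ} {p : ι → ℂ}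
    (hA : ∀ i j, IsComplexRegularAt c (fun x => A x i j) p) :
    IsComplexRegularAt c (fun x => (A x).det) p := by
  have h : (fun x => (A x).det) = ∑ s : Equiv.Perm σ,
      ((Equiv.Perm.sign s : ℤ) : ℂ) • ∏ i, fun x => A x (s i) i := by
    ext x
    simp [Matrix.det_apply', Finset.sum_apply, Finset.prod_apply]
  rw [h]
  exact (complexRegularSubalgebra c p).sum_mem fun s _ =>
    (complexRegularSubalgebra c p).smul_mem
      ((complexRegularSubalgebra c p).prod_mem fun i _ => hA _ _) _

theorem IsComplexRegularAt.inverse (hcard : Fintype.card ι ≤ Fintype.card κ)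
    {g : (ι → ℂ) → (κ → ℂ)} {f : (κ → ℂ) → (ι → ℂ)} {q : κ → ℂ} (hf : AnalyticAt ℂ f q)
    (hg : ∀ j, IsComplexRegularAt c (fun x => g x j) (f q)) (hgq : g (f q) = q)
    (hgf : ∀ᶠ y in 𝓝 q, g (f y) = y) (hfg : ∀ᶠ x in 𝓝 (f q), f (g x) = x) (i : ι) :
    IsComplexRegularAt c (fun y => f y i) q := by
  have hga : AnalyticAt ℂ g (f q) := (analyticAt_pi_iff).2 fun j => (hg j).1
  refine isComplexRegularAt_iff.2 ⟨analyticAt_pi_iff.1 hf i, fun hc => ?_⟩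
  exact IsNashAt.inverse (e := ContinuousLinearEquiv.refl ℂ (ι → ℂ))
    (e' := ContinuousLinearEquiv.refl ℂ (κ → ℂ)) hcard hf
    (fun j => (isComplexRegularAt_iff.1 (hg j)).2 hc) hgq hga.continuousAt hgf hfg i

/-- The real and imaginary parts of `f` are regular. -/
def IsMixedRegularAt (c : Regularity) (f : (ι → ℂ) → ℂ) (p : ι → ℂ) : Prop :=
  IsRealRegularAt c (fun x => (f x).re) p ∧ IsRealRegularAt c (fun x => (f x).im) p

theorem IsComplexRegularAt.isMixedRegularAt {f : (ι → ℂ) → ℂ} {p : ι → ℂ}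
    (hf : IsComplexRegularAt c f p) : IsMixedRegularAt c f p := by
  have h1 : AnalyticAt ℝ f p := hf.1.restrictScalars
  refine ⟨isRealRegularAt_iff.2 ⟨(Complex.reCLM.analyticAt _).comp h1, fun hc => ?_⟩,
    isRealRegularAt_iff.2 ⟨(Complex.imCLM.analyticAt _).comp h1, fun hc => ?_⟩⟩
  · exact (isNashAt_re_im hf.1 (hf.2 hc)).1
  · exact (isNashAt_re_im hf.1 (hf.2 hc)).2

theorem IsMixedRegularAt.conj {f : (ι → ℂ) → ℂ} {p : ι → ℂ} (hf : IsMixedRegularAt c f p) :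
    IsMixedRegularAt c (fun x => (starRingEnd ℂ) (f x)) p := by
  refine ⟨by simpa using hf.1, ?_⟩
  have h : IsRealRegularAt c (fun x => -(f x).im) p := (realRegularSubalgebra c p).neg_mem hf.2
  simpa using h

theorem IsMixedRegularAt.analyticAt {f : (ι → ℂ) → ℂ} {p : ι → ℂ} (hf : IsMixedRegularAt c f p) :
    AnalyticAt ℝ f p := by
  have h1 := ((Complex.ofRealCLM.analyticAt _).comp hf.1.1).add
    (((Complex.ofRealCLM.analyticAt _).comp hf.2.1).mul (analyticAt_const (v := Complex.I)))
  refine h1.congr (Eventually.of_forall fun x => ?_)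
  exact Complex.re_add_im (f x)

theorem IsRealRegularAt.comp {f : (κ → ℂ) → ℝ} {g : (ι → ℂ) → (κ → ℂ)} {p : ι → ℂ}
    (hf : IsRealRegularAt c f (g p)) (hg : ∀ j, IsMixedRegularAt c (fun x => g x j) p) :
    IsRealRegularAt c (fun x => f (g x)) p := by
  refine isRealRegularAt_iff.2 ⟨?_, fun hc => ?_⟩
  · exact AnalyticAt.comp (g := f) hf.1 ((analyticAt_pi_iff).2 fun j => (hg j).analyticAt)
  · refine IsNashAt.comp (e' := realCoordsEquiv κ) (g := g) ?_ ((isRealRegularAt_iff.1 hf).2 hc)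
    rintro (j | j)
    · exact (isRealRegularAt_iff.1 (hg j).1).2 hc
    · exact (isRealRegularAt_iff.1 (hg j).2).2 hc

theorem IsComplexRegularAt.comp_mixed {f : (κ → ℂ) → ℂ} {g : (ι → ℂ) → (κ → ℂ)} {p : ι → ℂ}
    (hf : IsComplexRegularAt c f (g p)) (hg : ∀ j, IsMixedRegularAt c (fun x => g x j) p) :
    IsMixedRegularAt c (fun x => f (g x)) p :=
  ⟨hf.isMixedRegularAt.1.comp hg, hf.isMixedRegularAt.2.comp hg⟩

/-- Real regular functions extend to regular functions of `(t, conj t)`. -/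
theorem IsRealRegularAt.exists_polarization {f : (ι → ℂ) → ℝ} {p : ι → ℂ}
    (hf : IsRealRegularAt c f p) : ∃ F : (ι ⊕ ι → ℂ) → ℂ,
      IsComplexRegularAt c F (Sum.elim p fun i => (starRingEnd ℂ) (p i)) ∧
      ∀ᶠ x in 𝓝 p, F (Sum.elim x fun i => (starRingEnd ℂ) (x i)) = f x := by
  classical
  let f' : (ι ⊕ ι → ℝ) → ℝ := fun y => f ((realCoordsEquiv ι).symm y)
  have hf' : AnalyticAt ℝ f' (realCoords p) := by
    refine AnalyticAt.comp (g := f) ?_ (((realCoordsEquiv ι).symm : (ι ⊕ ι → ℝ) →L[ℝ] (ι → ℂ)).analyticAt _)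
    have : (realCoordsEquiv ι).symm (realCoords p) = p := (realCoordsEquiv ι).symm_apply_apply p
    simpa [this] using hf.1
  obtain ⟨F, hF, hFf⟩ := exists_complexification hf'
  -- Complex-linear recovery of (Re x, Im x) from the pair (x, conj x).
  let L : (ι ⊕ ι → ℂ) →L[ℂ] (ι ⊕ ι → ℂ) := LinearMap.toContinuousLinearMap
    { toFun := fun y => Sum.elim (fun i => (y (Sum.inl i) + y (Sum.inr i)) / 2)
        (fun i => (y (Sum.inl i) - y (Sum.inr i)) / (2 * Complex.I))
      map_add' := fun x y => by ext (i | i) <;> simp <;> ring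
      map_smul' := fun a x => by ext (i | i) <;> simp <;> ring }
  have hL : ∀ x : ι → ℂ, L (Sum.elim x fun i => (starRingEnd ℂ) (x i)) =
      fun i => (realCoords x i : ℂ) := by
    intro x
    ext (i | i)
    · change (x i + (starRingEnd ℂ) (x i)) / 2 = ((x i).re : ℂ)
      rw [Complex.add_conj]; push_cast; ring
    · change (x i - (starRingEnd ℂ) (x i)) / (2 * Complex.I) = ((x i).im : ℂ)
      rw [Complex.sub_conj]
      field_simp [Complex.I_ne_zero]
      push_cast
      ring
  refine ⟨fun y => F (L y), ?_, ?_⟩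
  · refine IsComplexRegularAt.comp (g := L) ?_ fun j =>
      isComplexRegularAt_clm ((ContinuousLinearMap.proj (R := ℂ) (φ := fun _ => ℂ) j).comp L) _
    rw [hL]
    refine isComplexRegularAt_iff.2 ⟨hF, fun hc => ?_⟩
    refine IsNashAt.of_complexification (f := f') ?_ hF hFf
    obtain ⟨P, hP, hev⟩ := hf.2 hc
    refine ⟨P, hP, ?_⟩
    have ht : Tendsto (realCoordsEquiv ι).symm (𝓝 (realCoords p)) (𝓝 p) := by
      have := (realCoordsEquiv ι).symm.continuous.tendsto (realCoords p)
      rwa [show (realCoordsEquiv ι).symm (realCoords p) = p from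
        (realCoordsEquiv ι).symm_apply_apply p] at this
    filter_upwards [ht.eventually hev] with y hy
    rwa [show realCoords ((realCoordsEquiv ι).symm y) = y from
      (realCoordsEquiv ι).apply_symm_apply y] at hy
  · have ht : Tendsto realCoords (𝓝 p) (𝓝 (realCoords p)) :=
      (realCoordsEquiv ι).continuous.tendsto p
    filter_upwards [ht.eventually hFf] with x hx
    rw [hL, hx]
    exact congrArg (fun y => (f y : ℂ)) ((realCoordsEquiv ι).symm_apply_apply x)

end Regularity

/-! ### The inverse function theorem in both categories. -/

section LocalInverse

variable {ι κ : Type*} [Fintype ι] [Fintype κ] {c : Regularity}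

theorem exists_regular_localInverse {f : (ι → ℂ) → (κ → ℂ)} {p : ι → ℂ}
    (hf : ∀ i, IsComplexRegularAt c (fun x => f x i) p)
    (hbij : Function.Bijective (fderiv ℂ f p)) :
    ∃ g : (κ → ℂ) → (ι → ℂ), g (f p) = p ∧
      (∀ i, IsComplexRegularAt c (fun y => g y i) (f p)) ∧
      (∀ᶠ y in 𝓝 (f p), f (g y) = y) ∧ ∀ᶠ x in 𝓝 p, g (f x) = x := by
  have hfa : AnalyticAt ℂ f p := analyticAt_pi_iff.2 fun i => (hf i).1
  let i := ContinuousLinearEquiv.ofBijective (fderiv ℂ f p)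
    (LinearMap.ker_eq_bot.2 hbij.1) (LinearMap.range_eq_top.2 hbij.2)
  have hi : (i : (ι → ℂ) →L[ℂ] (κ → ℂ)) = fderiv ℂ f p :=
    ContinuousLinearEquiv.coe_ofBijective _ _ _
  have hfd : HasStrictFDerivAt f (i : (ι → ℂ) →L[ℂ] (κ → ℂ)) p := by
    rw [hi]; exact hfa.hasStrictFDerivAt
  let R := hfd.toOpenPartialHomeomorph f
  have hp : p ∈ R.source := hfd.mem_toOpenPartialHomeomorph_source
  have hga : AnalyticAt ℂ (hfd.localInverse f i p) (f p) := by
    refine R.analyticAt_symm' (i := i) hp hfa ?_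
    exact hi.symm
  have hgp : hfd.localInverse f i p (f p) = p := hfd.localInverse_apply_image
  have hcard : Fintype.card ι ≤ Fintype.card κ := by
    have := LinearMap.finrank_le_finrank_of_injective
      (f := (fderiv ℂ f p : (ι → ℂ) →ₗ[ℂ] (κ → ℂ))) hbij.1
    simpa using this
  refine ⟨hfd.localInverse f i p, hgp, fun j => ?_, hfd.eventually_right_inverse,
    hfd.eventually_left_inverse⟩
  refine IsComplexRegularAt.inverse hcard hga (fun j => by rw [hgp]; exact hf j)
    (by rw [hgp]) hfd.eventually_right_inverse ?_ j
  rw [hgp]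
  exact hfd.eventually_left_inverse

theorem isComplexRegularAt_analytic_iff {f : (ι → ℂ) → ℂ} {p : ι → ℂ} :
    IsComplexRegularAt Regularity.analytic f p ↔ AnalyticAt ℂ f p :=
  ⟨fun h => h.1, fun h => ⟨h, fun hc => by cases hc⟩⟩

theorem exists_analytic_localInverse {f : (ι → ℂ) → (κ → ℂ)} {p : ι → ℂ}
    (hf : AnalyticAt ℂ f p) (hbij : Function.Bijective (fderiv ℂ f p)) :
    ∃ g : (κ → ℂ) → (ι → ℂ), g (f p) = p ∧ AnalyticAt ℂ g (f p) ∧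
      (∀ᶠ y in 𝓝 (f p), f (g y) = y) ∧ ∀ᶠ x in 𝓝 p, g (f x) = x := by
  obtain ⟨g, h1, h2, h3, h4⟩ := exists_regular_localInverse (c := Regularity.analytic)
    (fun i => isComplexRegularAt_analytic_iff.2 (analyticAt_pi_iff.1 hf i)) hbij
  exact ⟨g, h1, analyticAt_pi_iff.2 fun i => (h2 i).1, h3, h4⟩

theorem eventually_bijective_fderiv {f : (ι → ℂ) → (κ → ℂ)} {p : ι → ℂ}
    (hf : AnalyticAt ℂ f p) (hbij : Function.Bijective (fderiv ℂ f p)) :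
    ∀ᶠ x in 𝓝 p, Function.Bijective (fderiv ℂ f x) := by
  let i := ContinuousLinearEquiv.ofBijective (fderiv ℂ f p)
    (LinearMap.ker_eq_bot.2 hbij.1) (LinearMap.range_eq_top.2 hbij.2)
  have hi : (i : (ι → ℂ) →L[ℂ] (κ → ℂ)) = fderiv ℂ f p :=
    ContinuousLinearEquiv.coe_ofBijective _ _ _
  have h1 := hf.fderiv.continuousAt.eventually
    ((ContinuousLinearEquiv.isOpen (𝕜 := ℂ) (E := ι → ℂ) (F := κ → ℂ)).mem_nhds ⟨i, hi⟩)
  filter_upwards [h1] with x hx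
  obtain ⟨e, he⟩ := hx
  rw [← he]
  exact e.bijective

end LocalInverse

/-! ### Complex defining equations and uniqueness on M. -/

section Representations

variable {m d : ℕ} {ι : Type*} [Fintype ι] {c : Regularity} {M : Set (ι → ℂ)}

/-- The embedding `t ↦ (conj z, t)` of the real points in the complexification. -/
def realPoint : CoordSpace m d →L[ℝ] ComplexifiedSpace m d :=
  LinearMap.toContinuousLinearMap
    { toFun := fun t => Sum.elim (fun i => (starRingEnd ℂ) (t (Sum.inl i))) t
      map_add' := fun u v => by ext (_ | _) <;> simp
      map_smul' := fun a v => by ext (_ | _) <;> simp }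

theorem realPoint_apply (t : CoordSpace m d) :
    realPoint t = Sum.elim (fun i => (starRingEnd ℂ) (t (Sum.inl i))) t := rfl

/-- The complex defining equations of `M` near `q`, for coordinates which need not vanish
at `q`. -/
structure IsLocallyRepresentedBy (M : Set (ι → ℂ)) (q : ι → ℂ) (h : (ι → ℂ) → CoordSpace m d)
    (Θ : Fin d → ComplexifiedSpace m d → ℂ) : Prop where
  analyticAt : AnalyticAt ℂ h q
  bijective : Function.Bijective (fderiv ℂ h q)
  regular : ∀ j, AnalyticAt ℂ (Θ j) (realPoint (h q))
  equations : ∀ᶠ x in 𝓝 q, x ∈ M ↔ ∀ j : Fin d,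
    (starRingEnd ℂ) (h x (Sum.inr j)) = Θ j (realPoint (h x))

variable {q : ι → ℂ} {h : (ι → ℂ) → CoordSpace m d} {Θ : Fin d → ComplexifiedSpace m d → ℂ}

/-- Without a normalization at the base point, one pair (h, Θ) serves at all nearby points; this is
what lets ranks be compared while the point moves. -/
theorem IsLocallyRepresentedBy.eventually (H : IsLocallyRepresentedBy M q h Θ) :
    ∀ᶠ x in 𝓝 q, IsLocallyRepresentedBy M x h Θ := by
  have h1 : ContinuousAt (fun x => realPoint (h x)) q :=
    realPoint.continuous.continuousAt.comp H.analyticAt.continuousAt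
  have h2 : ∀ᶠ x in 𝓝 q, ∀ j, AnalyticAt ℂ (Θ j) (realPoint (h x)) :=
    eventually_all.2 fun j => h1.eventually (H.regular j).eventually_analyticAt
  filter_upwards [H.analyticAt.eventually_analyticAt,
    eventually_bijective_fderiv H.analyticAt H.bijective, h2, H.equations.eventually_nhds]
    with x a1 a2 a3 a4
  exact ⟨a1, a2, a3, a4⟩

theorem IsRepresentedBy.isLocallyRepresentedBy {p : ι → ℂ} (H : IsRepresentedBy c M p h Θ) :
    IsLocallyRepresentedBy M p h Θ where
  analyticAt := analyticAt_pi_iff.2 fun i => (H.coord.1 i).1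
  bijective := H.coord.2
  regular j := by rw [H.center, map_zero]; exact (H.regular j).1
  equations := H.equations

theorem IsLocallyRepresentedBy.card_eq (H : IsLocallyRepresentedBy M q h Θ) :
    Fintype.card ι = m + d := by
  have := (LinearEquiv.ofBijective (fderiv ℂ h q : (ι → ℂ) →ₗ[ℂ] CoordSpace m d)
    H.bijective).finrank_eq
  simpa using this

/-- Differentials of functions vanishing on a generic submanifold vanish on a large subspace. -/
theorem IsGenericSubmanifold.exists_tangentSpace (hM : IsGenericSubmanifold c d M) (hq : q ∈ M) :
    ∃ T : Submodule ℝ (ι → ℂ), T ⊔ T.map (complexStructure ι) = ⊤ ∧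
      2 * Fintype.card ι ≤ Module.finrank ℝ T + d ∧
      ∀ (G : (ι → ℂ) → ℂ) (G' : (ι → ℂ) →L[ℝ] ℂ), HasStrictFDerivAt G G' q →
        (∀ᶠ x in 𝓝 q, x ∈ M → G x = 0) → ∀ v ∈ T, G' v = 0 := by
  obtain ⟨r, hr, hMr, hli, T, hT, hTJ⟩ := hM q hq
  refine ⟨T, hTJ, ?_, fun G G' hG hGM v hv => ?_⟩
  · let L : (ι → ℂ) →ₗ[ℝ] (Fin d → ℝ) := LinearMap.pi fun j =>
      (fderiv ℝ (r j) q : (ι → ℂ) →ₗ[ℝ] ℝ)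
    have h1 : T = LinearMap.ker L := by
      ext v
      rw [hT, LinearMap.mem_ker]
      exact ⟨fun h => funext h, fun h j => congrFun h j⟩
    have h2 := LinearMap.finrank_range_add_finrank_ker L
    have h3 : Module.finrank ℝ (LinearMap.range L) ≤ d := by
      simpa using Submodule.finrank_le (LinearMap.range L)
    have h4 : Module.finrank ℝ (ι → ℂ) = 2 * Fintype.card ι := by
      rw [Module.finrank_pi_fintype]; simp [Complex.finrank_real_complex, mul_comm]
    rw [h1]
    omega
  · have hrq : ∀ j, r j q = 0 := (hMr.self_of_nhds).1 hq
    have key : ∀ (φ : (ι → ℂ) → ℝ) (φ' : (ι → ℂ) →L[ℝ] ℝ), HasStrictFDerivAt φ φ' q →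
        (∀ᶠ x in 𝓝 q, x ∈ M → φ x = 0) → φ' v = 0 := by
      intro φ φ' hφ hφM
      have hφq : φ q = 0 := hφM.self_of_nhds hq
      -- A function vanishing on M has a constrained extremum at `q`. In the Lagrange relation the
      -- multiplier of φ' is nonzero, since the differentials of the r_j are independent.
      have hextr : IsLocalExtrOn φ {x | ∀ i, r i x = r i q} q := by
        left
        have : ∀ᶠ x in 𝓝[{x | ∀ i, r i x = r i q}] q, φ q ≤ φ x := by
          filter_upwards [hφM.filter_mono nhdsWithin_le_nhds, hMr.filter_mono nhdsWithin_le_nhds,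
            self_mem_nhdsWithin] with x h1 h2 h3
          rw [hφq, h1 (h2.2 fun j => by rw [h3 j, hrq j])]
        exact this
      obtain ⟨Λ, Λ₀, hΛ, hsum⟩ := hextr.exists_multipliers_of_hasStrictFDerivAt
        (fun j => (hr j).1.hasStrictFDerivAt) hφ
      have hΛ₀ : Λ₀ ≠ 0 := by
        rintro rfl
        rw [zero_smul, add_zero] at hsum
        have := Fintype.linearIndependent_iff.1 hli Λ hsum
        exact hΛ (by rw [show Λ = 0 from funext this]; rfl)
      have h1 := congrArg (fun L : (ι → ℂ) →L[ℝ] ℝ => L v) hsum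
      have h2 : ∑ i, Λ i * fderiv ℝ (r i) q v = 0 :=
        Finset.sum_eq_zero fun i _ => by rw [(hT v).1 hv i, mul_zero]
      simp only [_root_.add_apply, _root_.sum_apply,
        _root_.smul_apply, smul_eq_mul, _root_.zero_apply, h2,
        zero_add] at h1
      exact (mul_eq_zero.1 h1).resolve_left hΛ₀
    apply Complex.ext
    · exact key (fun x => (G x).re) (Complex.reCLM.comp G')
        (Complex.reCLM.hasStrictFDerivAt.comp q hG)
        (hGM.mono fun x hx hxM => by rw [hx hxM]; rfl)
    · exact key (fun x => (G x).im) (Complex.imCLM.comp G')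
        (Complex.imCLM.hasStrictFDerivAt.comp q hG)
        (hGM.mono fun x hx hxM => by rw [hx hxM]; rfl)

theorem IsLocallyRepresentedBy.hasStrictFDerivAt (H : IsLocallyRepresentedBy M q h Θ)
    {G : ComplexifiedSpace m d → ℂ} (hG : AnalyticAt ℂ G (realPoint (h q))) :
    HasStrictFDerivAt (fun x => G (realPoint (h x)))
      ((fderiv ℂ G (realPoint (h q))).restrictScalars ℝ ∘L realPoint ∘L
        (fderiv ℂ h q).restrictScalars ℝ) q := by
  have h1 : HasStrictFDerivAt h ((fderiv ℂ h q).restrictScalars ℝ) q :=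
    H.analyticAt.hasStrictFDerivAt.restrictScalars ℝ
  have h2 : HasStrictFDerivAt G ((fderiv ℂ G (realPoint (h q))).restrictScalars ℝ)
      (realPoint (h q)) := hG.hasStrictFDerivAt.restrictScalars ℝ
  exact h2.comp q (realPoint.hasStrictFDerivAt.comp q h1)

/-- `realPoint` is the sum of an antilinear ζ-part and the linear map `tangentInr`; multiplication
by i separates the two. -/
theorem realPoint_smul_I (u : CoordSpace m d) (L : ComplexifiedSpace m d →L[ℂ] ℂ) :
    L (realPoint (Complex.I • u)) =
      Complex.I * (2 * L (tangentInr u) - L (realPoint u)) := by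
  have h1 : realPoint (Complex.I • u) =
      Complex.I • ((2 : ℂ) • tangentInr u - realPoint u) := by
    ext (i | i) <;> simp [realPoint_apply]
    ring
  rw [h1, map_smul, map_sub, map_smul]
  rfl

/-- On the complex tangent space the antilinear and linear parts of the differential vanish
separately. The antilinear part there covers all ζ-directions, and the remaining t-part is complex
linear and zero on T, hence zero by T + JT = ℂ^n. -/
theorem IsLocallyRepresentedBy.fderiv_eq_zero (H : IsLocallyRepresentedBy M q h Θ)
    (hM : IsGenericSubmanifold c d M) (hq : q ∈ M) {G : ComplexifiedSpace m d → ℂ}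
    (hG : AnalyticAt ℂ G (realPoint (h q)))
    (hGM : ∀ᶠ x in 𝓝 q, x ∈ M → G (realPoint (h x)) = 0) :
    fderiv ℂ G (realPoint (h q)) = 0 := by
  obtain ⟨T, hTJ, hTd, hT⟩ := hM.exists_tangentSpace hq
  set y := realPoint (h q)
  set A := fderiv ℂ h q
  set L := fderiv ℂ G y
  have hL : ∀ v ∈ T, L (realPoint (A v)) = 0 := fun v hv =>
    hT _ _ (H.hasStrictFDerivAt hG) hGM v hv
  have hΘ : ∀ j, ∀ v ∈ T, (starRingEnd ℂ) (A v (Sum.inr j)) = fderiv ℂ (Θ j) y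
      (realPoint (A v)) := by
    intro j v hv
    let P : CoordSpace m d →L[ℝ] ℂ := (Complex.conjCLE : ℂ →L[ℝ] ℂ) ∘L
      ContinuousLinearMap.proj (R := ℝ) (φ := fun _ => ℂ) (Sum.inr j)
    have h1 : HasStrictFDerivAt h (A.restrictScalars ℝ) q :=
      H.analyticAt.hasStrictFDerivAt.restrictScalars ℝ
    have h2 := (P.hasStrictFDerivAt.comp q h1).sub (H.hasStrictFDerivAt (H.regular j))
    have h3 := hT _ _ h2 (H.equations.mono fun x hx hxM => sub_eq_zero.2 (hx.1 hxM j)) v hv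
    exact sub_eq_zero.1 h3
  let J := complexStructure ι
  have hJ : ∀ v, J v = Complex.I • v := fun v => rfl
  have hJJ : ∀ v, J (J v) = -v := fun v => by
    rw [hJ, hJ, smul_smul, Complex.I_mul_I, neg_one_smul]
  have hAJ : ∀ v, A (J v) = Complex.I • A v := fun v => by rw [hJ, map_smul]
  let S : Submodule ℝ (ι → ℂ) := T ⊓ T.map J
  have hSJ : ∀ v ∈ S, v ∈ T ∧ J v ∈ T := by
    rintro v ⟨h1, u, hu, rfl⟩
    exact ⟨h1, by rw [hJJ]; exact T.neg_mem hu⟩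
  let Z : S →ₗ[ℝ] (Fin m → ℂ) :=
    { toFun := fun v i => A v (Sum.inl i)
      map_add' := fun u v => by ext i; simp
      map_smul' := fun a v => by
        ext i
        have : A (a • (v : ι → ℂ)) = a • A (v : ι → ℂ) := (A.restrictScalars ℝ).map_smul a _
        simp [this] }
  have hZinj : Function.Injective Z := by
    rw [← LinearMap.ker_eq_bot, LinearMap.ker_eq_bot']
    intro v hv
    have hz : ∀ i, A v (Sum.inl i) = 0 := fun i => congrFun hv i
    have hr : realPoint (A v) = tangentInr (A v) := by
      ext (i | i) <;> simp [realPoint_apply, hz]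
    have h0 : A (v : ι → ℂ) = 0 := by
      ext (i | j)
      · exact hz i
      · have h1 := hΘ j v (hSJ v v.2).1
        have h2 := hΘ j _ (hSJ v v.2).2
        rw [hAJ, realPoint_smul_I, hr] at h2
        rw [hr] at h1
        simp only [Pi.smul_apply, smul_eq_mul, map_mul, Complex.conj_I] at h2
        have h3 : (starRingEnd ℂ) (A v (Sum.inr j)) = 0 := by
          have h4 : (2 * Complex.I) * (starRingEnd ℂ) (A v (Sum.inr j)) = 0 := by
            linear_combination -h2 + Complex.I * h1
          exact (mul_eq_zero.1 h4).resolve_left (by simp)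
        simpa using h3
    exact Subtype.ext (H.bijective.1 (by rw [ZeroMemClass.coe_zero, map_zero]; exact h0))
  have hfS : Module.finrank ℝ S = Module.finrank ℝ (Fin m → ℂ) := by
    have h1 := Submodule.finrank_sup_add_finrank_inf_eq T (T.map J)
    have hJinj : Function.Injective J := fun u v huv => by
      have := congrArg J huv
      rw [hJJ, hJJ] at this
      exact neg_injective this
    have h2 : Module.finrank ℝ (T.map J) = Module.finrank ℝ T :=
      (T.equivMapOfInjective J hJinj).finrank_eq.symm
    rw [hTJ, h2, finrank_top] at h1
    have h3 : ∀ (κ : Type _) [Fintype κ], Module.finrank ℝ (κ → ℂ) = 2 * Fintype.card κ := by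
      intro κ _
      rw [Module.finrank_pi_fintype]; simp [Complex.finrank_real_complex, mul_comm]
    rw [h3] at h1
    have h4 := H.card_eq
    have h5 : Module.finrank ℝ (Fin m → ℂ) = 2 * m := by
      rw [Module.finrank_pi_fintype]; simp [Complex.finrank_real_complex, mul_comm]
    have h6 := LinearMap.finrank_le_finrank_of_injective hZinj
    have h7 : Module.finrank ℝ S = Module.finrank ℝ (T ⊓ T.map J : Submodule ℝ (ι → ℂ)) := rfl
    omega
  have hZsurj : Function.Surjective Z :=
    (LinearMap.injective_iff_surjective_of_finrank_eq_finrank hfS).1 hZinj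
  have hS : ∀ v ∈ S, L (tangentInr (A v)) = 0 ∧ L (realPoint (A v)) = 0 := by
    intro v hv
    have h1 := hL v (hSJ v hv).1
    have h2 := hL _ (hSJ v hv).2
    rw [hAJ, realPoint_smul_I, h1, sub_zero] at h2
    refine ⟨?_, h1⟩
    simpa using h2
  have hzeta : ∀ ζ : Fin m → ℂ, L (Sum.elim ζ 0) = 0 := by
    intro ζ
    obtain ⟨v, hv⟩ := hZsurj (conjVec ζ)
    have h1 : (Sum.elim ζ 0 : ComplexifiedSpace m d) = realPoint (A v) - tangentInr (A v) := by
      ext (i | i)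
      · have : A v (Sum.inl i) = starRingEnd ℂ (ζ i) := congrFun hv i
        simp [realPoint_apply, this]
      · simp [realPoint_apply]
    rw [h1, map_sub, (hS v v.2).1, (hS v v.2).2, sub_zero]
  have hdec : ∀ u : CoordSpace m d, realPoint u =
      Sum.elim (conjVec fun i => u (Sum.inl i)) 0 + tangentInr u := by
    intro u
    ext (i | i) <;> simp [realPoint_apply]
  -- With the ζ-directions gone, T suffices: the functional is complex linear, so it also vanishes
  -- on JT.
  have htan : ∀ v, L (tangentInr (A v)) = 0 := by
    have h1 : ∀ v ∈ T, L (tangentInr (A v)) = 0 := fun v hv => by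
      have h2 := hL v hv
      rwa [hdec, map_add, hzeta, zero_add] at h2
    intro v
    have hv : v ∈ T ⊔ T.map J := by rw [hTJ]; trivial
    obtain ⟨a, ha, _, ⟨b, hb, rfl⟩, rfl⟩ := Submodule.mem_sup.1 hv
    rw [map_add, map_add, map_add, h1 a ha, hAJ, map_smul, map_smul, h1 b hb, smul_zero, add_zero]
  ext w
  have hw : w = Sum.elim (fun i => w (Sum.inl i)) 0 + tangentInr fun i => w (Sum.inr i) := by
    ext (i | i) <;> simp
  obtain ⟨v, hv⟩ := H.bijective.2 fun i => w (Sum.inr i)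
  rw [hw, map_add, hzeta, ← hv]
  simpa using htan v

/-- The real points of the complexification form a set of uniqueness. -/
theorem IsLocallyRepresentedBy.eventually_eq_zero (H : IsLocallyRepresentedBy M q h Θ)
    (hM : IsGenericSubmanifold c d M) (hq : q ∈ M) {F : ComplexifiedSpace m d → ℂ}
    (hF : AnalyticAt ℂ F (realPoint (h q)))
    (hFM : ∀ᶠ x in 𝓝 q, x ∈ M → F (realPoint (h x)) = 0) :
    ∀ᶠ y in 𝓝 (realPoint (h q)), F y = 0 := by
  obtain ⟨V, hV, hVo, hqV⟩ := eventually_nhds_iff.1 (H.eventually.and hFM)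
  let S : Set (ComplexifiedSpace m d) := (fun x => realPoint (h x)) '' (M ∩ V)
  refine eventually_eq_zero_of_eq_zero_on (S := S) ⟨q, ⟨hq, hqV⟩, rfl⟩
    (Eventually.of_forall ?_) hF (Eventually.of_forall ?_)
  · rintro _ ⟨x, ⟨hxM, hxV⟩, rfl⟩ G hG hGS
    refine (hV x hxV).1.fderiv_eq_zero hM hxM hG ?_
    have hc : ContinuousAt (fun x => realPoint (h x)) x :=
      realPoint.continuous.continuousAt.comp (hV x hxV).1.analyticAt.continuousAt
    filter_upwards [hc.eventually hGS, hVo.mem_nhds hxV] with x' h1 h2 h3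
    exact h1 ⟨x', ⟨h3, h2⟩, rfl⟩
  · rintro _ ⟨x, ⟨hxM, hxV⟩, rfl⟩
    exact (hV x hxV).2 hxM

end Representations

/-! ### Segre kernels as orders of vanishing along ζ-slices. -/

section Slices

variable {m d : ℕ} {Θ : Fin d → ComplexifiedSpace m d → ℂ}

theorem fderiv_apply_apply {E σ : Type*} [NormedAddCommGroup E] [NormedSpace ℂ E] [Fintype σ]
    {f : E → (σ → ℂ)} {x : E} (hf : DifferentiableAt ℂ f x) (v : E) (i : σ) :
    fderiv ℂ f x v i = fderiv ℂ (fun x => f x i) x v := by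
  have h1 := ((ContinuousLinearMap.proj (R := ℂ) (φ := fun _ : σ => ℂ) i).hasFDerivAt.comp x
    hf.hasFDerivAt).fderiv
  change fderiv ℂ (fun x => f x i) x = _ at h1
  rw [h1]
  rfl

theorem fderiv_comp_apply' {E F G : Type*} [NormedAddCommGroup E] [NormedSpace ℂ E]
    [NormedAddCommGroup F] [NormedSpace ℂ F] [NormedAddCommGroup G] [NormedSpace ℂ G]
    {g : F → G} {f : E → F} {x : E} (hg : DifferentiableAt ℂ g (f x))
    (hf : DifferentiableAt ℂ f x) (v : E) :
    fderiv ℂ (fun x => g (f x)) x v = fderiv ℂ g (f x) (fderiv ℂ f x v) := by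
  have := fderiv_comp x hg hf
  rw [show (fun x => g (f x)) = g ∘ f from rfl, this]
  rfl

/-- The slice with fixed second argument. -/
def sliceInl {σ τ : Type*} [Fintype σ] [Fintype τ] : (σ → ℂ) →L[ℂ] (σ ⊕ τ → ℂ) :=
  LinearMap.toContinuousLinearMap
    { toFun := fun v => Sum.elim v (fun _ => 0)
      map_add' := fun u v => by ext (_ | _) <;> simp
      map_smul' := fun a v => by ext (_ | _) <;> simp }

theorem sliceInl_apply {σ τ : Type*} [Fintype σ] [Fintype τ] (v : σ → ℂ) :
    (sliceInl v : σ ⊕ τ → ℂ) = Sum.elim v (fun _ => 0) := rfl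

theorem hasFDerivAt_sumElim {σ τ : Type*} [Fintype σ] [Fintype τ] (t : τ → ℂ) (ζ : σ → ℂ) :
    HasFDerivAt (fun ζ : σ → ℂ => (Sum.elim ζ t : σ ⊕ τ → ℂ)) (sliceInl (τ := τ)) ζ := by
  have h1 : (fun ζ : σ → ℂ => (Sum.elim ζ t : σ ⊕ τ → ℂ)) =
      fun ζ => sliceInl (τ := τ) ζ + Sum.elim (fun _ => 0) t := by
    ext ζ (i | i) <;> simp [sliceInl_apply]
  rw [h1]
  exact (sliceInl (τ := τ)).hasFDerivAt.add_const _

theorem analyticAt_sumElim {σ τ : Type*} [Fintype σ] [Fintype τ] (t : τ → ℂ) (ζ : σ → ℂ) :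
    AnalyticAt ℂ (fun ζ : σ → ℂ => (Sum.elim ζ t : σ ⊕ τ → ℂ)) ζ := by
  have h1 : (fun ζ : σ → ℂ => (Sum.elim ζ t : σ ⊕ τ → ℂ)) =
      fun ζ => sliceInl (τ := τ) ζ + Sum.elim (fun _ => 0) t := by
    ext ζ (i | i) <;> simp [sliceInl_apply]
  rw [h1]
  exact ((sliceInl (τ := τ)).analyticAt ζ).add analyticAt_const

theorem coordDeriv_slice {σ τ : Type*} [Fintype σ] [Fintype τ] [DecidableEq σ] [DecidableEq τ]
    {F : (σ ⊕ τ → ℂ) → ℂ} {ζ : σ → ℂ} {t : τ → ℂ} (hF : AnalyticAt ℂ F (Sum.elim ζ t))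
    (w : List σ) :
    coordDeriv w (fun ζ => F (Sum.elim ζ t)) =ᶠ[𝓝 ζ]
      fun ζ => coordDeriv (w.map Sum.inl) F (Sum.elim ζ t) := by
  induction w with
  | nil => exact EventuallyEq.rfl
  | cons i w ih =>
    refine (partialDeriv_congr ih i).trans ?_
    have h1 := (analyticAt_sumElim t ζ).continuousAt.eventually
      (analyticAt_coordDeriv hF (w.map Sum.inl)).eventually_analyticAt
    filter_upwards [h1] with ξ hξ
    change fderiv ℂ (fun ζ => coordDeriv (w.map Sum.inl) F (Sum.elim ζ t)) ξ _ = _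
    rw [fderiv_comp_apply' (f := fun ζ : σ → ℂ => (Sum.elim ζ t : σ ⊕ τ → ℂ))
      hξ.differentiableAt (hasFDerivAt_sumElim t ξ).differentiableAt,
      (hasFDerivAt_sumElim t ξ).fderiv]
    have h2 : (sliceInl (Pi.single i 1) : σ ⊕ τ → ℂ) = Pi.single (Sum.inl i) 1 := by
      ext (a | a) <;> simp [sliceInl_apply, Pi.single_apply]
    rw [h2]
    rfl

/-- The derivative along v commutes with ζ-derivatives, so membership is an order of vanishing in ζ
of a single function for each j. This is the form used for changes of coordinates. -/
theorem mem_segreKer_iff_isBigO {ζ : Fin m → ℂ} {t : CoordSpace m d}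
    (hΘ : ∀ j, AnalyticAt ℂ (Θ j) (Sum.elim ζ t)) (k : ℕ) (v : CoordSpace m d) :
    v ∈ segreKer Θ k (Sum.elim ζ t) ↔ ∀ j,
      (fun ξ : Fin m → ℂ => fderiv ℂ (Θ j) (Sum.elim ξ t) (tangentInr v)) =O[𝓝 ζ]
        fun ξ => ‖ξ - ζ‖ ^ (k + 1) := by
  refine forall_congr' fun j => ?_
  have h1 : AnalyticAt ℂ (fun y => fderiv ℂ (Θ j) y (tangentInr v)) (Sum.elim ζ t) :=
    analyticAt_fderiv_apply (hΘ j) _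
  have h2 : AnalyticAt ℂ (fun ξ : Fin m → ℂ => fderiv ℂ (Θ j) (Sum.elim ξ t) (tangentInr v)) ζ :=
    AnalyticAt.comp (f := fun ξ : Fin m → ℂ => (Sum.elim ξ t : ComplexifiedSpace m d)) h1
      (analyticAt_sumElim t ζ)
  rw [← coordDeriv_eq_zero_iff_isBigO h2]
  refine forall_congr' fun w => imp_congr_right fun _ => ?_
  rw [(coordDeriv_slice h1 w).eq_of_nhds,
    (coordDeriv_fderiv_apply (hΘ j) (w.map Sum.inl) (tangentInr v)).eq_of_nhds]

end Slices

/-! ### Transition maps and the reality of the equations. -/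

section Reflection

variable {m d : ℕ} {ι : Type*} [Fintype ι] {c : Regularity} {M : Set (ι → ℂ)}
  {q : ι → ℂ} {h : (ι → ℂ) → CoordSpace m d} {Θ : Fin d → ComplexifiedSpace m d → ℂ}

/-- The point `(ζ, Θ(ζ, t))`, the second factor of the point of the complexification with
coordinates `(ζ, t)`. -/
def conjugatePoint (Θ : Fin d → ComplexifiedSpace m d → ℂ) (y : ComplexifiedSpace m d) :
    CoordSpace m d :=
  Sum.elim (fun i => y (Sum.inl i)) (fun l => Θ l y)

theorem analyticAt_conjugatePoint {y : ComplexifiedSpace m d} (hΘ : ∀ j, AnalyticAt ℂ (Θ j) y) :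
    AnalyticAt ℂ (conjugatePoint Θ) y := by
  rw [analyticAt_pi_iff]
  rintro (i | j)
  · exact (ContinuousLinearMap.proj (R := ℂ) (φ := fun _ => ℂ)
      (Sum.inl i : Fin m ⊕ (Fin m ⊕ Fin d))).analyticAt y
  · exact hΘ j

theorem fderiv_conjugatePoint {y : ComplexifiedSpace m d} (hΘ : ∀ j, AnalyticAt ℂ (Θ j) y)
    (w : ComplexifiedSpace m d) :
    fderiv ℂ (conjugatePoint Θ) y w =
      Sum.elim (fun i => w (Sum.inl i)) (fun l => fderiv ℂ (Θ l) y w) := by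
  ext (i | j)
  · rw [fderiv_apply_apply (analyticAt_conjugatePoint hΘ).differentiableAt]
    have h1 : HasFDerivAt (fun y : ComplexifiedSpace m d => y (Sum.inl i))
      (ContinuousLinearMap.proj (R := ℂ) (φ := fun _ => ℂ)
      (Sum.inl i : Fin m ⊕ (Fin m ⊕ Fin d))) y := (ContinuousLinearMap.proj (R := ℂ)
      (φ := fun _ => ℂ) (Sum.inl i : Fin m ⊕ (Fin m ⊕ Fin d))).hasFDerivAt
    change fderiv ℂ (fun y : ComplexifiedSpace m d => y (Sum.inl i)) y w = _
    rw [h1.fderiv]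
    rfl
  · rw [fderiv_apply_apply (analyticAt_conjugatePoint hΘ).differentiableAt]
    rfl

theorem conjugatePoint_realPoint {t : CoordSpace m d}
    (ht : ∀ j, (starRingEnd ℂ) (t (Sum.inr j)) = Θ j (realPoint t)) :
    conjugatePoint Θ (realPoint t) = conjVec t := by
  ext (i | j)
  · rfl
  · exact (ht j).symm

/-- The coordinate-free part of a complexified point. -/
def holomorphicPart : ComplexifiedSpace m d →L[ℂ] CoordSpace m d :=
  LinearMap.toContinuousLinearMap
    { toFun := fun y i => y (Sum.inr i)
      map_add' := fun _ _ => rfl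
      map_smul' := fun _ _ => rfl }

@[simp] theorem holomorphicPart_tangentInr (v : CoordSpace m d) :
    holomorphicPart (tangentInr v) = v := rfl

/-- The complexification `(ζ, t) ↦ (Ψ_z(ζ, Θ), Φ(t))` of a change of coordinates. -/
def transition (Θ : Fin d → ComplexifiedSpace m d → ℂ) (Φ Ψ : CoordSpace m d → CoordSpace m d)
    (y : ComplexifiedSpace m d) : ComplexifiedSpace m d :=
  Sum.elim (fun i => Ψ (conjugatePoint Θ y) (Sum.inl i)) (Φ (holomorphicPart y))

theorem analyticAt_transition {Φ Ψ : CoordSpace m d → CoordSpace m d}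
    {y : ComplexifiedSpace m d} (hΘ : ∀ j, AnalyticAt ℂ (Θ j) y)
    (hΦ : AnalyticAt ℂ Φ (holomorphicPart y)) (hΨ : AnalyticAt ℂ Ψ (conjugatePoint Θ y)) :
    AnalyticAt ℂ (transition Θ Φ Ψ) y := by
  rw [analyticAt_pi_iff]
  rintro (i | i)
  · exact analyticAt_pi_iff.1 (AnalyticAt.comp (g := Ψ) hΨ (analyticAt_conjugatePoint hΘ)) _
  · exact analyticAt_pi_iff.1 (AnalyticAt.comp (g := Φ) hΦ (holomorphicPart.analyticAt y)) i

theorem fderiv_transition {Φ Ψ : CoordSpace m d → CoordSpace m d}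
    {y : ComplexifiedSpace m d} (hΘ : ∀ j, AnalyticAt ℂ (Θ j) y)
    (hΦ : AnalyticAt ℂ Φ (holomorphicPart y)) (hΨ : AnalyticAt ℂ Ψ (conjugatePoint Θ y))
    (w : ComplexifiedSpace m d) :
    fderiv ℂ (transition Θ Φ Ψ) y w =
      Sum.elim (fun i => fderiv ℂ Ψ (conjugatePoint Θ y)
        (fderiv ℂ (conjugatePoint Θ) y w) (Sum.inl i))
        (fderiv ℂ Φ (holomorphicPart y) (holomorphicPart w)) := by
  have hd := (analyticAt_transition hΘ hΦ hΨ).differentiableAt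
  ext (i | i)
  · rw [fderiv_apply_apply hd, Sum.elim_inl, ← fderiv_comp_apply' hΨ.differentiableAt
      (analyticAt_conjugatePoint hΘ).differentiableAt, fderiv_apply_apply
      (f := fun x => Ψ (conjugatePoint Θ x))
      (AnalyticAt.comp (g := Ψ) hΨ (analyticAt_conjugatePoint hΘ)).differentiableAt]
    rfl
  · have h1 : fderiv ℂ (holomorphicPart (m := m) (d := d)) y w = holomorphicPart w := by
      rw [ContinuousLinearMap.fderiv]
    rw [fderiv_apply_apply hd, Sum.elim_inr, ← h1, ← fderiv_comp_apply' hΦ.differentiableAt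
      holomorphicPart.differentiableAt, fderiv_apply_apply
      (f := fun x => Φ (holomorphicPart x))
      (AnalyticAt.comp (g := Φ) hΦ (holomorphicPart.analyticAt y)).differentiableAt]
    rfl

/-- Two representations are related by the complexification of the change of coordinates. -/
theorem IsLocallyRepresentedBy.exists_transition {h' : (ι → ℂ) → CoordSpace m d}
    {Θ' : Fin d → ComplexifiedSpace m d → ℂ} (H : IsLocallyRepresentedBy M q h Θ)
    (H' : IsLocallyRepresentedBy M q h' Θ') (hM : IsGenericSubmanifold c d M) (hq : q ∈ M) :
    ∃ Φ Ψ : CoordSpace m d → CoordSpace m d,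
      AnalyticAt ℂ Φ (h q) ∧ AnalyticAt ℂ Ψ (conjVec (h q)) ∧
      Function.Injective (fderiv ℂ Φ (h q)) ∧ Function.Injective (fderiv ℂ Ψ (conjVec (h q))) ∧
      transition Θ Φ Ψ (realPoint (h q)) = realPoint (h' q) ∧
      ∀ᶠ y in 𝓝 (realPoint (h q)), ∀ j,
        Ψ (conjugatePoint Θ y) (Sum.inr j) = Θ' j (transition Θ Φ Ψ y) := by
  obtain ⟨g, hgq, hg, -, hgh⟩ := exists_analytic_localInverse H.analyticAt H.bijective
  -- The change of coordinates h' ∘ h⁻¹; Ψ is its conjugate and acts on the conjugate factor of the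
  -- complexification.
  let Φ : CoordSpace m d → CoordSpace m d := fun t => h' (g t)
  let Ψ : CoordSpace m d → CoordSpace m d := fun t => conjVec (Φ (conjVec t))
  have hΦ : AnalyticAt ℂ Φ (h q) :=
    AnalyticAt.comp (g := h') (by rw [hgq]; exact H'.analyticAt) hg
  have hΨ : AnalyticAt ℂ Ψ (conjVec (h q)) :=
    analyticAt_pi_iff.2 fun a => analyticAt_conjFun (f := fun t => Φ t a) (analyticAt_pi_iff.1 hΦ a)
  have hΦh : ∀ᶠ x in 𝓝 q, Φ (h x) = h' x := by
    filter_upwards [hgh] with x hx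
    simp [Φ, hx]
  have hΦi : Function.Injective (fderiv ℂ Φ (h q)) := by
    intro u v huv
    obtain ⟨u, rfl⟩ := H.bijective.2 u
    obtain ⟨v, rfl⟩ := H.bijective.2 v
    rw [← fderiv_comp_apply' hΦ.differentiableAt H.analyticAt.differentiableAt,
      ← fderiv_comp_apply' hΦ.differentiableAt H.analyticAt.differentiableAt,
      EventuallyEq.fderiv_eq (f₁ := fun x => Φ (h x)) hΦh] at huv
    rw [H'.bijective.1 huv]
  have hΨi : Function.Injective (fderiv ℂ Ψ (conjVec (h q))) := by
    have h1 : ∀ u, fderiv ℂ Ψ (conjVec (h q)) u = conjVec (fderiv ℂ Φ (h q) (conjVec u)) := by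
      intro u
      ext a
      rw [fderiv_apply_apply hΨ.differentiableAt]
      have h2 := fderiv_conjFun (f := fun t => Φ t a) (y := conjVec (h q))
        (by rw [conjVec_conjVec]; exact analyticAt_pi_iff.1 hΦ a) u
      rw [conjVec_conjVec] at h2
      rw [conjVec_apply, fderiv_apply_apply hΦ.differentiableAt, ← h2]
      rfl
    intro u v huv
    rw [h1, h1] at huv
    exact conjVec_injective (hΦi (conjVec_injective huv))
  have htr : ∀ x, Φ (h x) = h' x →
      (∀ j, (starRingEnd ℂ) (h x (Sum.inr j)) = Θ j (realPoint (h x))) →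
      transition Θ Φ Ψ (realPoint (h x)) = realPoint (h' x) ∧
      Ψ (conjugatePoint Θ (realPoint (h x))) = conjVec (h' x) := by
    intro x hx hxM
    have h1 : Ψ (conjugatePoint Θ (realPoint (h x))) = conjVec (h' x) := by
      rw [conjugatePoint_realPoint hxM]
      simp only [Ψ, conjVec_conjVec, hx]
    refine ⟨?_, h1⟩
    ext (i | i)
    · change Ψ (conjugatePoint Θ (realPoint (h x))) (Sum.inl i) = _
      rw [h1]
      rfl
    · change Φ (h x) i = _
      rw [hx]
      rfl
  have hq1 := H.equations.self_of_nhds.1 hq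
  have hq2 := htr q hΦh.self_of_nhds hq1
  refine ⟨Φ, Ψ, hΦ, hΨ, hΦi, hΨi, hq2.1, eventually_all.2 fun j => ?_⟩
  have hcp := conjugatePoint_realPoint hq1
  have hΨ' : AnalyticAt ℂ Ψ (conjugatePoint Θ (realPoint (h q))) := by rwa [hcp]
  have h1 : AnalyticAt ℂ (fun y => Ψ (conjugatePoint Θ y) (Sum.inr j) -
      Θ' j (transition Θ Φ Ψ y)) (realPoint (h q)) := by
    refine AnalyticAt.sub ?_ ?_
    · exact analyticAt_pi_iff.1
        (AnalyticAt.comp (g := Ψ) hΨ' (analyticAt_conjugatePoint H.regular)) _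
    · refine AnalyticAt.comp (g := Θ' j) ?_ (analyticAt_transition H.regular hΦ hΨ')
      rw [hq2.1]
      exact H'.regular j
  -- At points of M the identity is the equation w̄' = Θ'; uniqueness extends it off the real
  -- points.
  refine (H.eventually_eq_zero hM hq h1 ?_).mono fun y hy => sub_eq_zero.1 hy
  filter_upwards [hΦh, H.equations, H'.equations] with x h2 h3 h4 hxM
  have h5 := htr x h2 (h3.1 hxM)
  rw [h5.1, h5.2, ← h4.1 hxM j, conjVec_apply, sub_self]

/-- The reality of the defining equations. -/
theorem IsLocallyRepresentedBy.reality (H : IsLocallyRepresentedBy M q h Θ)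
    (hM : IsGenericSubmanifold c d M) (hq : q ∈ M) :
    ∀ᶠ y in 𝓝 (realPoint (h q)), ∀ j, y (Sum.inr (Sum.inr j)) = conjFun (Θ j)
      (Sum.elim (fun i => y (Sum.inr (Sum.inl i))) (conjugatePoint Θ y)) := by
  refine eventually_all.2 fun j => ?_
  have hpt : ∀ t : CoordSpace m d,
      (∀ j, (starRingEnd ℂ) (t (Sum.inr j)) = Θ j (realPoint t)) →
      (Sum.elim (fun i => realPoint t (Sum.inr (Sum.inl i))) (conjugatePoint Θ (realPoint t)) :
        ComplexifiedSpace m d) = conjVec (realPoint t) := by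
    intro t ht
    rw [conjugatePoint_realPoint ht]
    ext (i | i) <;> simp [realPoint_apply]
  have h1 : AnalyticAt ℂ (fun y : ComplexifiedSpace m d => y (Sum.inr (Sum.inr j)) -
      conjFun (Θ j) (Sum.elim (fun i => y (Sum.inr (Sum.inl i))) (conjugatePoint Θ y)))
      (realPoint (h q)) := by
    refine AnalyticAt.sub ((ContinuousLinearMap.proj (R := ℂ) (φ := fun _ => ℂ)
      (Sum.inr (Sum.inr j) : Fin m ⊕ (Fin m ⊕ Fin d))).analyticAt _) ?_
    refine AnalyticAt.comp (g := conjFun (Θ j)) ?_ ?_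
    · rw [hpt _ (H.equations.self_of_nhds.1 hq)]
      exact analyticAt_conjFun (H.regular j)
    · rw [analyticAt_pi_iff]
      rintro (i | i)
      · exact (ContinuousLinearMap.proj (R := ℂ) (φ := fun _ => ℂ)
          (Sum.inr (Sum.inl i) : Fin m ⊕ (Fin m ⊕ Fin d))).analyticAt _
      · exact analyticAt_pi_iff.1 (analyticAt_conjugatePoint H.regular) i
  refine (H.eventually_eq_zero hM hq h1 ?_).mono fun y hy => sub_eq_zero.1 hy
  filter_upwards [H.equations] with x hx hxM
  rw [hpt _ (hx.1 hxM), conjFun_conjVec, ← hx.1 hxM j, Complex.conj_conj, sub_eq_zero]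
  rfl

/-- If dz(v) = 0 and dΘ(v) = 0, differentiating the reality identity w = conjΘ(z, ζ, Θ(ζ, t)) gives
dw(v) = 0, so the kernel injects into ℂ^m. Conversely it is cut out by only d equations. This yields
λ_0 = d. -/
theorem IsLocallyRepresentedBy.finrank_segreKer_zero (H : IsLocallyRepresentedBy M q h Θ)
    (hM : IsGenericSubmanifold c d M) (hq : q ∈ M) :
    Module.finrank ℂ (segreKer Θ 0 (realPoint (h q))) = m := by
  set y := realPoint (h q)
  refine le_antisymm ?_ ?_
  · let Z : segreKer Θ 0 y →ₗ[ℂ] (Fin m → ℂ) :=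
      { toFun := fun v i => (v : CoordSpace m d) (Sum.inl i)
        map_add' := fun _ _ => rfl
        map_smul' := fun _ _ => rfl }
    have hZ : Function.Injective Z := by
      rw [← LinearMap.ker_eq_bot, LinearMap.ker_eq_bot']
      intro v hv
      have hz : ∀ i, (v : CoordSpace m d) (Sum.inl i) = 0 := fun i => congrFun hv i
      have hcp : fderiv ℂ (conjugatePoint Θ) y (tangentInr v) = 0 := by
        rw [fderiv_conjugatePoint H.regular]
        ext (i | j)
        · rfl
        · exact v.2 j [] le_rfl
      let N : ComplexifiedSpace m d → ComplexifiedSpace m d := fun y =>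
        Sum.elim (fun i => y (Sum.inr (Sum.inl i))) (conjugatePoint Θ y)
      have hN : AnalyticAt ℂ N y := by
        rw [analyticAt_pi_iff]
        rintro (i | i)
        · exact (ContinuousLinearMap.proj (R := ℂ) (φ := fun _ => ℂ)
            (Sum.inr (Sum.inl i) : Fin m ⊕ (Fin m ⊕ Fin d))).analyticAt _
        · exact analyticAt_pi_iff.1 (analyticAt_conjugatePoint H.regular) i
      have hproj : ∀ (a : Fin m ⊕ (Fin m ⊕ Fin d)) (w : ComplexifiedSpace m d),
          fderiv ℂ (fun y : ComplexifiedSpace m d => y a) y w = w a := by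
        intro a w
        have h1 : HasFDerivAt (fun y : ComplexifiedSpace m d => y a)
          (ContinuousLinearMap.proj (R := ℂ) (φ := fun _ => ℂ) a) y :=
          (ContinuousLinearMap.proj (R := ℂ) (φ := fun _ => ℂ) a).hasFDerivAt
        rw [h1.fderiv]
        rfl
      have hNv : fderiv ℂ N y (tangentInr v) = 0 := by
        ext (i | i)
        · rw [fderiv_apply_apply hN.differentiableAt]
          exact (hproj (Sum.inr (Sum.inl i)) (tangentInr v)).trans (hz i)
        · rw [fderiv_apply_apply hN.differentiableAt]
          change fderiv ℂ (fun y => conjugatePoint Θ y i) y (tangentInr v) = 0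
          rw [← fderiv_apply_apply (analyticAt_conjugatePoint H.regular).differentiableAt, hcp]
          rfl
      have hq1 := H.equations.self_of_nhds.1 hq
      have hNy : N y = conjVec y := by
        simp only [N, y]
        rw [conjugatePoint_realPoint hq1]
        ext (i | i) <;> simp [realPoint_apply]
      refine Subtype.ext (funext ?_)
      rintro (i | j)
      · exact hz i
      · have h1 : (fun y : ComplexifiedSpace m d => y (Sum.inr (Sum.inr j))) =ᶠ[𝓝 y]
            fun y => conjFun (Θ j) (N y) :=
          (H.reality hM hq).mono fun y hy => hy j
        have h2 : AnalyticAt ℂ (conjFun (Θ j)) (N y) := by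
          rw [hNy]; exact analyticAt_conjFun (H.regular j)
        have h3 := congrArg (fun L : ComplexifiedSpace m d →L[ℂ] ℂ => L (tangentInr (v : CoordSpace m d))) h1.fderiv_eq
        rw [hproj, fderiv_comp_apply' h2.differentiableAt hN.differentiableAt, hNv, map_zero] at h3
        exact h3
    simpa using LinearMap.finrank_le_finrank_of_injective hZ
  · let L : CoordSpace m d →ₗ[ℂ] (Fin d → ℂ) := LinearMap.pi fun j =>
      (fderiv ℂ (Θ j) y ∘L tangentInr : CoordSpace m d →L[ℂ] ℂ).toLinearMap
    have h1 : LinearMap.ker L ≤ segreKer Θ 0 y := by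
      intro v hv j w hw
      rw [List.length_eq_zero_iff.1 (Nat.le_zero.1 hw)]
      exact congrFun hv j
    have h2 := LinearMap.finrank_range_add_finrank_ker L
    have h3 : Module.finrank ℂ (LinearMap.range L) ≤ d := by
      simpa using Submodule.finrank_le (LinearMap.range L)
    have h4 := Submodule.finrank_mono h1
    have h5 : Module.finrank ℂ (CoordSpace m d) = m + d := by simp
    omega

end Reflection

/-! ### Independence of ranks from the representation. -/

section Invariance

variable {m d : ℕ} {ι : Type*} [Fintype ι] {c : Regularity} {M : Set (ι → ℂ)}
  {q : ι → ℂ} {h h' : (ι → ℂ) → CoordSpace m d} {Θ Θ' : Fin d → ComplexifiedSpace m d → ℂ}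

theorem isBigO_clm_apply {α E F : Type*} [NormedAddCommGroup E] [NormedSpace ℂ E]
    [NormedAddCommGroup F] [NormedSpace ℂ F] {l : Filter α} {B : α → E →L[ℂ] F} {δ : α → E}
    {g : α → ℝ} (hB : B =O[l] fun _ => (1 : ℝ)) (hδ : δ =O[l] g) :
    (fun x => B x (δ x)) =O[l] g := by
  have h1 : (fun x => B x (δ x)) =O[l] fun x => ‖B x‖ * ‖δ x‖ :=
    Asymptotics.isBigO_of_le _ fun x => by
      rw [Real.norm_of_nonneg (by positivity)]
      exact (B x).le_opNorm _
  refine h1.trans ?_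
  simpa using hB.norm_left.mul hδ.norm_left

/-- Along v the conjugate point (ζ, Θ(ζ, t)) moves only to order k + 1 in ζ. The differentiated
transition identity passes this estimate to Θ' along dΦ(v), and the substitution in the ζ-variables
preserves it. -/
theorem IsLocallyRepresentedBy.map_mem_segreKer (H' : IsLocallyRepresentedBy M q h' Θ')
    {t₀ : CoordSpace m d} (hΘ : ∀ j, AnalyticAt ℂ (Θ j) (realPoint t₀))
    {Φ Ψ : CoordSpace m d → CoordSpace m d} (hΦ : AnalyticAt ℂ Φ t₀)
    (hΨ : AnalyticAt ℂ Ψ (conjugatePoint Θ (realPoint t₀)))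
    (hΨi : Function.Injective (fderiv ℂ Ψ (conjugatePoint Θ (realPoint t₀))))
    (htr : transition Θ Φ Ψ (realPoint t₀) = realPoint (h' q))
    (hev : ∀ᶠ y in 𝓝 (realPoint t₀), ∀ j,
        Ψ (conjugatePoint Θ y) (Sum.inr j) = Θ' j (transition Θ Φ Ψ y)) {k : ℕ}
    {v : CoordSpace m d} (hv : v ∈ segreKer Θ k (realPoint t₀)) :
    fderiv ℂ Φ t₀ v ∈ segreKer Θ' k (realPoint (h' q)) := by
  set t₁ := h' q
  let ζ₀ : Fin m → ℂ := fun i => (starRingEnd ℂ) (t₀ (Sum.inl i))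
  let ζ₁ : Fin m → ℂ := fun i => (starRingEnd ℂ) (t₁ (Sum.inl i))
  have hy₀ : realPoint t₀ = Sum.elim ζ₀ t₀ := rfl
  have hy₁ : realPoint t₁ = Sum.elim ζ₁ t₁ := rfl
  set N := transition Θ Φ Ψ
  have hN : AnalyticAt ℂ N (realPoint t₀) := analyticAt_transition hΘ hΦ hΨ
  have hΘ' : ∀ j, AnalyticAt ℂ (Θ' j) (N (realPoint t₀)) := fun j => by
    rw [htr]; exact H'.regular j
  have hcp := analyticAt_conjugatePoint hΘ
  have hΦt : Φ t₀ = t₁ := by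
    ext i
    exact congrFun htr (Sum.inr i)
  -- the differentiated transition identity
  have hD : ∀ᶠ y in 𝓝 (realPoint t₀), ∀ (w : ComplexifiedSpace m d) (j : Fin d),
      fderiv ℂ Ψ (conjugatePoint Θ y) (fderiv ℂ (conjugatePoint Θ) y w) (Sum.inr j) =
        fderiv ℂ (Θ' j) (N y) (fderiv ℂ N y w) := by
    have h1 := hcp.continuousAt.eventually hΨ.eventually_analyticAt
    have h2 := hN.continuousAt.eventually
      (eventually_all.2 fun j => (hΘ' j).eventually_analyticAt)
    filter_upwards [hev.eventually_nhds, h1, h2, hcp.eventually_analyticAt,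
      hN.eventually_analyticAt] with y a1 a2 a3 a4 a5 w j
    have h3 : (fun y => Ψ (conjugatePoint Θ y) (Sum.inr j)) =ᶠ[𝓝 y] fun y => Θ' j (N y) :=
      a1.mono fun z hz => hz j
    rw [← fderiv_comp_apply' (a3 j).differentiableAt a5.differentiableAt, ← h3.fderiv_eq,
      ← fderiv_comp_apply' a2.differentiableAt a4.differentiableAt,
      fderiv_apply_apply (f := fun y => Ψ (conjugatePoint Θ y))
        (AnalyticAt.comp (g := Ψ) a2 a4).differentiableAt]
  have hDN : ∀ᶠ y in 𝓝 (realPoint t₀), ∀ w, fderiv ℂ N y w =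
      Sum.elim (fun i => fderiv ℂ Ψ (conjugatePoint Θ y)
        (fderiv ℂ (conjugatePoint Θ) y w) (Sum.inl i))
        (fderiv ℂ Φ (holomorphicPart y) (holomorphicPart w)) := by
    have h1 := hcp.continuousAt.eventually hΨ.eventually_analyticAt
    have h2 := (holomorphicPart.continuous.tendsto (realPoint t₀)).eventually
      (p := fun t => AnalyticAt ℂ Φ t) hΦ.eventually_analyticAt
    filter_upwards [h1, h2, eventually_all.2 fun j => (hΘ j).eventually_analyticAt]
      with y a1 a2 a3 w
    exact fderiv_transition a3 a2 a1 w
  -- the map of the `ζ`-variables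
  let ψ : (Fin m → ℂ) → (Fin m → ℂ) := fun ξ i =>
    Ψ (conjugatePoint Θ (Sum.elim ξ t₀)) (Sum.inl i)
  have hNψ : ∀ ξ, N (Sum.elim ξ t₀) = Sum.elim (ψ ξ) t₁ := fun ξ => by
    rw [← hΦt]; rfl
  have hsl : AnalyticAt ℂ (fun ξ : Fin m → ℂ => (Sum.elim ξ t₀ : ComplexifiedSpace m d)) ζ₀ :=
    analyticAt_sumElim t₀ ζ₀
  have hNsl : AnalyticAt ℂ (fun ξ : Fin m → ℂ => N (Sum.elim ξ t₀)) ζ₀ :=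
    AnalyticAt.comp (g := N) hN hsl
  have hψ : AnalyticAt ℂ ψ ζ₀ := by
    rw [analyticAt_pi_iff]
    exact fun i => analyticAt_pi_iff.1 hNsl (Sum.inl i)
  have hψ₀ : ψ ζ₀ = ζ₁ := by
    ext i
    exact congrFun htr (Sum.inl i)
  have hψ' : ∀ μ i, fderiv ℂ ψ ζ₀ μ i = fderiv ℂ N (realPoint t₀) (sliceInl μ) (Sum.inl i) := by
    intro μ i
    have h1 := fderiv_comp_apply' (g := N)
      (f := fun ξ : Fin m → ℂ => (Sum.elim ξ t₀ : ComplexifiedSpace m d)) (x := ζ₀)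
      hN.differentiableAt hsl.differentiableAt μ
    rw [(hasFDerivAt_sumElim t₀ ζ₀).fderiv] at h1
    rw [fderiv_apply_apply hψ.differentiableAt, hy₀, ← h1, fderiv_apply_apply
      (f := fun ξ : Fin m → ℂ => N (Sum.elim ξ t₀)) hNsl.differentiableAt]
    rfl
  -- If dψ kills μ, then the transition kills (μ, 0). By the differentiated identity so does dΨ
  -- composed with d(ζ, Θ), and injectivity of dΨ gives μ = 0.
  have hψi : Function.Injective (fderiv ℂ ψ ζ₀) := by
    rw [injective_iff_map_eq_zero]
    intro μ hμ
    have h1 : fderiv ℂ N (realPoint t₀) (sliceInl μ) = 0 := by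
      ext (i | i)
      · rw [← hψ', hμ]; rfl
      · rw [hDN.self_of_nhds]
        have : holomorphicPart (sliceInl μ : ComplexifiedSpace m d) = 0 := rfl
        rw [this, map_zero]
        rfl
    have h2 : fderiv ℂ Ψ (conjugatePoint Θ (realPoint t₀))
        (fderiv ℂ (conjugatePoint Θ) (realPoint t₀) (sliceInl μ)) = 0 := by
      ext (i | j)
      · have := congrFun (hDN.self_of_nhds (sliceInl μ)) (Sum.inl i)
        rw [h1] at this
        exact this.symm
      · rw [hD.self_of_nhds, h1, map_zero]; rfl
    have h3 := hΨi (h2.trans (map_zero _).symm)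
    rw [fderiv_conjugatePoint hΘ] at h3
    ext i
    exact congrFun h3 (Sum.inl i)
  have hψb : Function.Bijective (fderiv ℂ ψ ζ₀) :=
    ⟨hψi, (LinearMap.injective_iff_surjective
      (f := (fderiv ℂ ψ ζ₀ : (Fin m → ℂ) →ₗ[ℂ] (Fin m → ℂ)))).1 hψi⟩
  obtain ⟨η, hη₀, hη, hψη, -⟩ := exists_analytic_localInverse hψ hψb
  rw [hψ₀] at hη₀ hη hψη
  -- the estimates
  rw [hy₁, mem_segreKer_iff_isBigO (by rw [← hy₁]; exact H'.regular)]
  rw [hy₀, mem_segreKer_iff_isBigO (by rw [← hy₀]; exact hΘ)] at hv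
  intro j
  have hδ : (fun ξ : Fin m → ℂ => fderiv ℂ (conjugatePoint Θ) (Sum.elim ξ t₀) (tangentInr v))
      =O[𝓝 ζ₀] fun ξ => ‖ξ - ζ₀‖ ^ (k + 1) := by
    have h1 : (fun ξ : Fin m → ℂ => fderiv ℂ (conjugatePoint Θ) (Sum.elim ξ t₀) (tangentInr v))
        =ᶠ[𝓝 ζ₀] fun ξ => (Sum.elim (fun _ => 0) fun l => fderiv ℂ (Θ l) (Sum.elim ξ t₀)
          (tangentInr v) : CoordSpace m d) := by
      filter_upwards [hsl.continuousAt.eventually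
        (eventually_all.2 fun j => (hΘ j).eventually_analyticAt)] with ξ hξ
      rw [fderiv_conjugatePoint hξ]
      rfl
    refine h1.trans_isBigO (Asymptotics.isBigO_pi.2 ?_)
    rintro (i | l)
    · exact Asymptotics.isBigO_zero _ _
    · exact hv l
  have hB1 : (fun ξ : Fin m → ℂ => fderiv ℂ Ψ (conjugatePoint Θ (Sum.elim ξ t₀)))
      =O[𝓝 ζ₀] fun _ => (1 : ℝ) := by
    have h1 : AnalyticAt ℂ (fun ξ : Fin m → ℂ => fderiv ℂ Ψ (conjugatePoint Θ (Sum.elim ξ t₀)))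
      ζ₀ := AnalyticAt.comp (g := fderiv ℂ Ψ) hΨ.fderiv
        (AnalyticAt.comp (g := conjugatePoint Θ) hcp hsl)
    exact h1.continuousAt.tendsto.isBigO_one ℝ
  have hB2 : (fun ξ : Fin m → ℂ => fderiv ℂ (Θ' j) (N (Sum.elim ξ t₀)))
      =O[𝓝 ζ₀] fun _ => (1 : ℝ) := by
    have h1 : AnalyticAt ℂ (fun ξ : Fin m → ℂ => fderiv ℂ (Θ' j) (N (Sum.elim ξ t₀))) ζ₀ :=
      AnalyticAt.comp (g := fderiv ℂ (Θ' j)) (hΘ' j).fderiv hNsl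
    exact h1.continuousAt.tendsto.isBigO_one ℝ
  have he := isBigO_clm_apply hB1 hδ
  let e : (Fin m → ℂ) → CoordSpace m d := fun ξ =>
    fderiv ℂ Ψ (conjugatePoint Θ (Sum.elim ξ t₀))
      (fderiv ℂ (conjugatePoint Θ) (Sum.elim ξ t₀) (tangentInr v))
  have he1 : (fun ξ => (sliceInl fun i => e ξ (Sum.inl i) : ComplexifiedSpace m d)) =O[𝓝 ζ₀]
      fun ξ => ‖ξ - ζ₀‖ ^ (k + 1) := by
    refine Asymptotics.isBigO_pi.2 ?_
    rintro (i | l)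
    · exact Asymptotics.isBigO_pi.1 he (Sum.inl i)
    · exact Asymptotics.isBigO_zero _ _
  have hf : (fun ξ => fderiv ℂ (Θ' j) (Sum.elim (ψ ξ) t₁) (tangentInr (fderiv ℂ Φ t₀ v)))
      =O[𝓝 ζ₀] fun ξ => ‖ξ - ζ₀‖ ^ (k + 1) := by
    -- The transition derivative along v has ζ-part taken from the small vector `e` and t-part
    -- dΦ(v); moving the former to the other side leaves only small terms.
    have h1 : (fun ξ => fderiv ℂ (Θ' j) (Sum.elim (ψ ξ) t₁) (tangentInr (fderiv ℂ Φ t₀ v)))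
        =ᶠ[𝓝 ζ₀] fun ξ => e ξ (Sum.inr j) - fderiv ℂ (Θ' j) (N (Sum.elim ξ t₀))
          (sliceInl fun i => e ξ (Sum.inl i)) := by
      filter_upwards [hsl.continuousAt.eventually (hD.and hDN)] with ξ hξ
      simp only [e]
      rw [hξ.1, ← map_sub, hξ.2, ← hNψ]
      congr 1
      ext (i | i) <;> simp [sliceInl_apply]
      congr 1
    exact h1.trans_isBigO ((Asymptotics.isBigO_pi.1 he (Sum.inr j)).sub
      (isBigO_clm_apply hB2 he1))
  have hηt : Tendsto η (𝓝 ζ₁) (𝓝 ζ₀) := by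
    have := hη.continuousAt.tendsto
    rwa [hη₀] at this
  -- The local inverse of ψ is differentiable, so the estimate can be read in the new ζ-variable.
  have hηO : (fun ξ => ‖η ξ - ζ₀‖ ^ (k + 1)) =O[𝓝 ζ₁] fun ξ => ‖ξ - ζ₁‖ ^ (k + 1) := by
    have h1 := hη.differentiableAt.isBigO_sub
    rw [hη₀] at h1
    exact h1.norm_norm.pow _
  refine EventuallyEq.trans_isBigO ?_ ((hf.comp_tendsto hηt).trans hηO)
  filter_upwards [hψη] with ξ hξ
  simp only [Function.comp_apply, hξ]

/-- dΦ embeds one kernel in the other; exchanging the two representations turns the inequality into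
equality of ranks. -/
theorem IsLocallyRepresentedBy.finrank_segreKer_le (H : IsLocallyRepresentedBy M q h Θ)
    (H' : IsLocallyRepresentedBy M q h' Θ') (hM : IsGenericSubmanifold c d M) (hq : q ∈ M)
    (k : ℕ) : Module.finrank ℂ (segreKer Θ k (realPoint (h q))) ≤
      Module.finrank ℂ (segreKer Θ' k (realPoint (h' q))) := by
  obtain ⟨Φ, Ψ, hΦ, hΨ, hΦi, hΨi, htr, hev⟩ := H.exists_transition H' hM hq
  have hcp := conjugatePoint_realPoint (H.equations.self_of_nhds.1 hq)
  rw [← hcp] at hΨ hΨi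
  let L := (fderiv ℂ Φ (h q) : CoordSpace m d →ₗ[ℂ] CoordSpace m d).restrict
    (p := segreKer Θ k (realPoint (h q))) (q := segreKer Θ' k (realPoint (h' q)))
    fun v hv => H'.map_mem_segreKer H.regular hΦ hΨ hΨi htr hev hv
  refine LinearMap.finrank_le_finrank_of_injective (f := L) fun u v huv => ?_
  exact Subtype.ext (hΦi (congrArg Subtype.val huv))

theorem IsLocallyRepresentedBy.rankAt_eq (H : IsLocallyRepresentedBy M q h Θ)
    (H' : IsLocallyRepresentedBy M q h' Θ') (hM : IsGenericSubmanifold c d M) (hq : q ∈ M)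
    (k : ℕ) : rankAt (segreJet Θ k) (realPoint (h q)) =
      rankAt (segreJet Θ' k) (realPoint (h' q)) := by
  have h1 := rankAt_segreJet_add_finrank H.regular k
  have h2 := rankAt_segreJet_add_finrank H'.regular k
  have h3 := H.finrank_segreKer_le H' hM hq k
  have h4 := H'.finrank_segreKer_le H hM hq k
  omega

end Invariance

/-! ### Propagation of equality of consecutive kernels. -/

section Stabilization

variable {m d : ℕ} {Θ : Fin d → ComplexifiedSpace m d → ℂ} {y₀ : ComplexifiedSpace m d}

/-- Extend v to a section V of the kernel of order k + 1. Differentiating dΘ_w(V) = 0 along ζ_i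
gives dΘ_{iw}(v) + dΘ_w(v') = 0, with v' the t-part of the derivative of V. For |w| ≤ k this puts v'
in the kernel of order k, hence of order k + 1; for |w| = k + 1 it then gives dΘ_{iw}(v) = 0. -/
theorem segreKer_succ_le (hΘ : ∀ j, AnalyticAt ℂ (Θ j) y₀) {k : ℕ}
    (hE : segreKer Θ k y₀ = segreKer Θ (k + 1) y₀)
    (hr : ∀ᶠ y in 𝓝 y₀, Module.finrank ℂ (segreKer Θ (k + 1) y) =
      Module.finrank ℂ (segreKer Θ (k + 1) y₀)) :
    segreKer Θ (k + 1) y₀ ≤ segreKer Θ (k + 2) y₀ := by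
  intro v hv
  have hΘe : ∀ᶠ y in 𝓝 y₀, ∀ j, AnalyticAt ℂ (Θ j) y :=
    eventually_all.2 fun j => (hΘ j).eventually_analyticAt
  obtain ⟨V, hV₀, hVd, hV⟩ := exists_differentiableAt_section_ker
    (A := fun y => fderiv ℂ (segreJet Θ (k + 1)) y) (y₀ := y₀) (v₀ := tangentInr v)
    (analyticAt_segreJet hΘ (k + 1)).fderiv.differentiableAt (by
      filter_upwards [hr, hΘe] with y h1 h2
      exact (finrank_ker_fderiv_segreJet h2 _).trans
        (h1.trans (finrank_ker_fderiv_segreJet hΘ _).symm))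
    ((fderiv_segreJet_eq_zero_iff hΘ _ _).2 ⟨v, hv, rfl⟩)
  have hVmem : ∀ᶠ y in 𝓝 y₀, holomorphicPart (V y) ∈ segreKer Θ (k + 1) y := by
    filter_upwards [hV, hΘe] with y h1 h2
    obtain ⟨u, hu, hVu⟩ := (fderiv_segreJet_eq_zero_iff h2 _ _).1 h1
    rw [hVu]
    exact hu
  let W : ComplexifiedSpace m d → ComplexifiedSpace m d := fun y =>
    tangentInr (holomorphicPart (V y))
  have hW : DifferentiableAt ℂ W y₀ :=
    tangentInr.differentiableAt.comp y₀ (holomorphicPart.differentiableAt.comp y₀ hVd)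
  have hW₀ : W y₀ = tangentInr v := by simp only [W, hV₀, holomorphicPart_tangentInr]
  have key : ∀ i : Fin m, ∃ v' : CoordSpace m d, ∀ (j : Fin d) (w : List (Fin m)),
      w.length ≤ k + 1 →
      fderiv ℂ (coordDeriv ((i :: w).map Sum.inl) (Θ j)) y₀ (tangentInr v) +
        fderiv ℂ (coordDeriv (w.map Sum.inl) (Θ j)) y₀ (tangentInr v') = 0 := by
    intro i
    let e : ComplexifiedSpace m d := Pi.single (Sum.inl i) 1
    refine ⟨holomorphicPart (fderiv ℂ V y₀ e), fun j w hw => ?_⟩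
    set f := coordDeriv (w.map Sum.inl) (Θ j)
    have hf : AnalyticAt ℂ f y₀ := analyticAt_coordDeriv (hΘ j) _
    have h1 : (fun y => fderiv ℂ f y (W y)) =ᶠ[𝓝 y₀] fun _ => 0 := by
      filter_upwards [hVmem] with y hy
      exact hy j w hw
    have h2 := congrArg (fun L : ComplexifiedSpace m d →L[ℂ] ℂ => L e) h1.fderiv_eq
    have h3 : fderiv ℂ W y₀ e = tangentInr (holomorphicPart (fderiv ℂ V y₀ e)) := by
      have := (tangentInr.hasFDerivAt.comp y₀
        (holomorphicPart.hasFDerivAt.comp y₀ hVd.hasFDerivAt)).fderiv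
      change fderiv ℂ W y₀ = _ at this
      rw [this]
      rfl
    rw [fderiv_clm_apply hf.fderiv.differentiableAt hW] at h2
    -- Symmetry of the second derivative turns the ζ_i-derivative of dΘ_w, applied to v, into
    -- dΘ_{iw}(v).
    have h4 := fderiv_fderiv_apply_comm hf (W y₀) e
    rw [fderiv_clm_apply hf.fderiv.differentiableAt (differentiableAt_const _)] at h4
    simp only [fderiv_fun_const, Pi.zero_apply, ContinuousLinearMap.comp_zero, zero_add,
      ContinuousLinearMap.flip_apply, _root_.add_apply, _root_.zero_apply,
      ContinuousLinearMap.comp_apply] at h2 h4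
    rw [h4, h3, hW₀, add_comm] at h2
    exact h2
  have key2 : ∀ (i : Fin m) (j : Fin d) (w : List (Fin m)), w.length ≤ k + 1 →
      fderiv ℂ (coordDeriv ((i :: w).map Sum.inl) (Θ j)) y₀ (tangentInr v) = 0 := by
    intro i j w hw
    obtain ⟨v', hv'⟩ := key i
    have h1 : v' ∈ segreKer Θ k y₀ := fun j w hw => by
      have h2 := hv' j w (by omega)
      rwa [hv j (i :: w) (by simpa using hw), zero_add] at h2
    rw [hE] at h1
    have h2 := hv' j w hw
    rwa [h1 j w hw, add_zero] at h2
  intro j w hw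
  cases w with
  | nil => exact hv j [] (by simp)
  | cons i w => exact key2 i j w (by simpa using hw)

end Stabilization

/-! ### Generic ranks through minors. -/

section GenericRank

variable {σ κ : Type*} [Fintype σ] [Fintype κ] [DecidableEq σ] {f : (σ → ℂ) → (κ → ℂ)}
  {x : σ → ℂ}

/-- A minor of the Jacobian matrix. -/
def jacobianMinor (f : (σ → ℂ) → (κ → ℂ)) {e : ℕ} (r : Fin e → κ) (s : Fin e → σ) :
    (σ → ℂ) → ℂ :=
  fun y => Matrix.det (Matrix.of fun i j => partialDeriv (s j) (fun x => f x (r i)) y)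

theorem isComplexRegularAt_jacobianMinor {c : Regularity}
    (hf : ∀ a, IsComplexRegularAt c (fun x => f x a) x) {e : ℕ} (r : Fin e → κ)
    (s : Fin e → σ) : IsComplexRegularAt c (jacobianMinor f r s) x :=
  IsComplexRegularAt.det fun i j => (hf (r i)).fderiv_apply (Pi.single (s j) 1)

theorem analyticAt_jacobianMinor (hf : AnalyticAt ℂ f x) {e : ℕ} (r : Fin e → κ)
    (s : Fin e → σ) : AnalyticAt ℂ (jacobianMinor f r s) x :=
  (isComplexRegularAt_jacobianMinor (c := Regularity.analytic)
    (fun a => isComplexRegularAt_analytic_iff.2 (analyticAt_pi_iff.1 hf a)) r s).1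

theorem le_rankAt_iff (hf : DifferentiableAt ℂ f x) (e : ℕ) :
    e ≤ rankAt f x ↔ ∃ (r : Fin e → κ) (s : Fin e → σ), jacobianMinor f r s x ≠ 0 := by
  have h1 : rankAt f x = (LinearMap.toMatrix' (fderiv ℂ f x : (σ → ℂ) →ₗ[ℂ] (κ → ℂ))).rank := by
    rw [Matrix.rank, ← Matrix.toLin'_apply', Matrix.toLin'_toMatrix']
    rfl
  rw [h1, le_rank_iff_exists_minor_ne_zero]
  refine exists_congr fun r => exists_congr fun s => not_congr ?_
  rw [jacobianMinor]
  have h2 : (LinearMap.toMatrix' (fderiv ℂ f x : (σ → ℂ) →ₗ[ℂ] (κ → ℂ))).submatrix r s =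
      Matrix.of fun i j => partialDeriv (s j) (fun x => f x (r i)) x := by
    ext i j
    rw [Matrix.submatrix_apply, LinearMap.toMatrix'_apply]
    exact fderiv_apply_apply hf _ _
  rw [h2]

theorem rankAt_le_card (f : (σ → ℂ) → (κ → ℂ)) (x : σ → ℂ) : rankAt f x ≤ Fintype.card σ := by
  have := LinearMap.finrank_range_le (fderiv ℂ f x : (σ → ℂ) →ₗ[ℂ] (κ → ℂ))
  simpa [rankAt] using this

theorem le_genericRank_iff (e : ℕ) : e ≤ genericRank f x ↔ ∃ᶠ y in 𝓝 x, e ≤ rankAt f y := by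
  have hbdd : BddAbove {e : ℕ | ∃ᶠ y in 𝓝 x, e ≤ rankAt f y} := ⟨Fintype.card σ, fun e he => by
    obtain ⟨y, hy⟩ := he.exists
    exact hy.trans (rankAt_le_card f y)⟩
  constructor
  · intro he
    have hmem : genericRank f x ∈ {e : ℕ | ∃ᶠ y in 𝓝 x, e ≤ rankAt f y} :=
      Nat.sSup_mem ⟨0, (Eventually.of_forall fun _ => Nat.zero_le _).frequently⟩ hbdd
    exact hmem.mono fun y hy => he.trans hy
  · exact fun he => le_csSup hbdd he

/-- There are finitely many minors, so if each vanished near x they would all vanish on a common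
neighborhood. -/
theorem le_genericRank_iff_minor (hf : AnalyticAt ℂ f x) (e : ℕ) : e ≤ genericRank f x ↔
    ∃ (r : Fin e → κ) (s : Fin e → σ), ¬ ∀ᶠ y in 𝓝 x, jacobianMinor f r s y = 0 := by
  rw [le_genericRank_iff]
  constructor
  · intro h
    by_contra! hcon
    refine h ?_
    have h1 : ∀ᶠ y in 𝓝 x, ∀ (r : Fin e → κ) (s : Fin e → σ), jacobianMinor f r s y = 0 :=
      eventually_all.2 fun r => eventually_all.2 fun s => hcon r s
    filter_upwards [h1, hf.eventually_analyticAt] with y h2 h3 h4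
    obtain ⟨r, s, hrs⟩ := (le_rankAt_iff h3.differentiableAt e).1 h4
    exact hrs (h2 r s)
  · rintro ⟨r, s, hrs⟩
    refine ((not_eventually.1 hrs).and_eventually hf.eventually_analyticAt).mono fun y hy => ?_
    exact (le_rankAt_iff hy.2.differentiableAt e).2 ⟨r, s, hy.1⟩

theorem rankAt_le_genericRank (hf : AnalyticAt ℂ f x) : rankAt f x ≤ genericRank f x := by
  obtain ⟨r, s, hrs⟩ := (le_rankAt_iff hf.differentiableAt _).1 (le_refl (rankAt f x))
  exact (le_genericRank_iff_minor hf _).2 ⟨r, s, fun h => hrs h.self_of_nhds⟩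

/-- On a ball of analyticity, a minor that vanishes near one point vanishes near all of them. -/
theorem eventually_genericRank_eq (hf : AnalyticAt ℂ f x) :
    ∀ᶠ y in 𝓝 x, genericRank f y = genericRank f x := by
  obtain ⟨ε, hε, hball⟩ := exists_ball_analyticAt hf
  filter_upwards [Metric.ball_mem_nhds x hε] with y hy
  have hx := Metric.mem_ball_self (x := x) hε
  refine eq_of_forall_le_iff fun e => ?_
  rw [le_genericRank_iff_minor (hball y hy), le_genericRank_iff_minor hf]
  refine exists_congr fun r => exists_congr fun s => not_congr ?_
  have key : ∀ a ∈ Metric.ball x ε, ∀ b ∈ Metric.ball x ε,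
      (∀ᶠ z in 𝓝 a, jacobianMinor f r s z = 0) → ∀ᶠ z in 𝓝 b, jacobianMinor f r s z = 0 := by
    intro a ha b hb h
    filter_upwards [Metric.isOpen_ball.mem_nhds hb] with z hz
    exact eq_zero_of_mem_ball_of_eventually (𝕜 := ℂ)
      (fun w hw => analyticAt_jacobianMinor (hball w hw) r s) ha h hz
  exact ⟨key y hy x hx, key x hx y hy⟩

/-- A minor of maximal generic size is nonzero on an open set accumulating at x, and there the
locally constant generic rank bounds the rank from above. -/
theorem frequently_rankAt_eq_genericRank (hf : AnalyticAt ℂ f x) :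
    ∃ᶠ y in 𝓝 x, ∀ᶠ z in 𝓝 y, rankAt f z = genericRank f x := by
  obtain ⟨r, s, hrs⟩ := (le_genericRank_iff_minor hf _).1 (le_refl (genericRank f x))
  refine ((not_eventually.1 hrs).and_eventually ((eventually_genericRank_eq hf).and
    hf.eventually_analyticAt).eventually_nhds).mono fun y hy => ?_
  have h1 := (analyticAt_jacobianMinor hy.2.self_of_nhds.2 r s).continuousAt.eventually_ne hy.1
  filter_upwards [hy.2, h1] with z h2 h3
  refine le_antisymm ?_ ((le_rankAt_iff h2.2.differentiableAt _).2 ⟨r, s, h3⟩)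
  rw [← h2.1]
  exact rankAt_le_genericRank h2.2

theorem genericRank_eq_of_eventually {e : ℕ} (h : ∀ᶠ y in 𝓝 x, rankAt f y = e) :
    genericRank f x = e := by
  refine eq_of_forall_le_iff fun a => ?_
  rw [le_genericRank_iff]
  constructor
  · intro ha
    obtain ⟨y, h1, h2⟩ := (ha.and_eventually h).exists
    omega
  · exact fun ha => (h.mono fun y hy => by omega).frequently

end GenericRank

/-! ### Stabilization of generic ranks. -/

section GenericStabilization

variable {m d : ℕ} {Θ : Fin d → ComplexifiedSpace m d → ℂ} {x : ComplexifiedSpace m d}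

theorem rankAt_segreJet_mono (hΘ : ∀ j, AnalyticAt ℂ (Θ j) x) :
    Monotone fun k => rankAt (segreJet Θ k) x := by
  intro k l hkl
  have h1 := rankAt_segreJet_add_finrank hΘ k
  have h2 := rankAt_segreJet_add_finrank hΘ l
  have h3 := Submodule.finrank_mono (segreKer_anti Θ x hkl)
  simp only at h3 ⊢
  omega

theorem genericRank_segreJet_mono (hΘ : ∀ j, AnalyticAt ℂ (Θ j) x) :
    Monotone fun k => genericRank (segreJet Θ k) x := by
  intro k l hkl
  change genericRank (segreJet Θ k) x ≤ genericRank (segreJet Θ l) x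
  rw [le_genericRank_iff]
  refine (((le_genericRank_iff (f := segreJet Θ k) _).1 le_rfl).and_eventually
    (eventually_all.2 fun j => (hΘ j).eventually_analyticAt)).mono fun y hy => ?_
  exact hy.1.trans (rankAt_segreJet_mono hy.2 hkl)

/-- At suitable points near x the ranks of orders k and k + 1 are equal and locally constant, so
`segreKer_succ_le` applies on an open set. Local constancy of generic ranks brings the result back
to x. -/
theorem genericRank_segreJet_stable (hΘ : ∀ j, AnalyticAt ℂ (Θ j) x) {k : ℕ}
    (hk : genericRank (segreJet Θ (k + 1)) x = genericRank (segreJet Θ k) x) :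
    genericRank (segreJet Θ (k + 2)) x = genericRank (segreJet Θ (k + 1)) x := by
  have hΘe : ∀ᶠ y in 𝓝 x, ∀ j, AnalyticAt ℂ (Θ j) y :=
    eventually_all.2 fun j => (hΘ j).eventually_analyticAt
  have hW : ∀ᶠ y in 𝓝 x, (∀ j, AnalyticAt ℂ (Θ j) y) ∧
      genericRank (segreJet Θ (k + 1)) y = genericRank (segreJet Θ (k + 1)) x ∧
      genericRank (segreJet Θ (k + 2)) y = genericRank (segreJet Θ (k + 2)) x :=
    hΘe.and ((eventually_genericRank_eq (analyticAt_segreJet hΘ _)).and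
      (eventually_genericRank_eq (analyticAt_segreJet hΘ _)))
  obtain ⟨y, h1, h2⟩ := ((frequently_rankAt_eq_genericRank
    (analyticAt_segreJet hΘ k)).and_eventually hW.eventually_nhds).exists
  have h3 : ∀ᶠ z in 𝓝 y, rankAt (segreJet Θ (k + 1)) z = rankAt (segreJet Θ k) z ∧
      rankAt (segreJet Θ (k + 1)) z = genericRank (segreJet Θ k) x := by
    filter_upwards [h1, h2] with z a1 a2
    have a3 := rankAt_segreJet_mono a2.1 (Nat.le_succ k)
    have a4 := rankAt_le_genericRank (analyticAt_segreJet a2.1 (k + 1))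
    simp only [Nat.succ_eq_add_one] at a3
    omega
  have h4 : ∀ᶠ z in 𝓝 y, rankAt (segreJet Θ (k + 2)) z = genericRank (segreJet Θ k) x := by
    filter_upwards [h3.eventually_nhds, h2.eventually_nhds] with z a1 a2
    have hz := a2.self_of_nhds.1
    have e0 := rankAt_segreJet_add_finrank hz k
    have e1 := rankAt_segreJet_add_finrank hz (k + 1)
    have e2 := rankAt_segreJet_add_finrank hz (k + 2)
    have hz3 := a1.self_of_nhds
    have b1 : segreKer Θ k z = segreKer Θ (k + 1) z :=
      (Submodule.eq_of_le_of_finrank_eq (segreKer_anti Θ z (Nat.le_succ k))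
        (by simp only [Nat.succ_eq_add_one]; omega)).symm
    have b2 := segreKer_succ_le hz b1 (by
      filter_upwards [a1, a2] with u c1 c2
      have := rankAt_segreJet_add_finrank c2.1 (k + 1)
      omega)
    have b3 := Submodule.finrank_mono b2
    have b4 : Module.finrank ℂ (segreKer Θ (k + 2) z) ≤ Module.finrank ℂ (segreKer Θ (k + 1) z) :=
      Submodule.finrank_mono (segreKer_anti Θ z (Nat.le_succ (k + 1)))
    omega
  rw [← h2.self_of_nhds.2.2, genericRank_eq_of_eventually h4, hk]

end GenericStabilization

/-! ### Existence of complex defining equations. -/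

section Existence

variable {ι : Type*} [Fintype ι] {c : Regularity} {M : Set (ι → ℂ)} {m d : ℕ}

/-- The slice with fixed first argument. -/
def sliceInr {σ τ : Type*} [Fintype σ] [Fintype τ] : (τ → ℂ) →L[ℂ] (σ ⊕ τ → ℂ) :=
  LinearMap.toContinuousLinearMap
    { toFun := fun v => Sum.elim (fun _ => 0) v
      map_add' := fun u v => by ext (_ | _) <;> simp
      map_smul' := fun a v => by ext (_ | _) <;> simp }

theorem sliceInr_apply {σ τ : Type*} [Fintype σ] [Fintype τ] (v : τ → ℂ) :
    (sliceInr v : σ ⊕ τ → ℂ) = Sum.elim (fun _ => 0) v := rfl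

/-- The differential of a real function in terms of the antiholomorphic differential of its
polarization. -/
theorem fderiv_eq_two_mul_re_polarization {r : (ι → ℂ) → ℝ} {p : ι → ℂ} (hr : AnalyticAt ℝ r p)
    {F : (ι ⊕ ι → ℂ) → ℂ} (hF : AnalyticAt ℂ F (Sum.elim p (conjVec p)))
    (hFr : ∀ᶠ x in 𝓝 p, F (Sum.elim x (conjVec x)) = r x) (v : ι → ℂ) :
    fderiv ℝ r p v =
      2 * (fderiv ℂ F (Sum.elim p (conjVec p)) (sliceInr (conjVec v))).re := by
  let D : (ι → ℂ) →L[ℝ] (ι ⊕ ι → ℂ) := LinearMap.toContinuousLinearMap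
    { toFun := fun x => Sum.elim x (conjVec x)
      map_add' := fun u v => by ext (_ | _) <;> simp
      map_smul' := fun a v => by ext (_ | _) <;> simp }
  have hD : ∀ x, D x = Sum.elim x (conjVec x) := fun x => rfl
  set L := fderiv ℂ F (Sum.elim p (conjVec p))
  have key : ∀ v, ((fderiv ℝ r p v : ℝ) : ℂ) = L (D v) := by
    intro v
    have h1 : HasFDerivAt (fun x => F (D x)) (L.restrictScalars ℝ ∘L D) p :=
      (HasFDerivAt.restrictScalars ℝ hF.differentiableAt.hasFDerivAt).comp p D.hasFDerivAt
    have h2 : HasFDerivAt (fun x => (r x : ℂ)) (Complex.ofRealCLM ∘L fderiv ℝ r p) p :=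
      Complex.ofRealCLM.hasFDerivAt.comp p hr.differentiableAt.hasFDerivAt
    have h3 := (h2.congr_of_eventuallyEq hFr).unique h1
    exact congrArg (fun A : (ι → ℂ) →L[ℝ] ℂ => A v) h3
  have hdec : ∀ v, L (D v) = L (sliceInl v) + L (sliceInr (conjVec v)) := by
    intro v
    rw [← map_add]
    congr 1
    ext (i | i) <;> simp [hD, sliceInl_apply, sliceInr_apply]
  have h1 := key v
  -- Reality of the differential at i·v forces its holomorphic and antiholomorphic parts to have
  -- equal real parts; hence the factor 2.
  have h2 := key (Complex.I • v)
  rw [hdec] at h1 h2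
  have h3 : conjVec (Complex.I • v) = -Complex.I • conjVec v := by
    rw [conjVec_smul, Complex.conj_I]
  rw [h3, sliceInl.map_smul, sliceInr.map_smul, L.map_smul, L.map_smul] at h2
  have h4 := congrArg Complex.re h1
  have h5 := congrArg Complex.im h2
  simp at h4 h5
  linarith

/-- Write f = ∑ a_j u_j. From Re f(Bv) = 0, ∑ Re a_j Re B_j = ∑ Im a_j Im B_j. The right side
vanishes on T and on JT, hence everywhere; real independence of the Re B_j then kills both parts of
a. So genericity means ℂ-independence of the antiholomorphic differentials. -/
theorem surjective_of_generic {V : Type*} [AddCommGroup V] [Module ℂ V] (B : V →ₗ[ℝ] (Fin d → ℂ))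
    (J : V →ₗ[ℝ] V) (hBJ : ∀ v j, B (J v) j = -Complex.I * B v j) {T : Submodule ℝ V}
    (hT : ∀ v ∈ T, ∀ j, (B v j).re = 0) (hTJ : T ⊔ T.map J = ⊤)
    (hli : ∀ a : Fin d → ℝ, (∀ v, ∑ j, a j * (B v j).re = 0) → a = 0)
    {f : (Fin d → ℂ) →ₗ[ℂ] ℂ} (hf : ∀ v, f (B v) = 0) : f = 0 := by
  let a : Fin d → ℂ := fun j => f (Pi.single j 1)
  have hfa : ∀ u : Fin d → ℂ, f u = ∑ j, a j * u j := by
    intro u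
    conv_lhs => rw [show u = ∑ j, u j • (Pi.single j 1 : Fin d → ℂ) from (by
      ext i; simp [Finset.sum_apply, Pi.single_apply])]
    rw [map_sum]
    exact Finset.sum_congr rfl fun j _ => by rw [map_smul, smul_eq_mul, mul_comm]
  have hre : ∀ v, ∑ j, (a j).re * (B v j).re = ∑ j, (a j).im * (B v j).im := by
    intro v
    have h1 := congrArg Complex.re ((hfa (B v)).symm.trans (hf v))
    rw [Complex.re_sum] at h1
    simp only [Complex.mul_re, Finset.sum_sub_distrib, Complex.zero_re] at h1
    linarith
  have hJre : ∀ v j, (B (J v) j).re = (B v j).im := fun v j => by rw [hBJ]; simp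
  have hJim : ∀ v j, (B (J v) j).im = -(B v j).re := fun v j => by rw [hBJ]; simp
  have him : ∀ v, ∑ j, (a j).im * (B v j).im = 0 := by
    intro v
    have hv : v ∈ T ⊔ T.map J := by rw [hTJ]; trivial
    obtain ⟨u, hu, _, ⟨w, hw, rfl⟩, rfl⟩ := Submodule.mem_sup.1 hv
    have h1 : ∑ j, (a j).im * (B u j).im = 0 := by
      rw [← hre]
      exact Finset.sum_eq_zero fun j _ => by rw [hT u hu, mul_zero]
    have h2 : ∑ j, (a j).im * (B (J w) j).im = 0 :=
      Finset.sum_eq_zero fun j _ => by rw [hJim, hT w hw, neg_zero, mul_zero]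
    simp only [map_add, Pi.add_apply, Complex.add_im, mul_add, Finset.sum_add_distrib, h1, h2,
      add_zero]
  have h1 := hli (fun j => (a j).re) fun v => (hre v).trans (him v)
  have h2 := hli (fun j => (a j).im) fun v => by
    have := him (J v)
    simp only [hJim, mul_neg, Finset.sum_neg_distrib, neg_eq_zero] at this
    exact this
  ext j
  change a j = 0
  exact Complex.ext (congrFun h1 j) (congrFun h2 j)

/-- Polarize the equations to F(x, x̄) = 0. Genericity makes the differential of F in the conjugate
variables onto ℂ^d, so with w chosen along a complement of its kernel the equations can be solved
for w̄. -/
theorem IsGenericSubmanifold.exists_isRepresentedBy {p : ι → ℂ}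
    (hM : IsGenericSubmanifold c d M) (hp : p ∈ M) (hcard : Fintype.card ι = m + d) :
    ∃ (h : (ι → ℂ) → CoordSpace m d) (Θ : Fin d → ComplexifiedSpace m d → ℂ),
      IsRepresentedBy c M p h Θ := by
  obtain ⟨r, hr, hMr, hli, T, hT, hTJ⟩ := hM p hp
  have hpol := fun j => (hr j).exists_polarization
  choose F hF hFr using hpol
  change ∀ j, IsComplexRegularAt c (F j) (Sum.elim p (conjVec p)) at hF
  change ∀ j, ∀ᶠ x in 𝓝 p, F j (Sum.elim x (conjVec x)) = r j x at hFr
  set pp : ι ⊕ ι → ℂ := Sum.elim p (conjVec p)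
  have hdr : ∀ j v, fderiv ℝ (r j) p v = 2 * (fderiv ℂ (F j) pp (sliceInr (conjVec v))).re :=
    fun j v => fderiv_eq_two_mul_re_polarization (hr j).1 (hF j).1 (hFr j) v
  let β : (ι → ℂ) →ₗ[ℂ] (Fin d → ℂ) := LinearMap.pi fun j =>
    (fderiv ℂ (F j) pp ∘L sliceInr : (ι → ℂ) →L[ℂ] ℂ).toLinearMap
  have hβ : ∀ u j, β u j = fderiv ℂ (F j) pp (sliceInr u) := fun u j => rfl
  have hβr : LinearMap.range β = ⊤ := by
    by_contra hne
    obtain ⟨f, hf0, hf⟩ := Submodule.exists_le_ker_of_lt_top _ (lt_top_iff_ne_top.2 hne)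
    refine hf0 (surjective_of_generic (V := ι → ℂ)
      { toFun := fun v => β (conjVec v)
        map_add' := fun u v => by rw [conjVec_add, map_add]
        map_smul' := fun a v => by
          have : conjVec (a • v) = (a : ℂ) • conjVec v := by ext i; simp
          rw [this, map_smul]
          rfl } (complexStructure ι) (fun v j => ?_) (T := T) (fun v hv j => ?_) hTJ (fun a ha => ?_)
        fun v => hf ⟨_, rfl⟩)
    · have : conjVec (complexStructure ι v) = -Complex.I • conjVec v := by
        rw [← Complex.conj_I, ← conjVec_smul]
        rfl
      change β (conjVec (complexStructure ι v)) j = -Complex.I * β (conjVec v) j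
      rw [this, map_smul]
      rfl
    · have h1 := (hT v).1 hv j
      rw [hdr] at h1
      exact (mul_eq_zero.1 h1).resolve_left two_ne_zero
    · refine funext (Fintype.linearIndependent_iff.1 hli a ?_)
      ext v
      have h1 : ∑ j, a j * (fderiv ℂ (F j) pp (sliceInr (conjVec v))).re = 0 := ha v
      simp only [_root_.sum_apply, _root_.smul_apply, smul_eq_mul, hdr, _root_.zero_apply]
      calc _ = 2 * ∑ j, a j * (fderiv ℂ (F j) pp (sliceInr (conjVec v))).re := by
            rw [Finset.mul_sum]; exact Finset.sum_congr rfl fun j _ => by ring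
        _ = 0 := by rw [h1, mul_zero]
  obtain ⟨B, C, -, hBC⟩ := exists_complementary_maps (r := d) (s := m) β
    (by rw [hβr, finrank_top]; simp) (by simp [hcard, add_comm])
  let E₀ : (ι → ℂ) →ₗ[ℂ] CoordSpace m d :=
    { toFun := fun v => Sum.elim (C v) (B (β v))
      map_add' := fun u v => by ext (_ | _) <;> simp
      map_smul' := fun a v => by ext (_ | _) <;> simp }
  have hE₀ : Function.Bijective E₀ := by
    constructor
    · intro u v huv
      refine hBC.1 (Prod.ext (funext fun j => congrFun huv (Sum.inr j))
        (funext fun j => congrFun huv (Sum.inl j)))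
    · intro t
      obtain ⟨v, hv⟩ := hBC.2 (fun j => t (Sum.inr j), fun j => t (Sum.inl j))
      refine ⟨v, ?_⟩
      ext (i | i)
      · exact congrFun (congrArg Prod.snd hv) i
      · exact congrFun (congrArg Prod.fst hv) i
  let E : (ι → ℂ) ≃ₗ[ℂ] CoordSpace m d := LinearEquiv.ofBijective E₀ hE₀
  have hE : ∀ v j, E v (Sum.inr j) = B (β v) j := fun v j => rfl
  -- Conjugating `E` on both sides gives a complex linear chart whose conjugate is `E` applied to
  -- conj(x - p).
  let A : (ι → ℂ) ≃ₗ[ℂ] CoordSpace m d :=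
    { toFun := fun v => conjVec (E (conjVec v))
      map_add' := fun u v => by rw [conjVec_add, map_add, conjVec_add]
      map_smul' := fun a v => by
        rw [conjVec_smul, map_smul, conjVec_smul, Complex.conj_conj]; rfl
      invFun := fun t => conjVec (E.symm (conjVec t))
      left_inv := fun v => by simp
      right_inv := fun v => by simp }
  have hA : ∀ v, A v = conjVec (E (conjVec v)) := fun v => rfl
  let h : (ι → ℂ) → CoordSpace m d := fun x => A (x - p)
  let Acl : (ι → ℂ) ≃L[ℂ] CoordSpace m d := A.toContinuousLinearEquiv
  have hconjh : ∀ x, conjVec (h x) = E (conjVec (x - p)) := fun x => conjVec_conjVec _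
  -- Expresses the polarized displacement from (p, p̄) in the variables (ζ, t) and an independent
  -- variable standing for w̄.
  let K₀ : (((Fin m ⊕ (Fin m ⊕ Fin d)) ⊕ Fin d) → ℂ) →L[ℂ] (ι ⊕ ι → ℂ) :=
    LinearMap.toContinuousLinearMap
    { toFun := fun Y => Sum.elim (A.symm fun i => Y (Sum.inl (Sum.inr i)))
        (E.symm (Sum.elim (fun i => Y (Sum.inl (Sum.inl i))) fun j => Y (Sum.inr j)))
      map_add' := fun X Y => by
        have h1 : (Sum.elim (fun i => (X + Y) (Sum.inl (Sum.inl i))) fun j => (X + Y) (Sum.inr j) :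
          CoordSpace m d) =
          (Sum.elim (fun i => X (Sum.inl (Sum.inl i))) fun j => X (Sum.inr j)) +
          (Sum.elim (fun i => Y (Sum.inl (Sum.inl i))) fun j => Y (Sum.inr j)) := by
            ext (_ | _) <;> rfl
        have h2 : (fun i => (X + Y) (Sum.inl (Sum.inr i))) =
          (fun i => X (Sum.inl (Sum.inr i))) + fun i => Y (Sum.inl (Sum.inr i)) := rfl
        rw [h1, h2, map_add, map_add]
        ext (_ | _) <;> rfl
      map_smul' := fun a Y => by
        have h1 : (Sum.elim (fun i => (a • Y) (Sum.inl (Sum.inl i))) fun j => (a • Y) (Sum.inr j) :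
          CoordSpace m d) =
          a • (Sum.elim (fun i => Y (Sum.inl (Sum.inl i))) fun j => Y (Sum.inr j)) := by
            ext (_ | _) <;> rfl
        have h2 : (fun i => (a • Y) (Sum.inl (Sum.inr i))) =
          a • (fun i => Y (Sum.inl (Sum.inr i))) := rfl
        rw [h1, h2, map_smul, map_smul]
        ext (_ | _) <;> rfl }
  have hK₀ : ∀ Y, K₀ Y = Sum.elim (A.symm fun i => Y (Sum.inl (Sum.inr i)))
        (E.symm (Sum.elim (fun i => Y (Sum.inl (Sum.inl i))) fun j => Y (Sum.inr j))) :=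
    fun Y => rfl
  -- The variable w̄ is replaced by the value of F; Θ is the last component of the local inverse at
  -- F = 0.
  let Ψ : (((Fin m ⊕ (Fin m ⊕ Fin d)) ⊕ Fin d) → ℂ) → (((Fin m ⊕ (Fin m ⊕ Fin d)) ⊕ Fin d) → ℂ) :=
    fun Y => Sum.elim (fun i => Y (Sum.inl i)) fun j => F j (K₀ Y + pp)
  have hKreg : ∀ a, IsComplexRegularAt c (fun Y => (K₀ Y + pp) a) 0 := fun a =>
    (complexRegularSubalgebra c _).add_mem (isComplexRegularAt_clm
      ((ContinuousLinearMap.proj (R := ℂ) (φ := fun _ => ℂ) a).comp K₀) 0)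
      (isComplexRegularAt_const (pp a) 0)
  have hK0 : K₀ 0 + pp = pp := by rw [map_zero, zero_add]
  have hΨreg : ∀ a, IsComplexRegularAt c (fun Y => Ψ Y a) 0 := by
    rintro (a | j)
    · exact isComplexRegularAt_coord (Sum.inl a) 0
    · exact IsComplexRegularAt.comp (f := F j) (g := fun Y => K₀ Y + pp)
        (by rw [hK0]; exact hF j) hKreg
  have hΨa : AnalyticAt ℂ Ψ 0 := analyticAt_pi_iff.2 fun a => (hΨreg a).1
  have hΨ0 : Ψ 0 = 0 := by
    ext (a | j)
    · rfl
    · change F j (K₀ 0 + pp) = 0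
      rw [hK0, (hFr j).self_of_nhds, hMr.self_of_nhds.1 hp j, Complex.ofReal_zero]
  have hΨ' : ∀ V j, fderiv ℂ Ψ 0 V (Sum.inr j) = fderiv ℂ (F j) pp (K₀ V) := by
    intro V j
    rw [fderiv_apply_apply hΨa.differentiableAt]
    have h1 : HasFDerivAt (fun Y => K₀ Y + pp) K₀ 0 := K₀.hasFDerivAt.add_const _
    have h2 := fderiv_comp_apply' (g := F j) (f := fun Y => K₀ Y + pp) (x := 0)
      (by rw [hK0]; exact (hF j).1.differentiableAt) h1.differentiableAt V
    rw [h1.fderiv, hK0] at h2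
    exact h2
  have hΨ'' : ∀ V a, fderiv ℂ Ψ 0 V (Sum.inl a) = V (Sum.inl a) := by
    intro V a
    rw [fderiv_apply_apply hΨa.differentiableAt]
    have h1 : HasFDerivAt (fun Y : ((Fin m ⊕ (Fin m ⊕ Fin d)) ⊕ Fin d) → ℂ => Y (Sum.inl a))
      (ContinuousLinearMap.proj (R := ℂ) (φ := fun _ => ℂ) (Sum.inl a)) 0 :=
      (ContinuousLinearMap.proj (R := ℂ) (φ := fun _ => ℂ) (Sum.inl a)).hasFDerivAt
    change fderiv ℂ (fun Y : ((Fin m ⊕ (Fin m ⊕ Fin d)) ⊕ Fin d) → ℂ => Y (Sum.inl a)) 0 V = _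
    rw [h1.fderiv]
    rfl
  have hΨinj : Function.Injective (fderiv ℂ Ψ 0) := by
    rw [injective_iff_map_eq_zero]
    intro V hV
    have h1 : ∀ a, V (Sum.inl a) = 0 := fun a => by
      rw [← hΨ'' V a, hV]
      rfl
    let u : ι → ℂ := E.symm (Sum.elim (fun _ => 0) fun j => V (Sum.inr j))
    have h2 : K₀ V = sliceInr u := by
      rw [hK₀]
      simp only [h1]
      change Sum.elim (A.symm 0) u = _
      rw [map_zero]
      rfl
    have h3 : β u = 0 := by
      ext j
      rw [hβ, ← h2, ← hΨ', hV]
      rfl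
    ext (a | j)
    · exact h1 a
    · have h4 : E u (Sum.inr j) = V (Sum.inr j) := by simp [u]
      rw [hE, h3, map_zero] at h4
      exact h4.symm
  have hΨb : Function.Bijective (fderiv ℂ Ψ 0) := ⟨hΨinj, (LinearMap.injective_iff_surjective
    (f := (fderiv ℂ Ψ 0).toLinearMap)).1 hΨinj⟩
  obtain ⟨g, hg0, hg, hΨg, hgΨ⟩ := exists_regular_localInverse hΨreg hΨb
  rw [hΨ0] at hg0 hg hΨg
  have hsl : sliceInl (0 : ComplexifiedSpace m d) = (0 : (Fin m ⊕ (Fin m ⊕ Fin d)) ⊕ Fin d → ℂ) :=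
    map_zero _
  have hh : ∀ i, IsComplexRegularAt c (fun x => h x i) p := by
    intro i
    have h1 := (complexRegularSubalgebra c p).add_mem (isComplexRegularAt_clm
      ((ContinuousLinearMap.proj (R := ℂ) (φ := fun _ => ℂ) i).comp
        (Acl : (ι → ℂ) →L[ℂ] CoordSpace m d)) p)
      (isComplexRegularAt_const (-A p i) p)
    refine IsComplexRegularAt.congr h1 (Eventually.of_forall fun x => ?_)
    simp only [h, map_sub, Pi.sub_apply]
    exact (sub_eq_add_neg _ _).symm
  have hhp : h p = 0 := by simp only [h, sub_self, map_zero]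
  have hhcont : Continuous h := Acl.continuous.comp (continuous_id.sub continuous_const)
  refine ⟨h, fun j y => g (sliceInl y) (Sum.inr j), ⟨⟨hh, ?_⟩, hhp, fun j => ?_, fun j => ?_, ?_⟩⟩
  · have h1 : HasFDerivAt h (Acl : (ι → ℂ) →L[ℂ] CoordSpace m d) p :=
      (Acl : (ι → ℂ) →L[ℂ] CoordSpace m d).hasFDerivAt.comp p ((hasFDerivAt_id p).sub_const p)
    rw [h1.fderiv]
    exact Acl.bijective
  · refine IsComplexRegularAt.comp (f := fun Y => g Y (Sum.inr j)) (g := sliceInl) ?_ fun a => ?_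
    · rw [hsl]; exact hg _
    · exact isComplexRegularAt_clm
        ((ContinuousLinearMap.proj (R := ℂ) (φ := fun _ => ℂ) a).comp sliceInl) _
  · rw [hsl, hg0]; rfl
  · let Yx : (ι → ℂ) → (((Fin m ⊕ (Fin m ⊕ Fin d)) ⊕ Fin d) → ℂ) := fun x =>
      Sum.elim (realPoint (h x)) fun j => (starRingEnd ℂ) (h x (Sum.inr j))
    have hYc : Continuous Yx := by
      refine continuous_pi ?_
      rintro (a | j)
      · exact (continuous_apply a).comp (realPoint.continuous.comp hhcont)
      · exact Complex.continuous_conj.comp ((continuous_apply (Sum.inr j)).comp hhcont)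
    have hY0 : Yx p = 0 := by
      ext (a | j)
      · change realPoint (h p) a = 0
        rw [hhp, map_zero]
        rfl
      · change (starRingEnd ℂ) (h p (Sum.inr j)) = 0
        rw [hhp]
        simp
    have hKY : ∀ x, K₀ (Yx x) + pp = Sum.elim x (conjVec x) := by
      intro x
      have h1 : (Sum.elim (fun i => Yx x (Sum.inl (Sum.inl i))) fun j => Yx x (Sum.inr j)) =
          conjVec (h x) := by
        ext (_ | _) <;> rfl
      have h2 : (fun i => Yx x (Sum.inl (Sum.inr i))) = h x := rfl
      rw [hK₀, h1, h2, hconjh, LinearEquiv.symm_apply_apply]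
      simp only [LinearEquiv.symm_apply_apply]
      ext (i | i)
      · simp [pp]
      · simp [pp]
    have hYt : Tendsto Yx (𝓝 p) (𝓝 0) := by
      have := hYc.tendsto p
      rwa [hY0] at this
    have hst : Tendsto (fun x => (sliceInl (realPoint (h x)) :
        (Fin m ⊕ (Fin m ⊕ Fin d)) ⊕ Fin d → ℂ)) (𝓝 p) (𝓝 0) := by
      have : Continuous (fun x => (sliceInl (realPoint (h x)) :
        (Fin m ⊕ (Fin m ⊕ Fin d)) ⊕ Fin d → ℂ)) :=
        sliceInl.continuous.comp (realPoint.continuous.comp hhcont)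
      have h2 := this.tendsto p
      rwa [hhp, map_zero, hsl] at h2
    filter_upwards [hMr, eventually_all.2 hFr, hYt.eventually hgΨ, hst.eventually hΨg]
      with x h1 h2 h3 h4
    have hΨY : Ψ (Yx x) = Sum.elim (realPoint (h x)) fun j => (r j x : ℂ) := by
      ext (a | j)
      · rfl
      · change F j (K₀ (Yx x) + pp) = _
        rw [hKY, h2 j]
        rfl
    change x ∈ M ↔ ∀ j, (starRingEnd ℂ) (h x (Sum.inr j)) = g (sliceInl (realPoint (h x))) (Sum.inr j)
    rw [h1]
    constructor
    · intro hx j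
      have h5 : Ψ (Yx x) = sliceInl (realPoint (h x)) := by
        rw [hΨY]
        ext (a | j)
        · rfl
        · change ((r j x : ℝ) : ℂ) = 0
          rw [hx j, Complex.ofReal_zero]
      rw [← h5, h3]
      rfl
    · intro hx
      have h5 : g (sliceInl (realPoint (h x))) = Yx x := by
        ext (a | j)
        · exact congrFun h4 (Sum.inl a)
        · exact (hx j).symm
      rw [h5, hΨY] at h4
      intro j
      have := congrFun h4 (Sum.inr j)
      exact Complex.ofReal_eq_zero.1 this

end Existence

/-! ### Global generic ranks and the exceptional subvariety. -/

section GlobalInvariants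

variable {ι : Type*} [Fintype ι] {c : Regularity} {M : Set (ι → ℂ)} {m d : ℕ}
  {q : ι → ℂ} {h h' : (ι → ℂ) → CoordSpace m d} {Θ Θ' : Fin d → ComplexifiedSpace m d → ℂ}

/-- Minors vanishing at the real points vanish identically, so generic rank is visible on M, where
ranks do not depend on coordinates. -/
theorem IsLocallyRepresentedBy.le_genericRank_iff (H : IsLocallyRepresentedBy M q h Θ)
    (hM : IsGenericSubmanifold c d M) (hq : q ∈ M) (k e : ℕ) :
    e ≤ genericRank (segreJet Θ k) (realPoint (h q)) ↔
      ∃ᶠ x in 𝓝[M] q, e ≤ rankAt (segreJet Θ k) (realPoint (h x)) := by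
  have han := analyticAt_segreJet H.regular k
  constructor
  · intro he
    obtain ⟨r, s, hrs⟩ := (le_genericRank_iff_minor han e).1 he
    by_contra hcon
    rw [not_frequently, eventually_nhdsWithin_iff] at hcon
    refine hrs (H.eventually_eq_zero hM hq (analyticAt_jacobianMinor han r s) ?_)
    filter_upwards [hcon, H.eventually] with x h1 h2 hx
    by_contra h3
    exact h1 hx ((le_rankAt_iff (analyticAt_segreJet h2.regular k).differentiableAt e).2
      ⟨r, s, h3⟩)
  · intro he
    rw [SegreJets.le_genericRank_iff]
    have h1 : Tendsto (fun x => realPoint (h x)) (𝓝[M] q) (𝓝 (realPoint (h q))) :=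
      (realPoint.continuous.continuousAt.comp H.analyticAt.continuousAt).tendsto.mono_left
        nhdsWithin_le_nhds
    exact h1.frequently he

theorem IsLocallyRepresentedBy.genericRank_eq (H : IsLocallyRepresentedBy M q h Θ)
    (H' : IsLocallyRepresentedBy M q h' Θ') (hM : IsGenericSubmanifold c d M) (hq : q ∈ M)
    (k : ℕ) : genericRank (segreJet Θ k) (realPoint (h q)) =
      genericRank (segreJet Θ' k) (realPoint (h' q)) := by
  refine eq_of_forall_le_iff fun e => ?_
  rw [H.le_genericRank_iff hM hq, H'.le_genericRank_iff hM hq]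
  refine frequently_congr ?_
  filter_upwards [H.eventually.filter_mono nhdsWithin_le_nhds,
    H'.eventually.filter_mono nhdsWithin_le_nhds, self_mem_nhdsWithin] with x h1 h2 h3
  rw [h1.rankAt_eq h2 hM h3]

/-- One representation computes the generic ranks at all nearby points of M, so they are locally
constant functions on a preconnected set. -/
theorem IsGenericSubmanifold.exists_genericRank_eq (hM : IsGenericSubmanifold c d M)
    (hconn : IsPreconnected M) (hcard : Fintype.card ι = m + d) :
    ∃ g : ℕ → ℕ, ∀ q ∈ M, ∀ (h : (ι → ℂ) → CoordSpace m d)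
      (Θ : Fin d → ComplexifiedSpace m d → ℂ), IsLocallyRepresentedBy M q h Θ →
        ∀ k, genericRank (segreJet Θ k) (realPoint (h q)) = g k := by
  have hex : ∀ q, ∃ (h : (ι → ℂ) → CoordSpace m d) (Θ : Fin d → ComplexifiedSpace m d → ℂ),
      q ∈ M → IsLocallyRepresentedBy M q h Θ := by
    intro q
    by_cases hq : q ∈ M
    · obtain ⟨h, Θ, H⟩ := hM.exists_isRepresentedBy hq hcard
      exact ⟨h, Θ, fun _ => H.isLocallyRepresentedBy⟩
    · exact ⟨fun _ => 0, fun _ _ => 0, fun h => absurd h hq⟩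
  choose H Θ hH using hex
  let G : ℕ → (ι → ℂ) → ℕ := fun k q => genericRank (segreJet (Θ q) k) (realPoint (H q q))
  have hG : ∀ k, ContinuousOn (G k) M := by
    intro k q hq
    have h1 : ∀ᶠ x in 𝓝[M] q, G k x = G k q := by
      have h2 : ∀ᶠ x in 𝓝 q, genericRank (segreJet (Θ q) k) (realPoint (H q x)) = G k q :=
        (realPoint.continuous.continuousAt.comp (hH q hq).analyticAt.continuousAt).eventually
          (eventually_genericRank_eq (analyticAt_segreJet (hH q hq).regular k))
      filter_upwards [h2.filter_mono nhdsWithin_le_nhds,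
        (hH q hq).eventually.filter_mono nhdsWithin_le_nhds, self_mem_nhdsWithin] with x a1 a2 a3
      rw [← a1]
      exact (hH x a3).genericRank_eq a2 hM a3 k
    exact tendsto_const_nhds.congr' (h1.mono fun _ hx => hx.symm)
  by_cases hne : M.Nonempty
  · obtain ⟨q₀, hq₀⟩ := hne
    refine ⟨fun k => G k q₀, fun q hq h Θ' H' k => ?_⟩
    rw [H'.genericRank_eq (hH q hq) hM hq]
    exact hconn.constant (hG k) hq hq₀
  · exact ⟨fun _ => 0, fun q hq => absurd ⟨q, hq⟩ hne⟩

theorem eventually_eq_zero_of_prod {σ α : Type*} [Fintype σ] (s : Finset α)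
    {f : α → (σ → ℂ) → ℂ} {x : σ → ℂ} (hf : ∀ a, AnalyticAt ℂ (f a) x)
    (h : ∀ᶠ y in 𝓝 x, ∏ a ∈ s, f a y = 0) : ∃ a ∈ s, ∀ᶠ y in 𝓝 x, f a y = 0 := by
  classical
  induction s using Finset.induction_on with
  | empty =>
    simp only [Finset.prod_empty] at h
    exact absurd h.self_of_nhds one_ne_zero
  | insert a s ha ih =>
    simp only [Finset.prod_insert ha] at h
    have h1 : AnalyticAt ℂ (fun y => ∏ a ∈ s, f a y) x :=
      Finset.analyticAt_fun_prod s fun a _ => hf a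
    rcases eventually_eq_zero_or_of_smul (𝕜 := ℂ) (hf a) h1 h with h2 | h2
    · exact ⟨a, Finset.mem_insert_self _ _, h2⟩
    · obtain ⟨b, hb, h3⟩ := ih h2
      exact ⟨b, Finset.mem_insert_of_mem hb, h3⟩

/-- The points at which some jet mapping of order at most `ℓ` has rank less than `g`. -/
def degeneracySet (M : Set (ι → ℂ)) (m d ℓ : ℕ) (g : ℕ → ℕ) : Set (ι → ℂ) :=
  {p | p ∈ M ∧ ∃ (h : (ι → ℂ) → CoordSpace m d) (Θ : Fin d → ComplexifiedSpace m d → ℂ),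
    IsLocallyRepresentedBy M p h Θ ∧ ∃ k ≤ ℓ, rankAt (segreJet Θ k) (realPoint (h p)) < g k}

theorem IsLocallyRepresentedBy.mem_degeneracySet_iff (H : IsLocallyRepresentedBy M q h Θ)
    (hM : IsGenericSubmanifold c d M) (hq : q ∈ M) (ℓ : ℕ) (g : ℕ → ℕ) :
    q ∈ degeneracySet M m d ℓ g ↔
      ∃ k ≤ ℓ, rankAt (segreJet Θ k) (realPoint (h q)) < g k := by
  constructor
  · rintro ⟨-, h', Θ', H', k, hk, hlt⟩
    exact ⟨k, hk, by rwa [H.rankAt_eq H' hM hq]⟩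
  · rintro ⟨k, hk, hlt⟩
    exact ⟨hq, h, Θ, H, k, hk, hlt⟩

/-- Choices of a minor of each order. -/
abbrev MinorChoice (m d ℓ : ℕ) (g : ℕ → ℕ) : Type :=
  (k : Fin (ℓ + 1)) → (Fin (g k) → Fin m ⊕ Fin d × MultiIndex m k) ×
    (Fin (g k) → Fin m ⊕ (Fin m ⊕ Fin d))

/-- The product of the chosen minors. -/
def minorProduct (Θ : Fin d → ComplexifiedSpace m d → ℂ) {ℓ : ℕ} {g : ℕ → ℕ}
    (I : MinorChoice m d ℓ g) (y : ComplexifiedSpace m d) : ℂ :=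
  ∏ k : Fin (ℓ + 1), jacobianMinor (segreJet Θ k) (I k).1 (I k).2 y

theorem isComplexRegularAt_minorProduct {y : ComplexifiedSpace m d}
    (hΘ : ∀ j, IsComplexRegularAt c (Θ j) y) {ℓ : ℕ} {g : ℕ → ℕ} (I : MinorChoice m d ℓ g) :
    IsComplexRegularAt c (minorProduct Θ I) y := by
  have h1 : minorProduct Θ I = ∏ k : Fin (ℓ + 1),
      jacobianMinor (segreJet Θ k) (I k).1 (I k).2 := by
    ext y
    rw [Finset.prod_apply]
    rfl
  rw [h1]
  refine (complexRegularSubalgebra c y).prod_mem fun k _ =>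
    isComplexRegularAt_jacobianMinor ?_ _ _
  rintro (i | ⟨j, β⟩)
  · exact isComplexRegularAt_coord (Sum.inl i) y
  · exact IsComplexRegularAt.jetCoeff hΘ j β

/-- A union of loci, each the common zeros of minors of one order, is cut out by the products taking
one minor from each order. -/
theorem exists_rankAt_lt_iff_minorProduct {y : ComplexifiedSpace m d}
    (hΘ : ∀ j, AnalyticAt ℂ (Θ j) y) (ℓ : ℕ) (g : ℕ → ℕ) :
    (∃ k ≤ ℓ, rankAt (segreJet Θ k) y < g k) ↔
      ∀ I : MinorChoice m d ℓ g, minorProduct Θ I y = 0 := by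
  have h1 := fun k => le_rankAt_iff (analyticAt_segreJet hΘ k).differentiableAt (g k)
  constructor
  · rintro ⟨k, hk, hlt⟩ I
    refine Finset.prod_eq_zero (Finset.mem_univ (⟨k, by omega⟩ : Fin (ℓ + 1))) ?_
    by_contra h2
    exact absurd ((h1 k).2 ⟨_, _, h2⟩) (not_le.2 hlt)
  · intro hI
    by_contra! hcon
    have h2 : ∀ k : Fin (ℓ + 1), ∃ rs : (Fin (g k) → Fin m ⊕ Fin d × MultiIndex m k) ×
        (Fin (g k) → Fin m ⊕ (Fin m ⊕ Fin d)),
        jacobianMinor (segreJet Θ k) rs.1 rs.2 y ≠ 0 := by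
      intro k
      obtain ⟨r, s, hrs⟩ := (h1 k).1 (hcon k (by omega))
      exact ⟨(r, s), hrs⟩
    choose I hne using h2
    exact Finset.prod_ne_zero_iff.2 (fun k _ => hne k) (hI I)

theorem isRealSubvariety_degeneracySet (hM : IsGenericSubmanifold c d M)
    (hcard : Fintype.card ι = m + d) (ℓ : ℕ) (g : ℕ → ℕ) :
    IsRealSubvariety c M (degeneracySet M m d ℓ g) := by
  refine ⟨fun p hp => hp.1, fun p hp => ?_⟩
  obtain ⟨h, Θ, H⟩ := hM.exists_isRepresentedBy hp hcard
  have hreg : ∀ I : MinorChoice m d ℓ g,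
      IsMixedRegularAt c (fun x => minorProduct Θ I (realPoint (h x))) p := by
    intro I
    refine IsComplexRegularAt.comp_mixed (f := minorProduct Θ I) (g := fun x => realPoint (h x))
      (isComplexRegularAt_minorProduct ?_ I) ?_
    · rw [H.center, map_zero]
      exact H.regular
    · rintro (i | i)
      · exact (H.coord.1 (Sum.inl i)).isMixedRegularAt.conj
      · exact (H.coord.1 i).isMixedRegularAt
  let e := Fintype.equivFin (MinorChoice m d ℓ g ⊕ MinorChoice m d ℓ g)
  let f : MinorChoice m d ℓ g ⊕ MinorChoice m d ℓ g → (ι → ℂ) → ℝ :=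
    Sum.elim (fun I x => (minorProduct Θ I (realPoint (h x))).re)
      (fun I x => (minorProduct Θ I (realPoint (h x))).im)
  refine ⟨_, fun i => f (e.symm i), fun i => ?_, ?_⟩
  · change IsRealRegularAt c (f (e.symm i)) p
    rcases e.symm i with I | I
    · exact (hreg I).1
    · exact (hreg I).2
  · filter_upwards [H.isLocallyRepresentedBy.eventually] with x hx hxM
    rw [hx.mem_degeneracySet_iff hM hxM, exists_rankAt_lt_iff_minorProduct hx.regular]
    constructor
    · intro hI i
      rcases e.symm i with I | I
      · exact congrArg Complex.re (hI I)
      · exact congrArg Complex.im (hI I)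
    · intro hi I
      apply Complex.ext
      · simpa [f] using hi (e (Sum.inl I))
      · simpa [f] using hi (e (Sum.inr I))

/-- For each order some minor of size g k is not identically zero. If every point of M were
degenerate, the product of these minors would vanish on M, hence identically. -/
theorem degeneracySet_ne (hM : IsGenericSubmanifold c d M) (hne : M.Nonempty)
    (hcard : Fintype.card ι = m + d) (ℓ : ℕ) {g : ℕ → ℕ}
    (hg : ∀ q ∈ M, ∀ (h : (ι → ℂ) → CoordSpace m d) (Θ : Fin d → ComplexifiedSpace m d → ℂ),
      IsLocallyRepresentedBy M q h Θ →
        ∀ k, genericRank (segreJet Θ k) (realPoint (h q)) = g k) :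
    degeneracySet M m d ℓ g ≠ M := by
  obtain ⟨p, hp⟩ := hne
  obtain ⟨h, Θ, H₀⟩ := hM.exists_isRepresentedBy hp hcard
  have H := H₀.isLocallyRepresentedBy
  have h1 : ∀ k : Fin (ℓ + 1), ∃ rs : (Fin (g k) → Fin m ⊕ Fin d × MultiIndex m k) ×
      (Fin (g k) → Fin m ⊕ (Fin m ⊕ Fin d)),
      ¬ ∀ᶠ y in 𝓝 (realPoint (h p)), jacobianMinor (segreJet Θ k) rs.1 rs.2 y = 0 := by
    intro k
    obtain ⟨r, s, hrs⟩ := (le_genericRank_iff_minor (analyticAt_segreJet H.regular k) (g k)).1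
      (hg p hp h Θ H k).ge
    exact ⟨(r, s), hrs⟩
  choose I hI using h1
  intro hEM
  have h2 : ∀ᶠ y in 𝓝 (realPoint (h p)), minorProduct Θ I y = 0 := by
    refine H.eventually_eq_zero hM hp ?_ ?_
    · exact (isComplexRegularAt_minorProduct (c := Regularity.analytic)
        (fun j => isComplexRegularAt_analytic_iff.2 (H.regular j)) I).1
    · filter_upwards [H.eventually] with x hx hxM
      have h3 : x ∈ degeneracySet M m d ℓ g := by rw [hEM]; exact hxM
      rw [hx.mem_degeneracySet_iff hM hxM, exists_rankAt_lt_iff_minorProduct hx.regular] at h3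
      exact h3 I
  obtain ⟨k, -, hk⟩ := eventually_eq_zero_of_prod Finset.univ
    (fun k : Fin (ℓ + 1) => analyticAt_jacobianMinor (analyticAt_segreJet H.regular k) (I k).1 (I k).2) h2
  exact hI k hk

end GlobalInvariants

/-! ### Straightening of the Segre kernels. -/

section Foliation

variable {m d : ℕ} {Θ : Fin d → ComplexifiedSpace m d → ℂ} {c : Regularity}

/-- `segreKer_succ_le` iterated on one open set; each step needs the two preceding kernels to agree
throughout it. -/
theorem eventually_forall_segreKer_eq {x : ComplexifiedSpace m d}
    (hΘ : ∀ j, AnalyticAt ℂ (Θ j) x) {ℓ b : ℕ}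
    (h0 : ∀ᶠ y in 𝓝 x, Module.finrank ℂ (segreKer Θ ℓ y) = b)
    (h1 : ∀ᶠ y in 𝓝 x, Module.finrank ℂ (segreKer Θ (ℓ + 1) y) = b) :
    ∀ᶠ y in 𝓝 x, ∀ n, segreKer Θ (ℓ + n) y = segreKer Θ ℓ y := by
  have hΘe : ∀ᶠ y in 𝓝 x, ∀ j, AnalyticAt ℂ (Θ j) y :=
    eventually_all.2 fun j => (hΘ j).eventually_analyticAt
  obtain ⟨V, hV, hVo, hxV⟩ := eventually_nhds_iff.1 (hΘe.and (h0.and h1))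
  have key : ∀ n, ∀ y ∈ V, segreKer Θ (ℓ + n) y = segreKer Θ ℓ y ∧
      segreKer Θ (ℓ + n + 1) y = segreKer Θ ℓ y := by
    intro n
    induction n with
    | zero =>
      intro y hy
      refine ⟨rfl, Submodule.eq_of_le_of_finrank_eq (segreKer_anti Θ y (Nat.le_succ ℓ)) ?_⟩
      exact (hV y hy).2.2.trans (hV y hy).2.1.symm
    | succ n ih =>
      intro y hy
      refine ⟨(ih y hy).2, ?_⟩
      have h2 := segreKer_succ_le (k := ℓ + n) (hV y hy).1
        ((ih y hy).1.trans (ih y hy).2.symm) (by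
          filter_upwards [hVo.mem_nhds hy] with z hz
          rw [(ih z hz).2, (ih y hy).2, (hV z hz).2.1, (hV y hy).2.1])
      rw [← (ih y hy).2]
      exact le_antisymm (segreKer_anti Θ y (Nat.le_succ (ℓ + n + 1))) h2
  filter_upwards [hVo.mem_nhds hxV] with y hy n
  exact (key n y hy).1

theorem analyticAt_segreMap {t : CoordSpace m d} (hΘ : ∀ j, AnalyticAt ℂ (Θ j) (tangentInr t))
    (k : ℕ) : AnalyticAt ℂ (segreMap Θ k) t :=
  analyticAt_pi_iff.2 fun jb => AnalyticAt.comp (g := jetCoeff Θ jb.1 jb.2)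
    (analyticAt_jetCoeff hΘ jb.1 jb.2) (tangentInr.analyticAt t)

theorem fderiv_segreMap_eq_zero_iff {t : CoordSpace m d}
    (hΘ : ∀ j, AnalyticAt ℂ (Θ j) (tangentInr t)) (k : ℕ) (v : CoordSpace m d) :
    fderiv ℂ (segreMap Θ k) t v = 0 ↔ v ∈ segreKer Θ k (tangentInr t) := by
  rw [mem_segreKer, ← fderiv_jetCoeff_eq_zero_iff hΘ]
  have h1 : ∀ (j : Fin d) (β : MultiIndex m k), fderiv ℂ (segreMap Θ k) t v (j, β) =
      fderiv ℂ (jetCoeff Θ j β) (tangentInr t) (tangentInr v) := by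
    intro j β
    rw [fderiv_apply_apply (analyticAt_segreMap hΘ k).differentiableAt]
    have h2 := fderiv_comp_apply' (g := jetCoeff Θ j β) (f := tangentInr (m := m) (d := d)) (x := t)
      (analyticAt_jetCoeff hΘ j β).differentiableAt tangentInr.differentiableAt v
    rw [ContinuousLinearMap.fderiv] at h2
    exact h2
  constructor
  · intro h j β
    rw [← h1, h]
    rfl
  · intro h
    ext ⟨j, β⟩
    rw [h1, h]
    rfl

theorem rankAt_segreMap_add_finrank {t : CoordSpace m d}
    (hΘ : ∀ j, AnalyticAt ℂ (Θ j) (tangentInr t)) (k : ℕ) :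
    rankAt (segreMap Θ k) t + Module.finrank ℂ (segreKer Θ k (tangentInr t)) = m + d := by
  have h1 : LinearMap.ker (fderiv ℂ (segreMap Θ k) t).toLinearMap =
      segreKer Θ k (tangentInr t) := by
    ext v
    exact fderiv_segreMap_eq_zero_iff hΘ k v
  have h2 := LinearMap.finrank_range_add_finrank_ker (fderiv ℂ (segreMap Θ k) t).toLinearMap
  rw [h1] at h2
  simpa [rankAt] using h2

/-- Coordinates in which the defining functions do not depend on the last variables. -/
theorem exists_straightening (hΘ : ∀ j, IsComplexRegularAt c (Θ j) 0) {ℓ a b : ℕ}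
    (hab : m + d = a + b)
    (h0 : ∀ᶠ y in 𝓝 (0 : ComplexifiedSpace m d), Module.finrank ℂ (segreKer Θ ℓ y) = b)
    (h1 : ∀ᶠ y in 𝓝 (0 : ComplexifiedSpace m d), Module.finrank ℂ (segreKer Θ (ℓ + 1) y) = b) :
    ∃ H : CoordSpace m d → CoordSpace a b, H 0 = 0 ∧
      (∀ i, IsComplexRegularAt c (fun t => H t i) 0) ∧ Function.Bijective (fderiv ℂ H 0) ∧
      ∃ ε > 0, ∀ ζ : Fin m → ℂ, ‖ζ‖ < ε → ∀ t t' : CoordSpace m d, ‖t‖ < ε → ‖t'‖ < ε →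
        (∀ i, H t (Sum.inl i) = H t' (Sum.inl i)) →
        ∀ j, Θ j (Sum.elim ζ t) = Θ j (Sum.elim ζ t') := by
  have hΘa : ∀ j, AnalyticAt ℂ (Θ j) 0 := fun j => (hΘ j).1
  have hT0 : tangentInr (0 : CoordSpace m d) = (0 : ComplexifiedSpace m d) := map_zero _
  have hTt : Tendsto (tangentInr (m := m) (d := d)) (𝓝 0) (𝓝 0) := by
    have := (tangentInr (m := m) (d := d)).continuous.tendsto 0
    rwa [hT0] at this
  set S := segreMap Θ ℓ
  have hS0 : AnalyticAt ℂ S 0 := analyticAt_segreMap (by rwa [hT0]) ℓ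
  have hrk := rankAt_segreMap_add_finrank (t := 0) (by rwa [hT0]) ℓ
  rw [hT0, h0.self_of_nhds] at hrk
  obtain ⟨B, C, -, hBC⟩ := exists_complementary_maps (r := a) (s := b)
    (fderiv ℂ S 0).toLinearMap (by change rankAt (segreMap Θ ℓ) 0 = a; omega) (by simp [hab])
  let J : ((Fin d × MultiIndex m ℓ → ℂ) × CoordSpace m d) →L[ℂ] CoordSpace a b :=
    LinearMap.toContinuousLinearMap
      { toFun := fun z => Sum.elim (B z.1) (C z.2)
        map_add' := fun u v => by ext (_ | _) <;> simp
        map_smul' := fun a v => by ext (_ | _) <;> simp }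
  have hJ : ∀ x v, J (x, v) = Sum.elim (B x) (C v) := fun x v => rfl
  -- The first a coordinates are independent combinations of the Segre mapping of order ℓ; `C`
  -- completes them linearly.
  let H : CoordSpace m d → CoordSpace a b := fun t => J (S t - S 0, t)
  have hHd : ∀ {t}, AnalyticAt ℂ S t → HasFDerivAt H
      (J ∘L ((fderiv ℂ S t).prod (ContinuousLinearMap.id ℂ _))) t := fun hS =>
    J.hasFDerivAt.comp _ ((hS.differentiableAt.hasFDerivAt.sub_const _).prodMk (hasFDerivAt_id _))
  have hHd' : ∀ {t}, AnalyticAt ℂ S t → ∀ v, fderiv ℂ H t v =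
      Sum.elim (B (fderiv ℂ S t v)) (C v) := fun hS v => by
    rw [(hHd hS).fderiv]
    rfl
  have hHa : AnalyticAt ℂ H 0 := (J.analyticAt _).comp
    ((hS0.sub analyticAt_const).prod analyticAt_id)
  have hH0 : H 0 = 0 := by
    simp only [H, sub_self]
    exact map_zero J
  have hHb : Function.Bijective (fderiv ℂ H 0) := by
    constructor
    · intro u v huv
      rw [hHd' hS0, hHd' hS0] at huv
      refine hBC.1 (Prod.ext (funext fun j => congrFun huv (Sum.inl j))
        (funext fun j => congrFun huv (Sum.inr j)))
    · intro t
      obtain ⟨v, hv⟩ := hBC.2 (fun j => t (Sum.inl j), fun j => t (Sum.inr j))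
      refine ⟨v, ?_⟩
      rw [hHd' hS0]
      ext (i | i)
      · exact congrFun (congrArg Prod.fst hv) i
      · exact congrFun (congrArg Prod.snd hv) i
  have hHreg : ∀ i, IsComplexRegularAt c (fun t => H t i) 0 := by
    rintro (i | i)
    · refine IsComplexRegularAt.comp (g := fun t => S t - S 0)
        (f := (ContinuousLinearMap.proj (R := ℂ) (φ := fun _ => ℂ) i).comp
          (LinearMap.toContinuousLinearMap B)) (isComplexRegularAt_clm _ _) fun jb => ?_
      have h2 : IsComplexRegularAt c (fun t => S t jb) 0 := by
        refine IsComplexRegularAt.comp (f := jetCoeff Θ jb.1 jb.2) (g := tangentInr)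
          (by rw [hT0]; exact IsComplexRegularAt.jetCoeff hΘ _ _) fun a => ?_
        exact isComplexRegularAt_clm
          ((ContinuousLinearMap.proj (R := ℂ) (φ := fun _ => ℂ) a).comp tangentInr) 0
      exact (complexRegularSubalgebra c _).sub_mem h2 (isComplexRegularAt_const (S 0 jb) 0)
    · exact isComplexRegularAt_clm ((ContinuousLinearMap.proj (R := ℂ) (φ := fun _ => ℂ) i).comp
          (LinearMap.toContinuousLinearMap C)) 0
  refine ⟨H, hH0, hHreg, hHb, ?_⟩
  have hΘe : ∀ᶠ y in 𝓝 (0 : ComplexifiedSpace m d), ∀ j, AnalyticAt ℂ (Θ j) y :=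
    eventually_all.2 fun j => (hΘa j).eventually_analyticAt
  obtain ⟨ε, hε, hball⟩ := Metric.eventually_nhds_iff_ball.1 hΘe
  -- the kernels along the fibers
  have hker : ∀ᶠ t in 𝓝 (0 : CoordSpace m d), ∀ v, (∀ i, fderiv ℂ H t v (Sum.inl i) = 0) →
      ∀ ζ : Fin m → ℂ, ‖ζ‖ < ε → ∀ j, fderiv ℂ (Θ j) (Sum.elim ζ t) (tangentInr v) = 0 := by
    filter_upwards [hTt.eventually hΘe, eventually_bijective_fderiv hHa hHb, hTt.eventually h0,
      hTt.eventually (eventually_forall_segreKer_eq hΘa h0 h1), Metric.ball_mem_nhds 0 hε]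
      with t a1 a2 a3 a4 a5 v hv ζ hζ j
    have hSt : AnalyticAt ℂ S t := analyticAt_segreMap a1 ℓ
    let BS := B ∘ₗ (fderiv ℂ S t).toLinearMap
    -- Both sides have dimension b near 0, so the tangent space of the fiber is the whole Segre
    -- kernel at ζ = 0.
    have hle : segreKer Θ ℓ (tangentInr t) ≤ LinearMap.ker BS := by
      intro u hu
      change B (fderiv ℂ S t u) = 0
      rw [(fderiv_segreMap_eq_zero_iff a1 ℓ u).2 hu, map_zero]
    have hsurj : LinearMap.range BS = ⊤ := by
      rw [LinearMap.range_eq_top]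
      intro s
      obtain ⟨u, hu⟩ := a2.2 (Sum.elim s fun _ => 0)
      rw [hHd' hSt] at hu
      exact ⟨u, funext fun i => congrFun hu (Sum.inl i)⟩
    have hfr := LinearMap.finrank_range_add_finrank_ker BS
    rw [hsurj, finrank_top] at hfr
    have hfr' : Module.finrank ℂ (segreKer Θ ℓ (tangentInr t)) =
        Module.finrank ℂ (LinearMap.ker BS) := by
      simp at hfr
      omega
    have hvk : v ∈ segreKer Θ ℓ (tangentInr t) := by
      rw [Submodule.eq_of_le_of_finrank_eq hle hfr']
      change B (fderiv ℂ S t v) = 0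
      ext i
      have := hv i
      rw [hHd' hSt] at this
      exact this
    have hmem : ∀ ξ : Fin m → ℂ, ‖ξ‖ < ε →
        (Sum.elim ξ t : ComplexifiedSpace m d) ∈ Metric.ball 0 ε := by
      intro ξ hξ
      rw [mem_ball_zero_iff, pi_norm_lt_iff hε]
      rintro (i | i)
      · exact (norm_le_pi_norm ξ i).trans_lt hξ
      · exact (norm_le_pi_norm t i).trans_lt (mem_ball_zero_iff.1 a5)
    let f : (Fin m → ℂ) → ℂ := fun ξ => fderiv ℂ (Θ j) (Sum.elim ξ t) (tangentInr v)
    have hf : ∀ ξ ∈ Metric.ball (0 : Fin m → ℂ) ε, AnalyticAt ℂ f ξ := by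
      intro ξ hξ
      exact AnalyticAt.comp (g := fun y => fderiv ℂ (Θ j) y (tangentInr v))
        (analyticAt_fderiv_apply (hball _ (hmem ξ (mem_ball_zero_iff.1 hξ)) j) _)
        (analyticAt_sumElim t ξ)
    -- v lies in the kernels of all orders, so its derivative of Θ_j vanishes to infinite order at ζ
    -- = 0; the identity theorem then covers the whole ball of ζ.
    have hf0 : ∀ᶠ ξ in 𝓝 (0 : Fin m → ℂ), f ξ = 0 := by
      refine eventually_eq_zero_of_forall_isBigO (𝕜 := ℂ) (hf 0 (Metric.mem_ball_self hε))
        fun n => ?_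
      have h2 : v ∈ segreKer Θ n (Sum.elim (0 : Fin m → ℂ) t) := by
        have h3 := hvk
        rw [← a4 n] at h3
        exact segreKer_anti Θ _ (Nat.le_add_left n ℓ) h3
      exact (mem_segreKer_iff_isBigO (fun j => hball _ (hmem 0 (by simpa using hε)) j) n v).1 h2 j
    exact eq_zero_of_mem_ball_of_eventually (𝕜 := ℂ) hf (Metric.mem_ball_self hε) hf0
      (mem_ball_zero_iff.2 hζ)
  obtain ⟨G, hG0, hG, hHG, hGH⟩ := exists_analytic_localInverse hHa hHb
  rw [hH0] at hG0 hG hHG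
  have hGt : Tendsto G (𝓝 0) (𝓝 0) := by
    have := hG.continuousAt.tendsto
    rwa [hG0] at this
  have hgood : ∀ᶠ y in 𝓝 (0 : CoordSpace a b), AnalyticAt ℂ G y ∧
      (∀ᶠ z in 𝓝 y, H (G z) = z) ∧ ‖G y‖ < ε ∧ AnalyticAt ℂ H (G y) ∧
      ∀ v, (∀ i, fderiv ℂ H (G y) v (Sum.inl i) = 0) →
      ∀ ζ : Fin m → ℂ, ‖ζ‖ < ε → ∀ j, fderiv ℂ (Θ j) (Sum.elim ζ (G y)) (tangentInr v) = 0 := by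
    have h2 : ∀ᶠ t in 𝓝 (0 : CoordSpace m d), ‖t‖ < ε := by
      filter_upwards [Metric.ball_mem_nhds (0 : CoordSpace m d) hε] with t ht
      exact mem_ball_zero_iff.1 ht
    filter_upwards [hG.eventually_analyticAt, hHG.eventually_nhds, hGt.eventually h2,
      hGt.eventually hHa.eventually_analyticAt, hGt.eventually hker] with y a1 a2 a3 a4 a5
    exact ⟨a1, a2, a3, a4, a5⟩
  obtain ⟨δ, hδ, hgood⟩ := Metric.eventually_nhds_iff_ball.1 hgood
  have hfin : ∀ᶠ t in 𝓝 (0 : CoordSpace m d), H t ∈ Metric.ball 0 δ ∧ G (H t) = t := by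
    have h2 : Tendsto H (𝓝 0) (𝓝 0) := by
      have := hHa.continuousAt.tendsto
      rwa [hH0] at this
    exact (h2.eventually (Metric.ball_mem_nhds 0 hδ)).and hGH
  obtain ⟨ε', hε', hfin⟩ := Metric.eventually_nhds_iff_ball.1 hfin
  refine ⟨min ε ε', lt_min hε hε', fun ζ hζ t t' ht ht' htt' j => ?_⟩
  have b1 := hfin t (mem_ball_zero_iff.2 (ht.trans_le (min_le_right _ _)))
  have b2 := hfin t' (mem_ball_zero_iff.2 (ht'.trans_le (min_le_right _ _)))
  have hζ' : ‖ζ‖ < ε := hζ.trans_le (min_le_left _ _)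
  let s : Fin a → ℂ := fun i => H t (Sum.inl i)
  -- Θ_j along one fiber, for fixed ζ: its differential is zero on a convex ball, so it is constant
  -- there.
  let f : (Fin b → ℂ) → ℂ := fun u => Θ j (Sum.elim ζ (G (Sum.elim s u)))
  have hs : ‖s‖ < δ := by
    rw [pi_norm_lt_iff hδ]
    exact fun i => (norm_le_pi_norm (H t) (Sum.inl i)).trans_lt (mem_ball_zero_iff.1 b1.1)
  have hmem : ∀ u : Fin b → ℂ, ‖u‖ < δ → (Sum.elim s u : CoordSpace a b) ∈ Metric.ball 0 δ := by
    intro u hu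
    rw [mem_ball_zero_iff, pi_norm_lt_iff hδ]
    rintro (i | i)
    · exact (norm_le_pi_norm s i).trans_lt hs
    · exact (norm_le_pi_norm u i).trans_lt hu
  have hfd : ∀ u ∈ Metric.ball (0 : Fin b → ℂ) δ, HasFDerivAt f (0 : (Fin b → ℂ) →L[ℂ] ℂ) u := by
    intro u hu
    obtain ⟨c1, c2, c3, c4, c5⟩ := hgood _ (hmem u (mem_ball_zero_iff.1 hu))
    set y : CoordSpace a b := Sum.elim s u
    have hsl : HasFDerivAt (fun u : Fin b → ℂ => (Sum.elim s u : CoordSpace a b))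
        (sliceInr (σ := Fin a)) u := by
      have h3 : (fun u : Fin b → ℂ => (Sum.elim s u : CoordSpace a b)) =
          fun u => sliceInr (σ := Fin a) u + Sum.elim s (fun _ => 0) := by
        ext u (i | i) <;> simp [sliceInr_apply]
      rw [h3]
      exact (sliceInr (σ := Fin a)).hasFDerivAt.add_const _
    have htan : HasFDerivAt (fun t : CoordSpace m d => (Sum.elim ζ t : ComplexifiedSpace m d))
        tangentInr (G y) := by
      have h3 : (fun t : CoordSpace m d => (Sum.elim ζ t : ComplexifiedSpace m d)) =
          fun t => tangentInr t + Sum.elim ζ (fun _ => 0) := by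
        ext u (i | i) <;> simp
      rw [h3]
      exact tangentInr.hasFDerivAt.add_const _
    have hpt : (Sum.elim ζ (G y) : ComplexifiedSpace m d) ∈ Metric.ball 0 ε := by
      rw [mem_ball_zero_iff, pi_norm_lt_iff hε]
      rintro (i | i)
      · exact (norm_le_pi_norm ζ i).trans_lt hζ'
      · exact (norm_le_pi_norm (G y) i).trans_lt c3
    have hΘd := (hball _ hpt j).differentiableAt.hasFDerivAt
    have hGd : HasFDerivAt (fun u : Fin b → ℂ => G (Sum.elim s u))
        ((fderiv ℂ G y) ∘L (sliceInr (σ := Fin a))) u :=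
      HasFDerivAt.comp (g := G) u c1.differentiableAt.hasFDerivAt hsl
    have hcomp : HasFDerivAt f (((fderiv ℂ (Θ j) (Sum.elim ζ (G y))) ∘L tangentInr) ∘L
        ((fderiv ℂ G y) ∘L (sliceInr (σ := Fin a)))) u :=
      HasFDerivAt.comp (g := fun t : CoordSpace m d => Θ j (Sum.elim ζ t)) u
        (HasFDerivAt.comp (g := Θ j) (G y) hΘd htan) hGd
    refine hcomp.congr_fderiv ?_
    ext1 μ
    change fderiv ℂ (Θ j) (Sum.elim ζ (G y)) (tangentInr (fderiv ℂ G y (sliceInr μ))) = 0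
    refine c5 _ (fun i => ?_) ζ hζ' j
    have h4 : fderiv ℂ (fun z => H (G z)) y = ContinuousLinearMap.id ℂ _ := by
      rw [EventuallyEq.fderiv_eq (f₁ := fun z => H (G z)) (f := id) c2, fderiv_id]
    rw [← fderiv_comp_apply' c4.differentiableAt c1.differentiableAt, h4]
    rfl
  have hconst : ∀ {u u' : Fin b → ℂ}, u ∈ Metric.ball 0 δ → u' ∈ Metric.ball 0 δ → f u = f u' :=
    fun hu hu' => Metric.isOpen_ball.is_const_of_fderiv_eq_zero (𝕜 := ℂ)
      (convex_ball (0 : Fin b → ℂ) δ).isPreconnected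
      (fun u hu => (hfd u hu).differentiableAt.differentiableWithinAt)
      (fun u hu => (hfd u hu).fderiv) hu hu'
  have hu : ∀ t : CoordSpace m d, H t ∈ Metric.ball (0 : CoordSpace a b) δ →
      (fun i => H t (Sum.inr i)) ∈ Metric.ball (0 : Fin b → ℂ) δ := by
    intro t ht
    rw [mem_ball_zero_iff, pi_norm_lt_iff hδ]
    exact fun i => (norm_le_pi_norm (H t) (Sum.inr i)).trans_lt (mem_ball_zero_iff.1 ht)
  have h5 := hconst (hu t b1.1) (hu t' b2.1)
  have h6 : (Sum.elim s fun i => H t (Sum.inr i)) = H t := by ext (i | i) <;> rfl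
  have h7 : (Sum.elim s fun i => H t' (Sum.inr i)) = H t' := by
    ext (i | i)
    · exact htt' i
    · rfl
  simp only [f, h6, h7, b1.2, b2.2] at h5
  exact h5

variable {ι : Type*} [Fintype ι] {M : Set (ι → ℂ)}

/-- A generic submanifold is invariant along the fibers of the straightening coordinates. -/
theorem IsRepresentedBy.exists_mem_iff {p : ι → ℂ} {h : (ι → ℂ) → CoordSpace m d}
    (HR : IsRepresentedBy c M p h Θ) (hM : IsGenericSubmanifold c d M) (hp : p ∈ M)
    {a b : ℕ} {H : CoordSpace m d → CoordSpace a b}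
    (hH : ∃ ε > 0, ∀ ζ : Fin m → ℂ, ‖ζ‖ < ε → ∀ t t' : CoordSpace m d, ‖t‖ < ε → ‖t'‖ < ε →
        (∀ i, H t (Sum.inl i) = H t' (Sum.inl i)) →
        ∀ j, Θ j (Sum.elim ζ t) = Θ j (Sum.elim ζ t')) :
    ∃ U ∈ 𝓝 p, ∀ x ∈ U, ∀ x' ∈ U, (∀ i, H (h x) (Sum.inl i) = H (h x') (Sum.inl i)) →
      (x ∈ M ↔ x' ∈ M) := by
  obtain ⟨ε, hε, hH⟩ := hH
  have hR := HR.isLocallyRepresentedBy.reality hM hp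
  rw [HR.center, map_zero] at hR
  obtain ⟨δ, hδ, hR⟩ := Metric.eventually_nhds_iff_ball.1 hR
  have hsmall : ∀ᶠ x in 𝓝 p, ‖h x‖ < min ε δ := by
    have h1 : Tendsto h (𝓝 p) (𝓝 0) := by
      have := HR.isLocallyRepresentedBy.analyticAt.continuousAt.tendsto
      rwa [HR.center] at this
    filter_upwards [h1.eventually (Metric.ball_mem_nhds 0 (lt_min hε hδ))] with x hx
    exact mem_ball_zero_iff.1 hx
  let cz : CoordSpace m d → (Fin m → ℂ) := fun t i => (starRingEnd ℂ) (t (Sum.inl i))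
  have hcz : ∀ (t : CoordSpace m d) {r : ℝ}, ‖t‖ < r → ‖cz t‖ < r := by
    intro t r ht
    rw [pi_norm_lt_iff ((norm_nonneg t).trans_lt ht)]
    intro i
    simp only [cz, RCLike.norm_conj]
    exact (norm_le_pi_norm t (Sum.inl i)).trans_lt ht
  -- Reality makes the polarized relation between t and t' symmetric.
  have hsymm : ∀ t t' : CoordSpace m d, ‖t‖ < min ε δ → ‖t'‖ < min ε δ →
      (∀ j, (starRingEnd ℂ) (t (Sum.inr j)) = Θ j (Sum.elim (cz t) t')) →
      ∀ j, (starRingEnd ℂ) (t' (Sum.inr j)) = Θ j (Sum.elim (cz t') t) := by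
    intro t t' ht ht' hA j
    have hy : (Sum.elim (cz t) t' : ComplexifiedSpace m d) ∈ Metric.ball 0 δ := by
      rw [mem_ball_zero_iff, pi_norm_lt_iff hδ]
      rintro (i | i)
      · exact (norm_le_pi_norm (cz t) i).trans_lt (hcz t (ht.trans_le (min_le_right _ _)))
      · exact (norm_le_pi_norm t' i).trans_lt (ht'.trans_le (min_le_right _ _))
    have h1 := hR _ hy j
    have h2 : conjugatePoint Θ (Sum.elim (cz t) t') = conjVec t := by
      ext (i | l)
      · rfl
      · exact (hA l).symm
    rw [h2] at h1
    have h3 : (Sum.elim (fun i => (Sum.elim (cz t) t' : ComplexifiedSpace m d)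
        (Sum.inr (Sum.inl i))) (conjVec t) : ComplexifiedSpace m d) =
        conjVec (Sum.elim (cz t') t) := by
      ext (i | i) <;> simp [cz]
    rw [h3, conjFun_conjVec] at h1
    have h4 := congrArg (starRingEnd ℂ) h1
    rw [Complex.conj_conj] at h4
    exact h4
  refine ⟨_, hsmall.and HR.equations, fun x hx x' hx' hxx' => ?_⟩
  have hx1 : ‖h x‖ < ε := hx.1.trans_le (min_le_left _ _)
  have hx1' : ‖h x'‖ < ε := hx'.1.trans_le (min_le_left _ _)
  rw [hx.2, hx'.2]
  have e1 := hH (cz (h x)) (hcz _ hx1) (h x) (h x') hx1 hx1' hxx'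
  have e2 := hH (cz (h x')) (hcz _ hx1') (h x') (h x) hx1' hx1 fun i => (hxx' i).symm
  -- Membership is the relation for (x, x). Fiber invariance changes the second entry, symmetry
  -- swaps, and fiber invariance applies again: (x, x), (x, x'), (x', x), (x', x').
  constructor
  · intro hA j
    refine (hsymm (h x) (h x') hx.1 hx'.1 (fun j => (hA j).trans (e1 j)) j).trans (e2 j).symm
  · intro hA j
    refine (hsymm (h x') (h x) hx'.1 hx.1 (fun j => (hA j).trans (e2 j)) j).trans (e1 j).symm

end Foliation

/-! ### Slices and the local product structure. -/

section LocalProduct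

variable {ι : Type*} [Fintype ι] {c : Regularity} {M : Set (ι → ℂ)} {d a b : ℕ}

/-- The slice of a generic submanifold which is invariant along the fibers of a chart. -/
theorem IsGenericSubmanifold.exists_slice (hM : IsGenericSubmanifold c d M)
    {P : (ι → ℂ) → CoordSpace a b} {g : CoordSpace a b → (ι → ℂ)} {ρ : ℝ} (hρ : 0 < ρ)
    (hg : ∀ y ∈ Metric.ball (0 : CoordSpace a b) ρ, ∀ i, IsComplexRegularAt c (fun z => g z i) y)
    (hP : ∀ y ∈ Metric.ball (0 : CoordSpace a b) ρ, AnalyticAt ℂ P (g y) ∧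
      Function.Bijective (fderiv ℂ P (g y)) ∧ ∀ᶠ z in 𝓝 y, P (g z) = z)
    (hinv : ∀ y ∈ Metric.ball (0 : CoordSpace a b) ρ, ∀ y' ∈ Metric.ball (0 : CoordSpace a b) ρ,
      (∀ i, y (Sum.inl i) = y' (Sum.inl i)) → g y ∈ M → g y' ∈ M) :
    IsGenericSubmanifold c d
      {s : Fin a → ℂ | ‖s‖ < ρ ∧ g (Sum.elim s fun _ => 0) ∈ M} := by
  rintro s₀ ⟨hs₀, hs₀M⟩
  have hball : ∀ (s : Fin a → ℂ) (u : Fin b → ℂ), ‖s‖ < ρ → ‖u‖ < ρ →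
      (Sum.elim s u : CoordSpace a b) ∈ Metric.ball 0 ρ := by
    intro s u hs hu
    rw [mem_ball_zero_iff, pi_norm_lt_iff hρ]
    rintro (i | i)
    · exact (norm_le_pi_norm s i).trans_lt hs
    · exact (norm_le_pi_norm u i).trans_lt hu
  set y₀ : CoordSpace a b := Sum.elim s₀ fun _ => 0 with hy₀
  have hy₀b : y₀ ∈ Metric.ball 0 ρ := hball s₀ 0 hs₀ (by simpa using hρ)
  obtain ⟨r, hr, hMr, hli, T, hT, hTJ⟩ := hM (g y₀) hs₀M
  obtain ⟨hPa, hPb, hPg⟩ := hP y₀ hy₀b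
  have hga : AnalyticAt ℂ g y₀ := analyticAt_pi_iff.2 fun i => (hg y₀ hy₀b i).1
  have hid : ∀ v, fderiv ℂ P (g y₀) (fderiv ℂ g y₀ v) = v := by
    intro v
    have h4 : fderiv ℂ (fun z => P (g z)) y₀ = ContinuousLinearMap.id ℂ _ := by
      rw [EventuallyEq.fderiv_eq (f₁ := fun z => P (g z)) (f := id) hPg, fderiv_id]
    rw [← fderiv_comp_apply' hPa.differentiableAt hga.differentiableAt, h4]
    rfl
  have hid' : ∀ v, fderiv ℂ g y₀ (fderiv ℂ P (g y₀) v) = v := fun v => hPb.1 (hid _)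
  let B : (ι → ℂ) →ₗ[ℂ] (Fin a → ℂ) :=
    { toFun := fun v i => fderiv ℂ P (g y₀) v (Sum.inl i)
      map_add' := fun u v => by ext i; simp
      map_smul' := fun z v => by ext i; simp }
  have hB : ∀ v i, B v i = fderiv ℂ P (g y₀) v (Sum.inl i) := fun v i => rfl
  -- the differentials along and across the slice
  have hgd : HasFDerivAt g ((fderiv ℂ g y₀).restrictScalars ℝ) y₀ :=
    hga.differentiableAt.hasFDerivAt.restrictScalars ℝ
  have hrd : ∀ j, HasFDerivAt (r j) (fderiv ℝ (r j) (g y₀)) (g y₀) := fun j =>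
    (hr j).1.differentiableAt.hasFDerivAt
  have hsd : ∀ j, HasFDerivAt (fun s : Fin a → ℂ => r j (g (Sum.elim s fun _ => 0)))
      ((fderiv ℝ (r j) (g y₀)) ∘L (((fderiv ℂ g y₀).restrictScalars ℝ) ∘L
        ((sliceInl (τ := Fin b)).restrictScalars ℝ))) s₀ := fun j =>
    HasFDerivAt.comp (g := r j) s₀ (hrd j) (HasFDerivAt.comp (g := g) s₀ hgd
      ((hasFDerivAt_sumElim (fun _ : Fin b => (0 : ℂ)) s₀).restrictScalars ℝ))
  have hsd' : ∀ j σ, fderiv ℝ (fun s : Fin a → ℂ => r j (g (Sum.elim s fun _ => 0))) s₀ σ =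
      fderiv ℝ (r j) (g y₀) (fderiv ℂ g y₀ (sliceInl σ)) := by
    intro j σ
    rw [(hsd j).fderiv]
    rfl
  -- The fiber through a point of M lies in M, so the r_j vanish along it. Their differentials
  -- therefore factor through `B`, which transfers independence and genericity to the slice.
  have hacross : ∀ j μ, fderiv ℝ (r j) (g y₀) (fderiv ℂ g y₀ (sliceInr μ)) = 0 := by
    intro j μ
    have hsl : HasFDerivAt (fun u : Fin b → ℂ => (Sum.elim s₀ u : CoordSpace a b))
        ((sliceInr (σ := Fin a)).restrictScalars ℝ) 0 := by
      have h3 : (fun u : Fin b → ℂ => (Sum.elim s₀ u : CoordSpace a b)) =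
          fun u => (sliceInr (σ := Fin a)).restrictScalars ℝ u + Sum.elim s₀ (fun _ => 0) := by
        ext u (i | i) <;> simp [sliceInr_apply]
      rw [h3]
      exact ((sliceInr (σ := Fin a)).restrictScalars ℝ).hasFDerivAt.add_const _
    have hud : HasFDerivAt (fun u : Fin b → ℂ => r j (g (Sum.elim s₀ u)))
        ((fderiv ℝ (r j) (g y₀)) ∘L (((fderiv ℂ g y₀).restrictScalars ℝ) ∘L
          ((sliceInr (σ := Fin a)).restrictScalars ℝ))) 0 :=
      HasFDerivAt.comp (g := r j) (0 : Fin b → ℂ) (hrd j)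
        (HasFDerivAt.comp (g := g) (0 : Fin b → ℂ) hgd hsl)
    have hz : (fun u : Fin b → ℂ => r j (g (Sum.elim s₀ u))) =ᶠ[𝓝 0] fun _ => 0 := by
      have hc : Tendsto (fun u : Fin b → ℂ => g (Sum.elim s₀ u)) (𝓝 0) (𝓝 (g y₀)) :=
        hgd.continuousAt.tendsto.comp hsl.continuousAt.tendsto
      filter_upwards [hc.eventually hMr, Metric.ball_mem_nhds 0 hρ] with u h1 h2
      refine h1.1 (hinv y₀ hy₀b _ (hball s₀ u hs₀ (mem_ball_zero_iff.1 h2)) (fun i => rfl)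
        hs₀M) j
    have h5 := hud.unique ((hasFDerivAt_const (0 : ℝ) (0 : Fin b → ℂ)).congr_of_eventuallyEq hz)
    exact DFunLike.congr_fun h5 μ
  have hsplit : ∀ v : CoordSpace a b,
      v = sliceInl (fun i => v (Sum.inl i)) + sliceInr (fun i => v (Sum.inr i)) := by
    intro v
    ext (i | i) <;> simp [sliceInl_apply, sliceInr_apply]
  have hrB : ∀ j v, fderiv ℝ (r j) (g y₀) v =
      fderiv ℝ (fun s : Fin a → ℂ => r j (g (Sum.elim s fun _ => 0))) s₀ (B v) := by
    intro j v
    rw [hsd']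
    conv_lhs => rw [← hid' v, hsplit (fderiv ℂ P (g y₀) v), map_add, map_add, hacross, add_zero]
    rfl
  refine ⟨fun j s => r j (g (Sum.elim s fun _ => 0)), fun j => ?_, ?_, ?_, ?_⟩
  · refine (hr j).comp (g := fun s : Fin a → ℂ => g (Sum.elim s fun _ => 0)) fun i => ?_
    refine IsComplexRegularAt.isMixedRegularAt (IsComplexRegularAt.comp (f := fun z => g z i)
      (g := fun s : Fin a → ℂ => (Sum.elim s fun _ => 0 : CoordSpace a b)) (hg y₀ hy₀b i)
      fun k => ?_)
    exact isComplexRegularAt_clm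
      ((ContinuousLinearMap.proj (R := ℂ) (φ := fun _ => ℂ) k).comp (sliceInl (τ := Fin b))) s₀
  · have hc : Tendsto (fun s : Fin a → ℂ => g (Sum.elim s fun _ => 0)) (𝓝 s₀) (𝓝 (g y₀)) :=
      hgd.continuousAt.tendsto.comp
        (hasFDerivAt_sumElim (fun _ : Fin b => (0 : ℂ)) s₀).continuousAt.tendsto
    have hn : ∀ᶠ s in 𝓝 s₀, ‖s‖ < ρ := continuous_norm.continuousAt.eventually_lt
      continuousAt_const hs₀
    filter_upwards [hc.eventually hMr, hn] with s h1 h2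
    rw [← h1]
    exact and_iff_right h2
  · rw [Fintype.linearIndependent_iff] at hli ⊢
    intro w hw
    refine hli w ?_
    ext v
    have := DFunLike.congr_fun hw (B v)
    simp only [_root_.sum_apply, _root_.smul_apply, _root_.zero_apply, hrB] at this ⊢
    exact this
  · refine ⟨{ carrier := {σ | ∀ j,
                fderiv ℝ (fun s : Fin a → ℂ => r j (g (Sum.elim s fun _ => 0))) s₀ σ = 0}
              zero_mem' := fun j => map_zero _
              add_mem' := fun {u v} hu hv j => by rw [map_add, hu j, hv j, add_zero]
              smul_mem' := fun z {v} hv j => by rw [map_smul, hv j, smul_zero] },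
      fun v => Iff.rfl, eq_top_iff.2 fun σ _ => ?_⟩
    have hv : fderiv ℂ g y₀ (sliceInl σ) ∈ T ⊔ T.map (complexStructure ι) := by
      rw [hTJ]
      trivial
    obtain ⟨t₁, ht₁, _, ⟨t₂, ht₂, rfl⟩, hsum⟩ := Submodule.mem_sup.1 hv
    have hBσ : B (fderiv ℂ g y₀ (sliceInl σ)) = σ := by
      ext i
      rw [hB, hid]
      rfl
    refine Submodule.mem_sup.2 ⟨B t₁, fun j => ?_, complexStructure (Fin a) (B t₂),
      Submodule.mem_map_of_mem fun j => ?_, ?_⟩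
    · rw [← hrB]
      exact (hT t₁).1 ht₁ j
    · rw [← hrB]
      exact (hT t₂).1 ht₂ j
    · rw [← hBσ, ← hsum, map_add]
      congr 1
      exact (map_smul B Complex.I t₂).symm

/-- A generic submanifold whose Segre kernels have locally constant dimension `b` at two
consecutive orders is locally the product of a generic submanifold by a `b`-dimensional
polydisc. -/
theorem IsRepresentedBy.exists_isLocalProductAt {m : ℕ} {p : ι → ℂ}
    {h : (ι → ℂ) → CoordSpace m d} {Θ : Fin d → ComplexifiedSpace m d → ℂ}
    (HR : IsRepresentedBy c M p h Θ) (hM : IsGenericSubmanifold c d M) (hp : p ∈ M) {ℓ : ℕ}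
    (hab : m + d = a + b)
    (h0 : ∀ᶠ y in 𝓝 (0 : ComplexifiedSpace m d), Module.finrank ℂ (segreKer Θ ℓ y) = b)
    (h1 : ∀ᶠ y in 𝓝 (0 : ComplexifiedSpace m d), Module.finrank ℂ (segreKer Θ (ℓ + 1) y) = b) :
    ∃ (P : (ι → ℂ) → CoordSpace a b) (M' : Set (Fin a → ℂ)), 0 ∈ M' ∧
      IsGenericSubmanifold c d M' ∧ IsLocalProductAt c M p P M' := by
  obtain ⟨H, hH0, hH, hHb, hHi⟩ := exists_straightening HR.regular hab h0 h1
  obtain ⟨V, hV, hVM⟩ := HR.exists_mem_iff hM hp hHi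
  have hHa : AnalyticAt ℂ H (h p) := by
    rw [HR.center]
    exact analyticAt_pi_iff.2 fun i => (hH i).1
  have hha : AnalyticAt ℂ h p := HR.isLocallyRepresentedBy.analyticAt
  set P : (ι → ℂ) → CoordSpace a b := fun x => H (h x)
  have hP0 : P p = 0 := by simp only [P, HR.center, hH0]
  have hPr : ∀ i, IsComplexRegularAt c (fun x => P x i) p := fun i =>
    IsComplexRegularAt.comp (f := fun t => H t i) (by rw [HR.center]; exact hH i) HR.coord.1
  have hPa : AnalyticAt ℂ P p := analyticAt_pi_iff.2 fun i => (hPr i).1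
  have hPb : Function.Bijective (fderiv ℂ P p) := by
    have h2 : ⇑(fderiv ℂ P p) = ⇑(fderiv ℂ H (h p)) ∘ ⇑(fderiv ℂ h p) := by
      ext1 v
      exact fderiv_comp_apply' hHa.differentiableAt hha.differentiableAt v
    rw [h2, HR.center]
    exact hHb.comp HR.coord.2
  obtain ⟨g, hg0, hg, hPg, hgP⟩ := exists_regular_localInverse hPr hPb
  rw [hP0] at hg0 hg hPg
  have hga : AnalyticAt ℂ g 0 := analyticAt_pi_iff.2 fun i => (hg i).1
  have hgood : ∀ᶠ x in 𝓝 p, IsLocalBiholomorphismAt c P x ∧ g (P x) = x ∧ x ∈ V :=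
    ((eventually_all.2 fun i => (hPr i).eventually).and
      (eventually_bijective_fderiv hPa hPb)).and (hgP.and hV)
  obtain ⟨W, hWgood, hWo, hpW⟩ := eventually_nhds_iff.1 hgood
  have hgW : ∀ᶠ y in 𝓝 (0 : CoordSpace a b), (∀ i, IsComplexRegularAt c (fun z => g z i) y) ∧
      (∀ᶠ z in 𝓝 y, P (g z) = z) ∧ g y ∈ W := by
    refine (eventually_all.2 fun i => (hg i).eventually).and (hPg.eventually_nhds.and ?_)
    exact hga.continuousAt.eventually (hWo.mem_nhds (by rwa [hg0]))
  obtain ⟨ρ, hρ, hgW⟩ := Metric.eventually_nhds_iff_ball.1 hgW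
  have hPana : ∀ x ∈ W, AnalyticAt ℂ P x := fun x hx =>
    analyticAt_pi_iff.2 fun i => ((hWgood x hx).1.1 i).1
  have hPgy : ∀ y ∈ Metric.ball (0 : CoordSpace a b) ρ, P (g y) = y := fun y hy =>
    (hgW y hy).2.1.self_of_nhds
  have hinv : ∀ x ∈ W, ∀ x' ∈ W, (∀ i, P x (Sum.inl i) = P x' (Sum.inl i)) →
      (x ∈ M ↔ x' ∈ M) := fun x hx x' hx' =>
    hVM x (hWgood x hx).2.2 x' (hWgood x' hx').2.2
  have hslice : ∀ y ∈ Metric.ball (0 : CoordSpace a b) ρ,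
      ‖fun i => y (Sum.inl i)‖ < ρ ∧ (fun i => y (Sum.inr i)) ∈ Metric.ball (0 : Fin b → ℂ) ρ ∧
      (Sum.elim (fun i => y (Sum.inl i)) fun _ => 0 : CoordSpace a b) ∈ Metric.ball 0 ρ := by
    intro y hy
    rw [mem_ball_zero_iff] at hy
    have h3 : ‖fun i => y (Sum.inl i)‖ < ρ := (pi_norm_lt_iff hρ).2 fun i =>
      (norm_le_pi_norm y (Sum.inl i)).trans_lt hy
    refine ⟨h3, mem_ball_zero_iff.2 ((pi_norm_lt_iff hρ).2 fun i =>
      (norm_le_pi_norm y (Sum.inr i)).trans_lt hy), ?_⟩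
    rw [mem_ball_zero_iff, pi_norm_lt_iff hρ]
    rintro (i | i)
    · exact (norm_le_pi_norm y (Sum.inl i)).trans_lt hy
    · simpa using hρ
  -- M' is the slice with fiber coordinate 0, and the neighborhood is cut to the preimage of a ball
  -- so that its image is a full polydisc.
  refine ⟨P, {s | ‖s‖ < ρ ∧ g (Sum.elim s fun _ => 0) ∈ M}, ⟨by simpa using hρ, ?_⟩,
    hM.exists_slice hρ (fun y hy => (hgW y hy).1) (fun y hy => ⟨hPana _ (hgW y hy).2.2,
      (hWgood _ (hgW y hy).2.2).1.2, (hgW y hy).2.1⟩) (fun y hy y' hy' hyy' hyM => ?_),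
    hP0, W ∩ P ⁻¹' Metric.ball 0 ρ, ρ, ?_, ⟨hpW, ?_⟩, hρ, fun x hx => (hWgood x hx.1).1,
    ?_, ?_, ?_⟩
  · have : (Sum.elim 0 fun _ => 0 : CoordSpace a b) = 0 := by ext (i | i) <;> rfl
    rw [this, hg0]
    exact hp
  · refine (hinv _ (hgW y hy).2.2 _ (hgW y' hy').2.2 ?_).1 hyM
    rw [hPgy y hy, hPgy y' hy']
    exact hyy'
  · exact ContinuousOn.isOpen_inter_preimage
      (fun x hx => (hPana x hx).continuousAt.continuousWithinAt) hWo Metric.isOpen_ball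
  · rw [Set.mem_preimage, hP0]
    exact Metric.mem_ball_self hρ
  · intro x hx x' hx' hxx'
    rw [← (hWgood x hx.1).2.1, hxx', (hWgood x' hx'.1).2.1]
  · ext y
    constructor
    · rintro ⟨x, hx, rfl⟩
      exact hx.2
    · intro hy
      exact ⟨g y, ⟨(hgW y hy).2.2, by rw [Set.mem_preimage, hPgy y hy]; exact hy⟩, hPgy y hy⟩
  · have hkey : ∀ y ∈ Metric.ball (0 : CoordSpace a b) ρ, ∀ x ∈ W, P x = y →
        (x ∈ M ↔ g (Sum.elim (fun i => y (Sum.inl i)) fun _ => 0) ∈ M) := by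
      intro y hy x hx hxy
      refine hinv x hx _ (hgW _ (hslice y hy).2.2).2.2 fun i => ?_
      rw [hPgy _ (hslice y hy).2.2, hxy]
      rfl
    ext y
    constructor
    · rintro ⟨x, ⟨hxM, hxW, hxρ⟩, rfl⟩
      obtain ⟨e1, e2, e3⟩ := hslice _ hxρ
      exact ⟨⟨e1, (hkey _ hxρ x hxW rfl).1 hxM⟩, e2⟩
    · rintro ⟨⟨e1, e3⟩, e2⟩
      have hy : y ∈ Metric.ball (0 : CoordSpace a b) ρ := by
        rw [mem_ball_zero_iff, pi_norm_lt_iff hρ]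
        rintro (i | i)
        · exact (norm_le_pi_norm (fun i => y (Sum.inl i)) i).trans_lt e1
        · exact (norm_le_pi_norm (fun i => y (Sum.inr i)) i).trans_lt (mem_ball_zero_iff.1 e2)
      refine ⟨g y, ⟨(hkey y hy _ (hgW y hy).2.2 (hPgy y hy)).2 e3, (hgW y hy).2.2, ?_⟩,
        hPgy y hy⟩
      rw [Set.mem_preimage, hPgy y hy]
      exact hy

end LocalProduct

/-! ### Representations with dummy variables. -/

section Extension

variable {m b d : ℕ}

/-- Adjoin `b` further variables to the first group of coordinates. -/
def adjoinCoord : (CoordSpace m d × (Fin b → ℂ)) →L[ℂ] CoordSpace (m + b) d :=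
  LinearMap.toContinuousLinearMap
    { toFun := fun z => Sum.elim (Fin.append (fun i => z.1 (Sum.inl i)) z.2)
        fun j => z.1 (Sum.inr j)
      map_add' := fun u v => by
        ext (i | i)
        · refine Fin.addCases (fun i => ?_) (fun i => ?_) i <;> simp
        · simp
      map_smul' := fun a v => by
        ext (i | i)
        · refine Fin.addCases (fun i => ?_) (fun i => ?_) i <;> simp
        · simp }

theorem adjoinCoord_apply (z : CoordSpace m d × (Fin b → ℂ)) :
    adjoinCoord z = Sum.elim (Fin.append (fun i => z.1 (Sum.inl i)) z.2)
      fun j => z.1 (Sum.inr j) := rfl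

/-- Forget the adjoined variables. -/
def forgetCoord : CoordSpace (m + b) d →L[ℂ] CoordSpace m d :=
  LinearMap.toContinuousLinearMap
    (LinearMap.funLeft ℂ ℂ (Sum.map (Fin.castAdd b) id))

/-- Forget the adjoined variables and their conjugates. -/
def forgetComplexified : ComplexifiedSpace (m + b) d →L[ℂ] ComplexifiedSpace m d :=
  LinearMap.toContinuousLinearMap
    (LinearMap.funLeft ℂ ℂ (Sum.map (Fin.castAdd b) (Sum.map (Fin.castAdd b) id)))

theorem forgetComplexified_sumElim (ζ : Fin (m + b) → ℂ) (t : CoordSpace (m + b) d) :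
    forgetComplexified (Sum.elim ζ t) =
      Sum.elim (ζ ∘ Fin.castAdd b) (forgetCoord t) := by
  ext (i | i | i) <;> rfl

theorem forgetComplexified_tangentInr (v : CoordSpace (m + b) d) :
    forgetComplexified (tangentInr v) = tangentInr (forgetCoord v) := by
  ext (i | i | i) <;> rfl

theorem forgetComplexified_realPoint_adjoinCoord (z : CoordSpace m d × (Fin b → ℂ)) :
    forgetComplexified (realPoint (adjoinCoord z)) = realPoint z.1 := by
  ext (i | i | i)
  · change (starRingEnd ℂ) (Fin.append (fun i => z.1 (Sum.inl i)) z.2 (Fin.castAdd b i)) = _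
    rw [Fin.append_left]
    rfl
  · change Fin.append (fun i => z.1 (Sum.inl i)) z.2 (Fin.castAdd b i) = _
    rw [Fin.append_left]
    rfl
  · rfl

theorem forgetCoord_surjective :
    Function.Surjective (forgetCoord : CoordSpace (m + b) d →L[ℂ] CoordSpace m d) := by
  intro v
  refine ⟨adjoinCoord (v, 0), ?_⟩
  ext (i | i)
  · change Fin.append (fun i => v (Sum.inl i)) 0 (Fin.castAdd b i) = _
    rw [Fin.append_left]
  · rfl

/-- Defining functions, regarded as functions of more variables. -/
def extendTheta (b : ℕ) (Θ : Fin d → ComplexifiedSpace m d → ℂ) :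
    Fin d → ComplexifiedSpace (m + b) d → ℂ :=
  fun j y => Θ j (forgetComplexified y)

variable {Θ : Fin d → ComplexifiedSpace m d → ℂ} {y : ComplexifiedSpace (m + b) d}

theorem analyticAt_extendTheta {j : Fin d} (hΘ : AnalyticAt ℂ (Θ j) (forgetComplexified y)) :
    AnalyticAt ℂ (extendTheta b Θ j) y :=
  AnalyticAt.comp (g := Θ j) hΘ (forgetComplexified.analyticAt y)

/-- Nothing depends on the added ζ-variables. Freezing them restricts the vanishing estimate, and
forgetting them does not increase norms. -/
theorem mem_segreKer_extendTheta_iff (hΘ : ∀ j, AnalyticAt ℂ (Θ j) (forgetComplexified y))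
    (k : ℕ) (v : CoordSpace (m + b) d) :
    v ∈ segreKer (extendTheta b Θ) k y ↔ forgetCoord v ∈ segreKer Θ k (forgetComplexified y) := by
  obtain ⟨ζ, t, rfl⟩ : ∃ (ζ : Fin (m + b) → ℂ) (t : CoordSpace (m + b) d), y = Sum.elim ζ t :=
    ⟨fun i => y (Sum.inl i), fun i => y (Sum.inr i), by ext (i | i) <;> rfl⟩
  rw [mem_segreKer_iff_isBigO fun j => analyticAt_extendTheta (hΘ j)]
  rw [forgetComplexified_sumElim] at hΘ ⊢
  rw [mem_segreKer_iff_isBigO hΘ]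
  refine forall_congr' fun j => ?_
  set ζ' : Fin m → ℂ := ζ ∘ Fin.castAdd b
  have hπ : Continuous fun ξ : Fin (m + b) → ℂ => (ξ ∘ Fin.castAdd b : Fin m → ℂ) :=
    continuous_pi fun i => continuous_apply _
  have hslice : Tendsto (fun ξ : Fin m → ℂ => (Sum.elim ξ (forgetCoord t) :
      ComplexifiedSpace m d)) (𝓝 ζ') (𝓝 (Sum.elim ζ' (forgetCoord t))) :=
    (analyticAt_sumElim (forgetCoord t) ζ').continuousAt.tendsto
  have hF : (fun ξ : Fin (m + b) → ℂ =>
        fderiv ℂ (extendTheta b Θ j) (Sum.elim ξ t) (tangentInr v)) =ᶠ[𝓝 ζ]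
      fun ξ => fderiv ℂ (Θ j) (Sum.elim (ξ ∘ Fin.castAdd b) (forgetCoord t))
        (tangentInr (forgetCoord v)) := by
    filter_upwards [(hslice.comp (hπ.tendsto ζ)).eventually (hΘ j).eventually_analyticAt] with ξ hξ
    have hξ' : AnalyticAt ℂ (Θ j) (forgetComplexified (Sum.elim ξ t)) := by
      rw [forgetComplexified_sumElim]
      exact hξ
    rw [← forgetComplexified_sumElim, ← forgetComplexified_tangentInr]
    have h2 := fderiv_comp_apply' (x := Sum.elim ξ t) hξ'.differentiableAt
      (forgetComplexified (m := m) (b := b) (d := d)).differentiableAt (tangentInr v)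
    rw [ContinuousLinearMap.fderiv] at h2
    exact h2
  rw [Asymptotics.isBigO_congr hF EventuallyEq.rfl]
  constructor
  · intro hO
    let s : (Fin m → ℂ) → (Fin (m + b) → ℂ) := fun ξ =>
      Fin.append ξ (ζ ∘ Fin.natAdd m)
    have hs : s ζ' = ζ := by
      ext i
      refine Fin.addCases (fun i => ?_) (fun i => ?_) i <;> simp [s, ζ']
    have hsc : Continuous s := by
      refine continuous_pi fun i => ?_
      refine Fin.addCases (fun i => ?_) (fun i => ?_) i
      · simpa [s] using continuous_apply i
      · simpa [s] using continuous_const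
    have hst : Tendsto s (𝓝 ζ') (𝓝 ζ) := by
      have := hsc.tendsto ζ'
      rwa [hs] at this
    have h2 := hO.comp_tendsto hst
    refine (Asymptotics.IsBigO.congr_left h2 fun ξ => ?_).trans
      (Asymptotics.isBigO_of_le _ fun ξ => ?_)
    · have : s ξ ∘ Fin.castAdd b = ξ := by
        ext i
        simp [s]
      simp only [Function.comp_apply, this]
    · simp only [Function.comp_apply, norm_pow, norm_norm]
      gcongr
      refine (pi_norm_le_iff_of_nonneg (norm_nonneg _)).2 fun i => ?_
      refine Fin.addCases (fun i => ?_) (fun i => ?_) i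
      · simpa [s, ζ'] using norm_le_pi_norm (ξ - ζ') i
      · simp [s]
  · intro hO
    have h2 := hO.comp_tendsto (hπ.tendsto ζ)
    refine h2.trans (Asymptotics.isBigO_of_le _ fun ξ => ?_)
    simp only [Function.comp_apply, norm_pow, norm_norm]
    gcongr
    refine (pi_norm_le_iff_of_nonneg (norm_nonneg _)).2 fun i => ?_
    exact norm_le_pi_norm (ξ - ζ) (Fin.castAdd b i)

/-- The larger kernel is the preimage of the smaller one under the surjection forgetting b
variables. -/
theorem finrank_segreKer_extendTheta (hΘ : ∀ j, AnalyticAt ℂ (Θ j) (forgetComplexified y))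
    (k : ℕ) : Module.finrank ℂ (segreKer (extendTheta b Θ) k y) =
      Module.finrank ℂ (segreKer Θ k (forgetComplexified y)) + b := by
  set Q := segreKer Θ k (forgetComplexified y)
  let f := Q.mkQ ∘ₗ (forgetCoord (m := m) (b := b) (d := d)).toLinearMap
  have hker : LinearMap.ker f = segreKer (extendTheta b Θ) k y := by
    ext v
    rw [mem_segreKer_extendTheta_iff hΘ, LinearMap.mem_ker]
    exact Submodule.Quotient.mk_eq_zero Q
  have hran : LinearMap.range f = ⊤ :=
    LinearMap.range_eq_top.2 ((Submodule.mkQ_surjective Q).comp forgetCoord_surjective)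
  have h1 := LinearMap.finrank_range_add_finrank_ker f
  have h2 := Submodule.finrank_quotient_add_finrank Q
  rw [hker, hran, finrank_top] at h1
  simp only [Module.finrank_fintype_fun_eq_card, Fintype.card_sum, Fintype.card_fin] at h1 h2
  omega

theorem rankAt_segreJet_extendTheta (hΘ : ∀ j, AnalyticAt ℂ (Θ j) (forgetComplexified y))
    (k : ℕ) : rankAt (segreJet (extendTheta b Θ) k) y =
      rankAt (segreJet Θ k) (forgetComplexified y) + b := by
  have h1 := rankAt_segreJet_add_finrank hΘ k
  have h2 := rankAt_segreJet_add_finrank (Θ := extendTheta b Θ)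
    (fun j => analyticAt_extendTheta (hΘ j)) k
  rw [finrank_segreKer_extendTheta hΘ] at h2
  omega

theorem genericRank_segreJet_extendTheta (hΘ : ∀ j, AnalyticAt ℂ (Θ j) 0) (k : ℕ) :
    genericRank (segreJet (extendTheta b Θ) k) 0 = genericRank (segreJet Θ k) 0 + b := by
  have hT : Tendsto (forgetComplexified (m := m) (b := b) (d := d)) (𝓝 0) (𝓝 0) := by
    have := (forgetComplexified (m := m) (b := b) (d := d)).continuous.tendsto 0
    rwa [map_zero] at this
  have hev : ∀ᶠ y in 𝓝 (0 : ComplexifiedSpace m d), ∀ j, AnalyticAt ℂ (Θ j) y :=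
    eventually_all.2 fun j => (hΘ j).eventually_analyticAt
  -- A continuous section through the origin, so points near 0 in either space give points near 0 in
  -- the other.
  obtain ⟨s, hs, hs0⟩ : ∃ s : ComplexifiedSpace m d → ComplexifiedSpace (m + b) d,
      (∀ y, forgetComplexified (s y) = y) ∧ Tendsto s (𝓝 0) (𝓝 0) := by
    let s : ComplexifiedSpace m d → ComplexifiedSpace (m + b) d := fun y =>
      Sum.elim (Fin.append (fun i => y (Sum.inl i)) 0)
        (Sum.elim (Fin.append (fun i => y (Sum.inr (Sum.inl i))) 0) fun j => y (Sum.inr (Sum.inr j)))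
    refine ⟨s, fun y => ?_, ?_⟩
    · ext (i | i | i)
      · exact Fin.append_left (fun i => y (Sum.inl i)) 0 i
      · exact Fin.append_left (fun i => y (Sum.inr (Sum.inl i))) 0 i
      · rfl
    · have h0 : s 0 = 0 := by
        ext (i | i | i)
        · refine Fin.addCases (fun i => ?_) (fun i => ?_) i <;> simp [s]
        · refine Fin.addCases (fun i => ?_) (fun i => ?_) i <;> simp [s]
        · rfl
      have hc : Continuous s := by
        refine continuous_pi ?_
        rintro (i | i | i)
        · refine Fin.addCases (fun i => ?_) (fun i => ?_) i
          · simpa [s] using continuous_apply _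
          · simpa [s] using continuous_const
        · refine Fin.addCases (fun i => ?_) (fun i => ?_) i
          · simpa [s] using continuous_apply _
          · simpa [s] using continuous_const
        · exact continuous_apply _
      have := hc.tendsto 0
      rwa [h0] at this
  refine le_antisymm ?_ ?_
  · have h1 := (le_genericRank_iff (f := segreJet (extendTheta b Θ) k) (x := 0) _).1 le_rfl
    have h2 : genericRank (segreJet (extendTheta b Θ) k) 0 - b ≤ genericRank (segreJet Θ k) 0 := by
      rw [le_genericRank_iff]
      refine hT.frequently ((h1.and_eventually (hT.eventually hev)).mono fun y hy => ?_)
      have := rankAt_segreJet_extendTheta hy.2 k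
      omega
    omega
  · rw [le_genericRank_iff]
    have h1 := (le_genericRank_iff (f := segreJet Θ k) (x := 0) _).1 le_rfl
    refine hs0.frequently ((h1.and_eventually hev).mono fun y hy => ?_)
    rw [rankAt_segreJet_extendTheta (by rw [hs]; exact hy.2), hs]
    omega

variable {ι : Type*} [Fintype ι] {c : Regularity} {M : Set (ι → ℂ)} {a : ℕ}

/-- A representation of the first factor of a local product induces one of the product. -/
theorem IsLocalProductAt.isLocallyRepresentedBy {p : ι → ℂ} {P : (ι → ℂ) → CoordSpace a b}
    {M' : Set (Fin a → ℂ)} (HP : IsLocalProductAt c M p P M')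
    {h : (Fin a → ℂ) → CoordSpace m d} (H : IsRepresentedBy c M' 0 h Θ) :
    ∃ H' : (ι → ℂ) → CoordSpace (m + b) d, H' p = 0 ∧
      IsLocallyRepresentedBy M p H' (extendTheta b Θ) := by
  obtain ⟨hP0, U, ρ, hU, hpU, hρ, hbih, hinj, hball, himg⟩ := HP
  have hPa : AnalyticAt ℂ P p := analyticAt_pi_iff.2 fun i => ((hbih p hpU).1 i).1
  have hPb := (hbih p hpU).2
  let prl : CoordSpace a b →L[ℂ] (Fin a → ℂ) :=
    LinearMap.toContinuousLinearMap (LinearMap.funLeft ℂ ℂ Sum.inl)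
  let prr : CoordSpace a b →L[ℂ] (Fin b → ℂ) :=
    LinearMap.toContinuousLinearMap (LinearMap.funLeft ℂ ℂ Sum.inr)
  have hl0 : prl (P p) = 0 := by rw [hP0, map_zero]
  have hr0 : prr (P p) = 0 := by rw [hP0, map_zero]
  have hha : AnalyticAt ℂ h (prl (P p)) := by
    rw [hl0]
    exact H.isLocallyRepresentedBy.analyticAt
  have hla : AnalyticAt ℂ (fun x => prl (P x)) p :=
    AnalyticAt.comp (g := prl) (prl.analyticAt _) hPa
  have hra : AnalyticAt ℂ (fun x => prr (P x)) p :=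
    AnalyticAt.comp (g := prr) (prr.analyticAt _) hPa
  have hhla : AnalyticAt ℂ (fun x => h (prl (P x))) p := AnalyticAt.comp (g := h) hha hla
  have hd : HasFDerivAt (fun x => adjoinCoord (h (prl (P x)), prr (P x)))
      (adjoinCoord ∘L (((fderiv ℂ h (prl (P p))) ∘L (prl ∘L fderiv ℂ P p)).prod
        (prr ∘L fderiv ℂ P p))) p := by
    have d1 := hPa.differentiableAt.hasFDerivAt
    have d2 : HasFDerivAt (fun x => prl (P x)) (prl ∘L fderiv ℂ P p) p :=
      prl.hasFDerivAt.comp p d1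
    have d3 : HasFDerivAt (fun x => prr (P x)) (prr ∘L fderiv ℂ P p) p :=
      prr.hasFDerivAt.comp p d1
    have d4 : HasFDerivAt (fun x => h (prl (P x)))
        ((fderiv ℂ h (prl (P p))) ∘L (prl ∘L fderiv ℂ P p)) p :=
      HasFDerivAt.comp (g := h) p hha.differentiableAt.hasFDerivAt d2
    exact adjoinCoord.hasFDerivAt.comp p (d4.prodMk d3)
  have hzero : adjoinCoord (h (prl (P p)), prr (P p)) = (0 : CoordSpace (m + b) d) := by
    rw [hl0, hr0, H.center]
    exact map_zero adjoinCoord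
  have hadj : ∀ z : CoordSpace m d × (Fin b → ℂ), adjoinCoord z = 0 → z = 0 := by
    intro z hz
    refine Prod.ext ?_ ?_
    · ext (i | i)
      · have := congrFun hz (Sum.inl (Fin.castAdd b i))
        simpa [adjoinCoord_apply] using this
      · exact congrFun hz (Sum.inr i)
    · ext i
      have := congrFun hz (Sum.inl (Fin.natAdd m i))
      simpa [adjoinCoord_apply] using this
  refine ⟨fun x => adjoinCoord (h (prl (P x)), prr (P x)), hzero, ?_, ?_, ?_, ?_⟩
  · exact AnalyticAt.comp (g := adjoinCoord) (adjoinCoord.analyticAt _) (hhla.prod hra)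
  · have hi : Function.Injective
        (fderiv ℂ (fun x => adjoinCoord (h (prl (P x)), prr (P x))) p).toLinearMap := by
      rw [← LinearMap.ker_eq_bot, LinearMap.ker_eq_bot']
      intro v hv
      rw [hd.fderiv] at hv
      have h1 := hadj _ hv
      have h2 : fderiv ℂ h (prl (P p)) (prl (fderiv ℂ P p v)) = 0 := congrArg Prod.fst h1
      have h3 : prr (fderiv ℂ P p v) = 0 := congrArg Prod.snd h1
      rw [hl0] at h2
      have h4 : prl (fderiv ℂ P p v) = 0 := H.coord.2.1 (h2.trans (map_zero _).symm)
      refine hPb.1 ?_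
      rw [map_zero]
      ext (i | i)
      · exact congrFun h4 i
      · exact congrFun h3 i
    refine ⟨hi, (LinearMap.injective_iff_surjective_of_finrank_eq_finrank ?_).1 hi⟩
    have e1 := (LinearEquiv.ofBijective (fderiv ℂ P p).toLinearMap hPb).finrank_eq
    have e2 := H.isLocallyRepresentedBy.card_eq
    simp only [Module.finrank_fintype_fun_eq_card, Fintype.card_sum, Fintype.card_fin] at e1 e2 ⊢
    omega
  · intro j
    refine analyticAt_extendTheta ?_
    rw [hzero, map_zero, map_zero]
    exact (H.regular j).1
  · have hmem : ∀ x ∈ U, (x ∈ M ↔ prl (P x) ∈ M') := by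
      intro x hx
      have hPx : P x ∈ Metric.ball 0 ρ := hball ▸ Set.mem_image_of_mem P hx
      constructor
      · intro hxM
        have : P x ∈ P '' (M ∩ U) := ⟨x, ⟨hxM, hx⟩, rfl⟩
        rw [himg] at this
        exact this.1
      · intro hxM
        have : P x ∈ P '' (M ∩ U) := by
          rw [himg]
          refine ⟨hxM, mem_ball_zero_iff.2 ((pi_norm_lt_iff hρ).2 fun i =>
            (norm_le_pi_norm (P x) (Sum.inr i)).trans_lt (mem_ball_zero_iff.1 hPx))⟩
        obtain ⟨x', ⟨hx'M, hx'U⟩, hxx'⟩ := this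
        rwa [← hinj hx'U hx hxx']
    have hl : Tendsto (fun x => prl (P x)) (𝓝 p) (𝓝 0) := by
      have := hla.continuousAt.tendsto
      rwa [hl0] at this
    filter_upwards [hU.mem_nhds hpU, hl.eventually H.equations] with x h1 h2
    rw [hmem x h1, h2]
    refine forall_congr' fun j => ?_
    simp only [extendTheta, forgetComplexified_realPoint_adjoinCoord]
    rfl

end Extension

/-! ### The stable rank sequence and the structure off the exceptional set. -/

section Stabilization

/-- A bounded monotone sequence which is constant as soon as it repeats a value stabilizes
after at most as many steps as its total growth. -/
theorem exists_stabilization {g : ℕ → ℕ} (hg : Monotone g) {N : ℕ} (hN : ∀ k, g k ≤ N)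
    (hstep : ∀ k, g (k + 1) = g k → g (k + 2) = g (k + 1)) :
    ∃ ℓ, IsLeast {k | g (k + 1) = g k} ℓ ∧ (∀ k ≥ ℓ, g k = g ℓ) ∧ (∀ k < ℓ, g k < g ℓ) ∧
      g 0 + ℓ ≤ g ℓ := by
  have hex : ∃ k, g (k + 1) = g k := by
    by_contra! hcon
    have h1 : StrictMono g := strictMono_nat_of_lt_succ fun k =>
      lt_of_le_of_ne (hg (Nat.le_succ k)) (hcon k).symm
    exact absurd (hN (N + 1)) (by have := h1.id_le (N + 1); simp at this; omega)
  have hspec := Nat.find_spec hex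
  have hmin := fun k => Nat.find_min hex (m := k)
  set ℓ := Nat.find hex
  have hlt : ∀ k < ℓ, g k < g (k + 1) := fun k hk =>
    lt_of_le_of_ne (hg (Nat.le_succ k)) (Ne.symm (hmin k hk))
  refine ⟨ℓ, ⟨hspec, fun k hk => Nat.find_min' hex hk⟩, fun k hk => ?_,
    fun k hk => (hlt k hk).trans_le (hg hk), ?_⟩
  · have h2 : ∀ j, g (ℓ + j + 1) = g (ℓ + j) ∧ g (ℓ + j) = g ℓ := by
      intro j
      induction j with
      | zero => exact ⟨hspec, rfl⟩
      | succ j ih => exact ⟨hstep _ ih.1, ih.1.trans ih.2⟩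
    have := (h2 (k - ℓ)).2
    rwa [Nat.add_sub_cancel' hk] at this
  · have h2 : ∀ k ≤ ℓ, g 0 + k ≤ g k := by
      intro k
      induction k with
      | zero => simp
      | succ k ih =>
        intro hk
        have h3 := ih (by omega)
        have h4 := hlt k (by omega)
        omega
    exact h2 ℓ le_rfl

/-- A nonzero minor persists nearby, and the locally constant generic rank bounds the rank above. -/
theorem eventually_rankAt_eq {σ κ : Type*} [Fintype σ] [Fintype κ] [DecidableEq σ]
    [DecidableEq κ] {f : (σ → ℂ) → (κ → ℂ)} {x : σ → ℂ} (hf : AnalyticAt ℂ f x)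
    (h : rankAt f x = genericRank f x) : ∀ᶠ y in 𝓝 x, rankAt f y = rankAt f x := by
  obtain ⟨r, s, hrs⟩ := (le_rankAt_iff hf.differentiableAt _).1 (le_refl (rankAt f x))
  filter_upwards [eventually_genericRank_eq hf, hf.eventually_analyticAt,
    (analyticAt_jacobianMinor hf r s).continuousAt.eventually_ne hrs] with y h1 h2 h3
  refine le_antisymm ?_ ((le_rankAt_iff h2.differentiableAt _).2 ⟨r, s, h3⟩)
  rw [h, ← h1]
  exact rankAt_le_genericRank h2

variable {ι : Type*} [Fintype ι] {c : Regularity} {M : Set (ι → ℂ)} {m d : ℕ}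
  {q : ι → ℂ} {h : (ι → ℂ) → CoordSpace m d} {Θ : Fin d → ComplexifiedSpace m d → ℂ}

theorem IsLocallyRepresentedBy.rankAt_segreJet_zero (H : IsLocallyRepresentedBy M q h Θ)
    (hM : IsGenericSubmanifold c d M) (hq : q ∈ M) :
    rankAt (segreJet Θ 0) (realPoint (h q)) = m + d := by
  have h1 := rankAt_segreJet_add_finrank H.regular 0
  rw [H.finrank_segreKer_zero hM hq] at h1
  omega

theorem IsLocallyRepresentedBy.genericRank_segreJet_zero (H : IsLocallyRepresentedBy M q h Θ)
    (hM : IsGenericSubmanifold c d M) (hq : q ∈ M) :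
    genericRank (segreJet Θ 0) (realPoint (h q)) = m + d := by
  refine le_antisymm ?_ ?_
  · obtain ⟨x, h1, h2, h3⟩ := (((H.le_genericRank_iff hM hq 0 _).1 le_rfl).and_eventually
      ((H.eventually.filter_mono nhdsWithin_le_nhds).and self_mem_nhdsWithin)).exists
    rwa [h2.rankAt_segreJet_zero hM h3] at h1
  · rw [← H.rankAt_segreJet_zero hM hq]
    exact rankAt_le_genericRank (analyticAt_segreJet H.regular 0)

/-- The generic ranks of the jet mappings of a connected generic submanifold. -/
theorem IsGenericSubmanifold.exists_genericRank_stable (hM : IsGenericSubmanifold c d M)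
    (hconn : IsConnected M) (hcard : Fintype.card ι = m + d) :
    ∃ (g : ℕ → ℕ) (ℓ : ℕ), Monotone g ∧ g 0 = m + d ∧ (∀ k, g k ≤ m + (m + d)) ∧
      IsLeast {k | g (k + 1) = g k} ℓ ∧ (∀ k ≥ ℓ, g k = g ℓ) ∧ (∀ k < ℓ, g k < g ℓ) ∧
      g 0 + ℓ ≤ g ℓ ∧ ∀ q ∈ M, ∀ (h : (ι → ℂ) → CoordSpace m d)
        (Θ : Fin d → ComplexifiedSpace m d → ℂ), IsLocallyRepresentedBy M q h Θ →
          ∀ k, genericRank (segreJet Θ k) (realPoint (h q)) = g k := by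
  obtain ⟨g, hg⟩ := hM.exists_genericRank_eq hconn.isPreconnected hcard
  obtain ⟨p, hp⟩ := hconn.nonempty
  obtain ⟨h, Θ, HR⟩ := hM.exists_isRepresentedBy hp hcard
  have H := HR.isLocallyRepresentedBy
  have hgp := hg p hp h Θ H
  have hmono : Monotone g := fun k l hkl => by
    rw [← hgp, ← hgp]
    exact genericRank_segreJet_mono H.regular hkl
  have hN : ∀ k, g k ≤ m + (m + d) := fun k => by
    rw [← hgp]
    obtain ⟨y, hy⟩ := ((le_genericRank_iff (f := segreJet Θ k) _).1 le_rfl).exists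
    refine hy.trans ((rankAt_le_card _ _).trans (by simp))
  obtain ⟨ℓ, h1, h2, h3, h4⟩ := exists_stabilization hmono hN fun k hk => by
    rw [← hgp, ← hgp] at hk ⊢
    exact genericRank_segreJet_stable H.regular hk
  exact ⟨g, ℓ, hmono, by rw [← hgp, H.genericRank_segreJet_zero hM hp], hN, h1, h2, h3, h4, hg⟩

variable {g : ℕ → ℕ} {ℓ : ℕ}

/-- Away from the degeneracy set the jet mappings attain their generic ranks. -/
theorem IsLocallyRepresentedBy.rankAt_eq_of_notMem_degeneracySet
    (H : IsLocallyRepresentedBy M q h Θ) (hM : IsGenericSubmanifold c d M) (hq : q ∈ M)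
    (hqE : q ∉ degeneracySet M m d ℓ g)
    (hg : ∀ k, genericRank (segreJet Θ k) (realPoint (h q)) = g k)
    (hstab : ∀ k ≥ ℓ, g k = g ℓ) (k : ℕ) :
    rankAt (segreJet Θ k) (realPoint (h q)) = g k := by
  rw [H.mem_degeneracySet_iff hM hq] at hqE
  push Not at hqE
  have hle : ∀ k, rankAt (segreJet Θ k) (realPoint (h q)) ≤ g k := fun k => by
    rw [← hg]
    exact rankAt_le_genericRank (analyticAt_segreJet H.regular k)
  refine le_antisymm (hle k) ?_
  rcases le_total k ℓ with hk | hk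
  · exact hqE k hk
  · rw [hstab k hk]
    exact (hqE ℓ le_rfl).trans (rankAt_segreJet_mono H.regular hk)

/-- The local product structure away from the degeneracy set. -/
theorem IsGenericSubmanifold.exists_isLocalProductAt_of_notMem_degeneracySet
    (hM : IsGenericSubmanifold c d M) (hcard : Fintype.card ι = m + d) (hq : q ∈ M)
    (hqE : q ∉ degeneracySet M m d ℓ g)
    (hg : ∀ (h : (ι → ℂ) → CoordSpace m d) (Θ : Fin d → ComplexifiedSpace m d → ℂ),
      IsLocallyRepresentedBy M q h Θ → ∀ k, genericRank (segreJet Θ k) (realPoint (h q)) = g k)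
    (hleast : IsLeast {k | g (k + 1) = g k} ℓ) (hstab : ∀ k ≥ ℓ, g k = g ℓ)
    (hlt : ∀ k < ℓ, g k < g ℓ) {a b : ℕ} (ha : g ℓ = m + a) (hab : m + d = a + b)
    (hda : d ≤ a) :
    ∃ (P : (ι → ℂ) → CoordSpace a b) (M' : Set (Fin a → ℂ)), IsGenericSubmanifold c d M' ∧
      IsLocalProductAt c M q P M' ∧ IsFinitelyNondegenerateAt c d M' 0 ℓ ∧
      HasEssentialDimensionAt c d M' 0 a := by
  obtain ⟨h, Θ, HR⟩ := hM.exists_isRepresentedBy hq hcard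
  have H := HR.isLocallyRepresentedBy
  have hrank := H.rankAt_eq_of_notMem_degeneracySet hM hq hqE (hg h Θ H) hstab
  -- The rank is m + a near 0, so the kernel has dimension m + (m + d) - (m + a) = b.
  have hfin : ∀ k ≥ ℓ, ∀ᶠ y in 𝓝 (0 : ComplexifiedSpace m d),
      Module.finrank ℂ (segreKer Θ k y) = b := by
    intro k hk
    have h1 := eventually_rankAt_eq (analyticAt_segreJet H.regular k)
      ((hrank k).trans (hg h Θ H k).symm)
    have h2 : ∀ᶠ y in 𝓝 (realPoint (h q)), ∀ j, AnalyticAt ℂ (Θ j) y :=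
      eventually_all.2 fun j => (H.regular j).eventually_analyticAt
    rw [hrank k, hstab k hk] at h1
    rw [HR.center, map_zero] at h1 h2
    filter_upwards [h1, h2] with y h3 h4
    have := rankAt_segreJet_add_finrank h4 k
    omega
  obtain ⟨P, M', h0M', hM', HP⟩ := HR.exists_isLocalProductAt hM hq hab (hfin ℓ le_rfl)
    (hfin (ℓ + 1) (Nat.le_succ ℓ))
  have hex : ∃ (m' : ℕ) (h' : (Fin a → ℂ) → CoordSpace m' d)
      (Θ' : Fin d → ComplexifiedSpace m' d → ℂ), IsRepresentedBy c M' 0 h' Θ' :=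
    ⟨a - d, hM'.exists_isRepresentedBy h0M' (by simp; omega)⟩
  -- Any representation of M' becomes one of M at q after adding b dummy variables, so both its
  -- ranks at 0 and its generic ranks are those of M lowered by b.
  have hrep : ∀ (m' : ℕ) (h' : (Fin a → ℂ) → CoordSpace m' d)
      (Θ' : Fin d → ComplexifiedSpace m' d → ℂ), IsRepresentedBy c M' 0 h' Θ' →
        a = m' + d ∧ (∀ k, rankAt (segreJet Θ' k) 0 + b = g k) ∧
          ∀ k, genericRank (segreJet Θ' k) 0 + b = g k := by
    intro m' h' Θ' HR'
    have ham : a = m' + d := by simpa using HR'.isLocallyRepresentedBy.card_eq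
    obtain rfl : m = m' + b := by omega
    obtain ⟨h₁, hh₁, H₁⟩ := HP.isLocallyRepresentedBy HR'
    have hr := H₁.rankAt_eq_of_notMem_degeneracySet hM hq hqE (hg _ _ H₁) hstab
    have hgr := hg _ _ H₁
    rw [hh₁, map_zero] at hr hgr
    have hΘ' : ∀ j, AnalyticAt ℂ (Θ' j) 0 := fun j => (HR'.regular j).1
    refine ⟨ham, fun k => ?_, fun k => ?_⟩
    · rw [← hr, rankAt_segreJet_extendTheta (by rwa [map_zero]), map_zero]
    · rw [← hgr, genericRank_segreJet_extendTheta hΘ']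
  refine ⟨P, M', hM', HP, ⟨hex, fun m' h' Θ' HR' => ?_⟩, ⟨hex, fun m' h' Θ' HR' => ⟨ℓ, ?_, ?_⟩⟩⟩
  · obtain ⟨h1, h2, -⟩ := hrep m' h' Θ' HR'
    have hΘ' : ∀ j, AnalyticAt ℂ (Θ' j) (tangentInr 0) := fun j => by
      rw [map_zero]
      exact (HR'.regular j).1
    -- Full rank of the Segre mapping means a trivial kernel, that is, rank m' + (m' + d) for the
    -- jet mapping; adding b gives m + a = g ℓ.
    have hiff : ∀ k, rankAt (segreMap Θ' k) 0 = m' + d ↔ g k = g ℓ := by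
      intro k
      have h3 := rankAt_segreMap_add_finrank hΘ' k
      have h4 := rankAt_segreJet_add_finrank hΘ' k
      rw [map_zero] at h3 h4
      have h5 := h2 k
      omega
    exact ⟨(hiff ℓ).2 rfl, fun k hk => not_lt.1 fun hkℓ => (hlt k hkℓ).ne ((hiff k).1 hk)⟩
  · obtain ⟨-, -, h3⟩ := hrep m' h' Θ' HR'
    have : {k : ℕ | genericRank (segreJet Θ' (k + 1)) 0 = genericRank (segreJet Θ' k) 0} =
        {k | g (k + 1) = g k} := by
      ext k
      rw [Set.mem_ofPred_eq, Set.mem_ofPred_eq, ← h3, ← h3, Nat.add_right_cancel_iff]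
    unfold IsLeviType
    rwa [this]
  · obtain ⟨h1, -, h3⟩ := hrep m' h' Θ' HR'
    have := h3 ℓ
    omega

end Stabilization

end SegreJets

end

/-! ### Assembly of the theorem. -/

theorem theorem3p5p48 (c : SegreJets.Regularity) (n m d : ℕ) (hd : 1 ≤ d) (hm : 1 ≤ m)
    (hn : n = m + d) (M : Set (Fin n → ℂ)) (hconn : IsConnected M)
    (hM : SegreJets.IsGenericSubmanifold c d M) :
    ∃ (nM ℓM : ℕ) (lam : ℕ → ℕ),
      -- the integers are well defined: they are the generic-rank invariants of `M` at every
      -- point and in all coordinates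
      (∀ p ∈ M, ∀ (h : (Fin n → ℂ) → SegreJets.CoordSpace m d)
        (Θ : Fin d → SegreJets.ComplexifiedSpace m d → ℂ),
        SegreJets.IsRepresentedBy c M p h Θ →
          SegreJets.IsLeviType Θ ℓM ∧ SegreJets.IsEssentialDimension Θ nM ∧
          SegreJets.IsLeviMultitype Θ ℓM lam) ∧
      lam 0 = d ∧ d ≤ nM ∧ nM ≤ n ∧ ℓM ≤ nM - d ∧
      nM = d + ∑ i ∈ Finset.Icc 1 ℓM, lam i ∧
      ∃ E : Set (Fin n → ℂ), SegreJets.IsRealSubvariety c M E ∧ E ≠ M ∧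
        ∀ p ∈ M \ E,
          (∀ (h : (Fin n → ℂ) → SegreJets.CoordSpace m d)
            (Θ : Fin d → SegreJets.ComplexifiedSpace m d → ℂ),
            SegreJets.IsRepresentedBy c M p h Θ →
              (∀ k ≤ ℓM, SegreJets.rankAt (SegreJets.segreJet Θ k) 0 =
                m + ∑ i ∈ Finset.range (k + 1), lam i) ∧
              (∀ k ≥ ℓM, SegreJets.rankAt (SegreJets.segreJet Θ k) 0 = m + nM)) ∧
          ∃ (h : (Fin n → ℂ) → SegreJets.CoordSpace nM (n - nM)) (M' : Set (Fin nM → ℂ)),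
            SegreJets.IsGenericSubmanifold c d M' ∧
            SegreJets.IsLocalProductAt c M p h M' ∧
            SegreJets.IsFinitelyNondegenerateAt c d M' 0 ℓM ∧
            SegreJets.HasEssentialDimensionAt c d M' 0 nM := by
  have hcard : Fintype.card (Fin n) = m + d := by rw [Fintype.card_fin, hn]
  obtain ⟨g, ℓ, hmono, hg0, hgN, hleast, hstab, hlt, hgℓ, hg⟩ :=
    hM.exists_genericRank_stable hconn hcard
  have hgℓN := hgN ℓ
  have hcenter : ∀ p ∈ M, ∀ (h : (Fin n → ℂ) → SegreJets.CoordSpace m d)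
      (Θ : Fin d → SegreJets.ComplexifiedSpace m d → ℂ), SegreJets.IsRepresentedBy c M p h Θ →
        ∀ k, SegreJets.genericRank (SegreJets.segreJet Θ k) 0 = g k := by
    intro p hp h Θ H k
    have := hg p hp h Θ H.isLocallyRepresentedBy k
    rwa [H.center, map_zero] at this
  -- The value at 0 is the growth from m to g 0 = m + d. Monotonicity of g makes the other
  -- subtractions exact.
  let lam : ℕ → ℕ := fun k => if k = 0 then d else g k - g (k - 1)
  have hlam0 : lam 0 = d := rfl
  have hlam : ∀ k, g (k + 1) = g k + lam (k + 1) := fun k =>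
    (Nat.add_sub_cancel' (hmono (Nat.le_succ k))).symm
  have hsum : ∀ k, g k = m + ∑ i ∈ Finset.range (k + 1), lam i := by
    intro k
    induction k with
    | zero => simp [hg0, hlam0]
    | succ k ih => rw [Finset.sum_range_succ, hlam, ih, add_assoc]
  have hsum' : ∀ k, g k = m + (d + ∑ i ∈ Finset.Icc 1 k, lam i) := by
    intro k
    induction k with
    | zero => simp [hg0]
    | succ k ih => rw [Finset.sum_Icc_succ_top (by omega), hlam, ih]; ring
  have hn' : m + (g ℓ - m) = g ℓ := by omega
  refine ⟨g ℓ - m, ℓ, lam, fun p hp h Θ H => ?_, hlam0, by omega, by omega, by omega, ?_,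
    SegreJets.degeneracySet M m d ℓ g, SegreJets.isRealSubvariety_degeneracySet hM hcard ℓ g,
    SegreJets.degeneracySet_ne hM hconn.nonempty hcard ℓ hg, fun p hp => ⟨fun h Θ H => ?_, ?_⟩⟩
  · have hgp := hcenter p hp h Θ H
    have hlevi : SegreJets.IsLeviType Θ ℓ := by
      unfold SegreJets.IsLeviType
      simp only [hgp]
      exact hleast
    refine ⟨hlevi, ⟨ℓ, hlevi, by rw [hgp, hn']⟩, by rw [hgp, hg0, hlam0], fun k _ => ?_⟩
    rw [hgp, hgp, hlam]
  · have := hsum' ℓ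
    omega
  · have hr := H.isLocallyRepresentedBy.rankAt_eq_of_notMem_degeneracySet hM hp.1 hp.2
      (hg p hp.1 h Θ H.isLocallyRepresentedBy) hstab
    rw [H.center, map_zero] at hr
    exact ⟨fun k _ => (hr k).trans (hsum k), fun k hk => by rw [hr, hstab k hk, hn']⟩
  · exact hM.exists_isLocalProductAt_of_notMem_degeneracySet hcard hp.1 hp.2
      (hg p hp.1) hleast hstab hlt hn'.symm (by omega) (by omega)
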